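/- Let $M$ be a compact smooth manifold of real dimension $4$ without boundary (not necessarily connected), let $g$ be a smooth Riemannian metric on $M$, and let $J$ be a smooth almost complex structure on $M$ ($J^2=-\mathrm{Id}$) which is $g$-orthogonal, i.e. $g(JX,JY)=g(X,Y)$. Let $\omega(X,Y)=g(JX,Y)$ be the fundamental $2$-form, and let $\theta$ be the Lee form, $\theta = J\delta\omega$ (equivalently, $d\omega=\theta\wedge\omega$), where $\delta$ is the codifferential of $g$ and $(J\alpha)(X)=-\alpha(JX)$ for a $1$-form $\alpha$. Let $R$ be the Riemannian curvature tensor and $s$ the scalar curvature of $g$. Assume that $(M,g,J,\omega)$ is of class $\mathcal{AH}_1$, that is, that it satisfies the first Gray curvature condition $$R(X,Y,Z,W)=R(X,Y,JZ,JW)$$ for all $p\in M$ and all $X,Y,Z,W\in T_pM$, and assume that $s(p)\neq 0$ for every $p\in M$. Then $\delta\theta=0$ on $M$, i.e. the almost Hermitian structure is Gauduchon. -/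

import Mathlib

open scoped Manifold ContDiff

noncomputable section

/-- The model space `ℝ⁴`. -/
abbrev R4 : Type := EuclideanSpace ℝ (Fin 4)

/-! ### Tensor calculus in local coordinates

Here `G` is the matrix-valued function `y ↦ (g_{ij}(y))` of the components of a Riemannian metric
in a coordinate system on an open subset of `ℝ⁴`, and `A` is the matrix-valued function
`y ↦ (J^i_j(y))` of the components of an endomorphism field (`J ∂_j = ∑ i, J^i_j ∂_i`), with the
upper index as row index. -/

namespace Coord

/-- The partial derivative `∂_i f`. -/
def pderiv (i : Fin 4) (f : R4 → ℝ) (y : R4) : ℝ :=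
  fderiv ℝ f y (EuclideanSpace.single i 1)

/-- Christoffel symbols of the Levi-Civita connection, `∇_{∂_i} ∂_j = ∑ k, Γ^k_{ij} ∂_k`:
`Γ^k_{ij} = ½ ∑ l, g^{kl} (∂_i g_{jl} + ∂_j g_{il} - ∂_l g_{ij})`. -/
def christoffel (G : R4 → Matrix (Fin 4) (Fin 4) ℝ) (k i j : Fin 4) (y : R4) : ℝ :=
  (1 / 2) * ∑ l, (G y)⁻¹ k l *
    (pderiv i (fun z => G z j l) y + pderiv j (fun z => G z i l) y
      - pderiv l (fun z => G z i j) y)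

/-- The curvature `R(X, Y) Z = ∇_X ∇_Y Z - ∇_Y ∇_X Z - ∇_{[X, Y]} Z` in components:
`R(∂_i, ∂_j) ∂_k = ∑ l, (curvature G i j k l) ∂_l`. -/
def curvature (G : R4 → Matrix (Fin 4) (Fin 4) ℝ) (i j k l : Fin 4) (y : R4) : ℝ :=
  pderiv i (christoffel G l j k) y - pderiv j (christoffel G l i k) y
    + ∑ m, (christoffel G l i m y * christoffel G m j k y
      - christoffel G l j m y * christoffel G m i k y)

/-- The `(0, 4)` curvature tensor `R_{ijkl} = g(R(∂_i, ∂_j) ∂_k, ∂_l)`. -/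
def riemann (G : R4 → Matrix (Fin 4) (Fin 4) ℝ) (i j k l : Fin 4) (y : R4) : ℝ :=
  ∑ m, curvature G i j k m y * G y m l

/-- The Ricci tensor `Ric(∂_j, ∂_k) = tr (X ↦ R(X, ∂_j) ∂_k)`. -/
def ricci (G : R4 → Matrix (Fin 4) (Fin 4) ℝ) (j k : Fin 4) (y : R4) : ℝ :=
  ∑ i, curvature G i j k i y

/-- The scalar curvature `s = ∑ g^{jk} Ric_{jk}`. -/
def scalar (G : R4 → Matrix (Fin 4) (Fin 4) ℝ) (y : R4) : ℝ :=
  ∑ j, ∑ k, (G y)⁻¹ j k * ricci G j k y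

/-- The covariant derivative of a 1-form, `(∇_{∂_i} α)(∂_j)`. -/
def nablaOne (G : R4 → Matrix (Fin 4) (Fin 4) ℝ) (α : Fin 4 → R4 → ℝ)
    (i j : Fin 4) (y : R4) : ℝ :=
  pderiv i (α j) y - ∑ k, christoffel G k i j y * α k y

/-- The covariant derivative of a covariant 2-tensor, `(∇_{∂_i} β)(∂_j, ∂_k)`. -/
def nablaTwo (G : R4 → Matrix (Fin 4) (Fin 4) ℝ) (β : Fin 4 → Fin 4 → R4 → ℝ)
    (i j k : Fin 4) (y : R4) : ℝ :=
  pderiv i (β j k) y - ∑ m, christoffel G m i j y * β m k y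
    - ∑ m, christoffel G m i k y * β j m y

/-- The codifferential of a 1-form, `δα = - ∑ g^{ij} (∇_{∂_i} α)(∂_j)`. -/
def codiffOne (G : R4 → Matrix (Fin 4) (Fin 4) ℝ) (α : Fin 4 → R4 → ℝ) (y : R4) : ℝ :=
  - ∑ i, ∑ j, (G y)⁻¹ i j * nablaOne G α i j y

/-- The codifferential of a 2-form, `(δβ)(∂_k) = - ∑ g^{ij} (∇_{∂_i} β)(∂_j, ∂_k)`. -/
def codiffTwo (G : R4 → Matrix (Fin 4) (Fin 4) ℝ) (β : Fin 4 → Fin 4 → R4 → ℝ)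
    (k : Fin 4) (y : R4) : ℝ :=
  - ∑ i, ∑ j, (G y)⁻¹ i j * nablaTwo G β i j k y

/-- The fundamental form `ω(∂_i, ∂_j) = g(J ∂_i, ∂_j)`. -/
def fundamentalForm (G A : R4 → Matrix (Fin 4) (Fin 4) ℝ) (i j : Fin 4) (y : R4) : ℝ :=
  ∑ k, A y k i * G y k j

/-- The Lee form `θ = J δω`, where `(J α)(X) = - α(J X)` for a 1-form `α`. -/
def leeForm (G A : R4 → Matrix (Fin 4) (Fin 4) ℝ) (i : Fin 4) (y : R4) : ℝ :=
  - ∑ k, A y k i * codiffTwo G (fundamentalForm G A) k y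

end Coord

/-! ### Almost Hermitian 4-manifolds -/

/-- An almost Hermitian structure on a smooth 4-manifold: a smooth Riemannian metric `g` and a
smooth `g`-orthogonal almost complex structure `J`. -/
structure AlmostHermitian (M : Type*) [TopologicalSpace M] [ChartedSpace R4 M]
    [IsManifold 𝓘(ℝ, R4) ∞ M] where
  /-- the Riemannian metric -/
  g : Bundle.ContMDiffRiemannianMetric 𝓘(ℝ, R4) ∞ R4
    (fun x : M => TangentSpace 𝓘(ℝ, R4) x)
  /-- the almost complex structure -/
  J : ∀ x : M, TangentSpace 𝓘(ℝ, R4) x →L[ℝ] TangentSpace 𝓘(ℝ, R4) x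
  smooth_J : ContMDiff 𝓘(ℝ, R4) (𝓘(ℝ, R4).prod 𝓘(ℝ, R4 →L[ℝ] R4)) ∞
    (fun x : M => Bundle.TotalSpace.mk' (R4 →L[ℝ] R4)
      (E := fun x : M => TangentSpace 𝓘(ℝ, R4) x →L[ℝ] TangentSpace 𝓘(ℝ, R4) x) x (J x))
  J_sq : ∀ (x : M) (v : TangentSpace 𝓘(ℝ, R4) x), J x (J x v) = -v
  J_orthogonal : ∀ (x : M) (v w : TangentSpace 𝓘(ℝ, R4) x),
    g.inner x (J x v) (J x w) = g.inner x v w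

namespace AlmostHermitian

variable {M : Type*} [TopologicalSpace M] [ChartedSpace R4 M] [IsManifold 𝓘(ℝ, R4) ∞ M]

/-- The coordinate vector field `∂_i` of the chart `e`, at the point with coordinates `y`. -/
def coordVector (e : OpenPartialHomeomorph M R4) (y : R4) (i : Fin 4) :
    TangentSpace 𝓘(ℝ, R4) (e.symm y) :=
  mfderiv 𝓘(ℝ, R4) 𝓘(ℝ, R4) e.symm y (EuclideanSpace.single i (1 : ℝ) : R4)

/-- The components `g_{ij} = g(∂_i, ∂_j)` of the metric in the chart `e`. -/
def metricMatrix (S : AlmostHermitian M) (e : OpenPartialHomeomorph M R4) (y : R4) :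
    Matrix (Fin 4) (Fin 4) ℝ :=
  Matrix.of fun i j => S.g.inner (e.symm y) (coordVector e y i) (coordVector e y j)

/-- The components `J^i_j = dx^i (J ∂_j)` of the almost complex structure in the chart `e`. -/
def complexMatrix (S : AlmostHermitian M) (e : OpenPartialHomeomorph M R4) (y : R4) :
    Matrix (Fin 4) (Fin 4) ℝ :=
  Matrix.of fun i j =>
    (EuclideanSpace.proj i : R4 →L[ℝ] ℝ)
      (mfderiv 𝓘(ℝ, R4) 𝓘(ℝ, R4) e (e.symm y) (S.J (e.symm y) (coordVector e y j)))

/-- The scalar curvature in the chart `e`, as a function of the coordinates. -/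
def scalarCurvature (S : AlmostHermitian M) (e : OpenPartialHomeomorph M R4) (y : R4) : ℝ :=
  Coord.scalar (S.metricMatrix e) y

/-- The components of the Lee form `θ = J δω` in the chart `e`. -/
def leeForm (S : AlmostHermitian M) (e : OpenPartialHomeomorph M R4) (i : Fin 4) (y : R4) : ℝ :=
  Coord.leeForm (S.metricMatrix e) (S.complexMatrix e) i y

/-- The codifferential `δθ` of the Lee form in the chart `e`, as a function of the coordinates. -/
def codiffLee (S : AlmostHermitian M) (e : OpenPartialHomeomorph M R4) (y : R4) : ℝ :=
  Coord.codiffOne (S.metricMatrix e) (S.leeForm e) y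

/-- The first Gray condition `R(X, Y, Z, W) = R(X, Y, JZ, JW)`, in every chart of the atlas and for
the coordinate vectors at every point of the chart. -/
def IsAH1 (S : AlmostHermitian M) : Prop :=
  ∀ e ∈ atlas R4 M, ∀ y ∈ e.target, ∀ i j k l : Fin 4,
    Coord.riemann (S.metricMatrix e) i j k l y =
      ∑ m, ∑ n, S.complexMatrix e y m k * S.complexMatrix e y n l *
        Coord.riemann (S.metricMatrix e) i j m n y

end AlmostHermitian

end

noncomputable section

/-! ### Calculus of matrix-valued functions on open subsets of `ℝ⁴` -/

/-! Write `B_i = ∇_i J`, `Ω_{ij}` for the curvature endomorphisms and `d^∇` for the exterior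
covariant derivative. The Gray condition says that every `Ω_{ij}` commutes with `J`, so the Ricci
identity gives `d^∇ B = 0` (`covDeriv_nablaJ_symm`). The rest rests on two 2-forms, `ρ = tr(JΩ)` and
`β = tr(J B ∧ B)`, and on a fact special to dimension 4: skew endomorphisms split as `u(2) ⊕ m` with
`m` (the antilinear ones) a plane, so `[S, B]` is a multiple of `JB` and `[B, C]` a multiple of `J`,
with coefficients given by complex traces.

Pointwise consequences. Applying `d^∇` again to `d^∇ B = 0` gives `ρ ∧ JB = 0` (`rho_wedge`).
Pairing this with `B` and contracting with `ω` gives `⟨ρ, ω⟩ β = ⟨β, ω⟩ ρ` (`contr_mul_beta`).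
Contracting it with the metric instead, and using that `ρ` is `J`-invariant, puts the Lee field
`θ^♯` in the kernel of `ρ` (`rho_leeVec`). The algebraic Bianchi identity gives `⟨ρ, ω⟩ = -2s`
(`contr_rhoForm`), which has no zeros. Finally `d^∇(JB) = -½ β J` gives `δθ = -¼ q` with `q = ⟨β,
ω⟩` (`codiffOne_leeForm`), so the goal is `q = 0`.

Differential consequences. Thus `β = fρ` with `f = q / ⟨ρ, ω⟩`. Both forms are closed, so `df ∧ ρ =
0`; inserting `θ^♯` leaves `θ^♯(f) ρ = 0`, hence `θ^♯(f) = 0`. In terms of `q` this reads `θ^♯(q) =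
κ q` with `κ` continuous (`leeVec_contr_beta`).

Global argument. Since `div θ^♯ = q / 4`, integration over the compact manifold gives `∫ θ^♯(v) + ¼
v q = 0` for every smooth `v` (`IsAH1.integral_leeDeriv`). The choice `v = arctan(nq)`, a smooth
approximation of a multiple of the sign of `q`, gives `θ^♯(v) = κ · nq / (1 + n²q²)`, which is
bounded and tends to `0`. So `∫ q arctan(nq) → 0`, whereas for `n ≥ 1` this is at least `∫ q arctan
q ≥ 0`. Hence `q arctan q = 0` and `q = 0`.

Everything is computed with matrices in charts. Only `q` and the Lee field need to be compared
between charts; `ρ`, `s`, `f` and `κ` are used inside one chart at a time. -/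

/-- Real `4 × 4` matrices. -/
abbrev Mat4 : Type := Matrix (Fin 4) (Fin 4) ℝ

namespace Coord

open Matrix

variable {T : Set R4} {f h : R4 → ℝ} {F H : R4 → Mat4} {y : R4}

theorem pderiv_congr {i : Fin 4} (hT : IsOpen T) (hy : y ∈ T) (hfh : ∀ z ∈ T, f z = h z) :
    pderiv i f y = pderiv i h y := by
  unfold pderiv
  rw [Filter.EventuallyEq.fderiv_eq (Filter.eventuallyEq_of_mem (hT.mem_nhds hy) hfh)]

theorem differentiableAt_of_contDiffOn (hT : IsOpen T) (hf : ContDiffOn ℝ ∞ f T) (hy : y ∈ T) :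
    DifferentiableAt ℝ f y :=
  (hf.contDiffAt (hT.mem_nhds hy)).differentiableAt (by simp)

theorem contDiffOn_pderiv (hT : IsOpen T) (hf : ContDiffOn ℝ ∞ f T) (i : Fin 4) :
    ContDiffOn ℝ ∞ (pderiv i f) T := by
  have h1 : ContDiffOn ℝ ∞ (fderiv ℝ f) T := hf.fderiv_of_isOpen hT (by simp)
  exact h1.clm_apply contDiffOn_const

theorem pderiv_const (i : Fin 4) (c : ℝ) : pderiv i (fun _ => c) y = 0 := by
  simp [pderiv]

theorem pderiv_add (i : Fin 4) (hf : DifferentiableAt ℝ f y) (hh : DifferentiableAt ℝ h y) :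
    pderiv i (fun z => f z + h z) y = pderiv i f y + pderiv i h y := by
  unfold pderiv
  rw [fderiv_fun_add hf hh]; rfl

theorem pderiv_sub (i : Fin 4) (hf : DifferentiableAt ℝ f y) (hh : DifferentiableAt ℝ h y) :
    pderiv i (fun z => f z - h z) y = pderiv i f y - pderiv i h y := by
  unfold pderiv
  rw [fderiv_fun_sub hf hh]; rfl

theorem pderiv_mul (i : Fin 4) (hf : DifferentiableAt ℝ f y) (hh : DifferentiableAt ℝ h y) :
    pderiv i (fun z => f z * h z) y = pderiv i f y * h y + f y * pderiv i h y := by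
  unfold pderiv
  rw [fderiv_fun_mul hf hh]
  simp only [_root_.add_apply, _root_.smul_apply, smul_eq_mul]
  ring

theorem pderiv_sum {ι : Type*} (s : Finset ι) (i : Fin 4) {u : ι → R4 → ℝ}
    (hu : ∀ j ∈ s, DifferentiableAt ℝ (u j) y) :
    pderiv i (fun z => ∑ j ∈ s, u j z) y = ∑ j ∈ s, pderiv i (u j) y := by
  unfold pderiv
  rw [fderiv_fun_sum hu]
  simp

theorem pderiv_comm (hT : IsOpen T) (hf : ContDiffOn ℝ ∞ f T) (hy : y ∈ T) (i j : Fin 4) :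
    pderiv i (pderiv j f) y = pderiv j (pderiv i f) y := by
  have hfa : ContDiffAt ℝ ∞ f y := hf.contDiffAt (hT.mem_nhds hy)
  have hs := hfa.isSymmSndFDerivAt (by
    rw [minSmoothness_of_isRCLikeNormedField]; exact WithTop.coe_le_coe.2 le_top)
  have h1 : DifferentiableAt ℝ (fderiv ℝ f) y :=
    (hfa.fderiv_right (m := 1) (by
      rw [one_add_one_eq_two]; exact WithTop.coe_le_coe.2 le_top)).differentiableAt (by simp)
  have key : ∀ v w : R4, fderiv ℝ (fun z => fderiv ℝ f z v) y w = fderiv ℝ (fderiv ℝ f) y w v := by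
    intro v w
    rw [fderiv_clm_apply h1 (differentiableAt_const _)]
    simp
  unfold pderiv
  rw [key, key]
  exact hs _ _

/-- Smoothness of a matrix-valued function on `T`, entry by entry. -/
def SmoothOn (F : R4 → Mat4) (T : Set R4) : Prop :=
  ∀ a b, ContDiffOn ℝ ∞ (fun z => F z a b) T

/-- The entrywise partial derivative of a matrix-valued function. -/
def mderiv (i : Fin 4) (F : R4 → Mat4) (y : R4) : Mat4 :=
  Matrix.of fun a b => pderiv i (fun z => F z a b) y

theorem mderiv_apply (i : Fin 4) (F : R4 → Mat4) (y : R4) (a b : Fin 4) :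
    mderiv i F y a b = pderiv i (fun z => F z a b) y := rfl

theorem SmoothOn.mul (hF : SmoothOn F T) (hH : SmoothOn H T) : SmoothOn (fun z => F z * H z) T := by
  intro a b
  simp only [Matrix.mul_apply]
  exact ContDiffOn.sum fun k _ => (hF a k).mul (hH k b)

theorem SmoothOn.add (hF : SmoothOn F T) (hH : SmoothOn H T) : SmoothOn (fun z => F z + H z) T :=
  fun a b => (hF a b).add (hH a b)

theorem SmoothOn.sub (hF : SmoothOn F T) (hH : SmoothOn H T) : SmoothOn (fun z => F z - H z) T :=
  fun a b => (hF a b).sub (hH a b)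

theorem SmoothOn.transpose (hF : SmoothOn F T) : SmoothOn (fun z => (F z)ᵀ) T :=
  fun a b => hF b a

theorem SmoothOn.mderiv (hT : IsOpen T) (hF : SmoothOn F T) (i : Fin 4) :
    SmoothOn (mderiv i F) T :=
  fun a b => contDiffOn_pderiv hT (hF a b) i

theorem SmoothOn.det (hF : SmoothOn F T) : ContDiffOn ℝ ∞ (fun z => (F z).det) T := by
  simp only [Matrix.det_apply']
  refine ContDiffOn.sum fun σ _ => ?_
  exact contDiffOn_const.mul (contDiffOn_prod fun k _ => hF _ _)

theorem SmoothOn.adjugate (hF : SmoothOn F T) : SmoothOn (fun z => (F z).adjugate) T := by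
  intro a b
  simp only [Matrix.adjugate_apply]
  refine SmoothOn.det (F := fun z => (F z).updateRow b (Pi.single a 1)) fun c d => ?_
  by_cases hc : c = b
  · subst hc; simpa using contDiffOn_const
  · simpa [Matrix.updateRow_ne hc] using hF c d

theorem SmoothOn.inv (hF : SmoothOn F T) (hdet : ∀ z ∈ T, (F z).det ≠ 0) :
    SmoothOn (fun z => (F z)⁻¹) T := by
  intro a b
  have : ∀ z, (F z)⁻¹ a b = ((F z).det)⁻¹ * (F z).adjugate a b := fun z => by
    rw [Matrix.inv_def]; simp
  simp only [this]
  exact (hF.det.inv hdet).mul (hF.adjugate a b)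

theorem SmoothOn.trace (hF : SmoothOn F T) : ContDiffOn ℝ ∞ (fun z => (F z).trace) T := by
  simp only [Matrix.trace, Matrix.diag]
  exact ContDiffOn.sum fun k _ => hF k k

theorem mderiv_congr {i : Fin 4} (hT : IsOpen T) (hy : y ∈ T) (hfh : ∀ z ∈ T, F z = H z) :
    mderiv i F y = mderiv i H y := by
  ext a b
  exact pderiv_congr hT hy fun z hz => by rw [hfh z hz]

theorem mderiv_mul (hT : IsOpen T) (hF : SmoothOn F T) (hH : SmoothOn H T) (hy : y ∈ T)
    (i : Fin 4) :
    mderiv i (fun z => F z * H z) y = mderiv i F y * H y + F y * mderiv i H y := by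
  ext a b
  have dF := fun a b => differentiableAt_of_contDiffOn hT (hF a b) hy
  have dH := fun a b => differentiableAt_of_contDiffOn hT (hH a b) hy
  simp only [mderiv_apply, Matrix.mul_apply, Matrix.add_apply]
  rw [pderiv_sum _ _ fun k _ => (dF a k).fun_mul (dH k b), ← Finset.sum_add_distrib]
  exact Finset.sum_congr rfl fun k _ => pderiv_mul i (dF a k) (dH k b)

theorem mderiv_add (hT : IsOpen T) (hF : SmoothOn F T) (hH : SmoothOn H T) (hy : y ∈ T)
    (i : Fin 4) :
    mderiv i (fun z => F z + H z) y = mderiv i F y + mderiv i H y := by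
  ext a b
  exact pderiv_add i (differentiableAt_of_contDiffOn hT (hF a b) hy)
    (differentiableAt_of_contDiffOn hT (hH a b) hy)

theorem mderiv_sub (hT : IsOpen T) (hF : SmoothOn F T) (hH : SmoothOn H T) (hy : y ∈ T)
    (i : Fin 4) :
    mderiv i (fun z => F z - H z) y = mderiv i F y - mderiv i H y := by
  ext a b
  exact pderiv_sub i (differentiableAt_of_contDiffOn hT (hF a b) hy)
    (differentiableAt_of_contDiffOn hT (hH a b) hy)

theorem mderiv_transpose (i : Fin 4) (F : R4 → Mat4) (y : R4) :
    mderiv i (fun z => (F z)ᵀ) y = (mderiv i F y)ᵀ := rfl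

theorem mderiv_const (i : Fin 4) (c : Mat4) : mderiv i (fun _ => c) y = 0 := by
  ext a b
  exact pderiv_const i _

theorem mderiv_comm (hT : IsOpen T) (hF : SmoothOn F T) (hy : y ∈ T) (i j : Fin 4) :
    mderiv i (mderiv j F) y = mderiv j (mderiv i F) y := by
  ext a b
  exact pderiv_comm hT (hF a b) hy i j

theorem pderiv_trace (hT : IsOpen T) (hF : SmoothOn F T) (hy : y ∈ T) (i : Fin 4) :
    pderiv i (fun z => (F z).trace) y = (mderiv i F y).trace := by
  simp only [Matrix.trace, Matrix.diag]
  exact pderiv_sum _ _ fun k _ => differentiableAt_of_contDiffOn hT (hF k k) hy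

/-- Jacobi's formula for the derivative of the determinant. -/
theorem pderiv_det (hT : IsOpen T) (hF : SmoothOn F T) (hy : y ∈ T) (i : Fin 4) :
    pderiv i (fun z => (F z).det) y = ((F y).adjugate * mderiv i F y).trace := by
  have dF := fun a b => differentiableAt_of_contDiffOn hT (hF a b) hy
  have h1 : ∀ σ : Equiv.Perm (Fin 4), HasFDerivAt (fun z => ∏ k, F z (σ k) k)
      (∑ k, (∏ j ∈ Finset.univ.erase k, F y (σ j) j) • fderiv ℝ (fun z => F z (σ k) k) y) y :=
    fun σ => HasFDerivAt.finsetProd fun k _ => (dF (σ k) k).hasFDerivAt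
  have h2 : pderiv i (fun z => (F z).det) y =
      ∑ σ : Equiv.Perm (Fin 4), ((Equiv.Perm.sign σ : ℤ) : ℝ) *
        ∑ k, (∏ j ∈ Finset.univ.erase k, F y (σ j) j) * mderiv i F y (σ k) k := by
    simp only [Matrix.det_apply']
    rw [pderiv_sum _ _ fun σ _ => ((h1 σ).const_mul ((Equiv.Perm.sign σ : ℤ) : ℝ)).differentiableAt]
    refine Finset.sum_congr rfl fun σ _ => ?_
    unfold pderiv
    rw [((h1 σ).const_mul ((Equiv.Perm.sign σ : ℤ) : ℝ)).fderiv]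
    simp [mderiv_apply, pderiv]
  rw [h2]
  -- By Cramer's rule the trace is a sum of determinants in which one column is replaced by its
  -- derivative; this is the Leibniz expansion regrouped by the differentiated column.
  have h3 : ((F y).adjugate * mderiv i F y).trace =
      ∑ k, ((F y).updateCol k fun a => mderiv i F y a k).det := by
    simp only [Matrix.trace, Matrix.diag, Matrix.mul_apply]
    refine Finset.sum_congr rfl fun k _ => ?_
    rw [← Matrix.cramer_apply, Matrix.cramer_eq_adjugate_mulVec]
    rfl
  rw [h3]
  simp only [Matrix.det_apply', Finset.mul_sum]
  rw [Finset.sum_comm]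
  refine Finset.sum_congr rfl fun k _ => Finset.sum_congr rfl fun σ _ => ?_
  congr 1
  rw [← Finset.mul_prod_erase _ _ (Finset.mem_univ k), mul_comm]
  congr 1
  · simp
  · refine Finset.prod_congr rfl fun j hj => ?_
    rw [Matrix.updateCol_ne (Finset.ne_of_mem_erase hj)]

end Coord

namespace Coord

open Matrix

/-! ### The Levi-Civita connection and its curvature in matrix form -/

/-- `G` is a smooth field of positive definite symmetric matrices on `T`. -/
structure IsMetricOn (G : R4 → Mat4) (T : Set R4) : Prop where
  isOpen : IsOpen T
  smooth : SmoothOn G T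
  posDef : ∀ y ∈ T, (G y).PosDef

/-- The connection matrices `(Γ_i)^k_j = Γ^k_{ij}`. -/
def conn (G : R4 → Mat4) (i : Fin 4) (y : R4) : Mat4 :=
  Matrix.of fun k j => christoffel G k i j y

/-- The curvature matrices `Ω_{ij}`, with `R(∂_i, ∂_j) ∂_k = ∑ l, (Ω_{ij})^l_k ∂_l`. -/
def curvMat (G : R4 → Mat4) (i j : Fin 4) (y : R4) : Mat4 :=
  mderiv i (conn G j) y - mderiv j (conn G i) y
    + (conn G i y * conn G j y - conn G j y * conn G i y)

/-- The covariant derivative of an endomorphism field. -/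
def covDeriv (G : R4 → Mat4) (i : Fin 4) (X : R4 → Mat4) (y : R4) : Mat4 :=
  mderiv i X y + (conn G i y * X y - X y * conn G i y)

variable {G : R4 → Mat4} {T : Set R4} {X Y : R4 → Mat4} {y : R4}

theorem curvMat_apply (G : R4 → Mat4) (i j k l : Fin 4) (y : R4) :
    curvMat G i j y l k = curvature G i j k l y := by
  simp only [curvMat, curvature, Matrix.add_apply, Matrix.sub_apply, Matrix.mul_apply,
    Finset.sum_sub_distrib]
  rfl

theorem riemann_eq (G : R4 → Mat4) (i j k l : Fin 4) (y : R4) :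
    riemann G i j k l y = ((curvMat G i j y)ᵀ * G y) k l := by
  simp only [riemann, Matrix.mul_apply, Matrix.transpose_apply, curvMat_apply]

namespace IsMetricOn

variable (hG : IsMetricOn G T)
include hG

theorem transpose_eq (hy : y ∈ T) : (G y)ᵀ = G y := by
  simpa using (hG.posDef y hy).isHermitian.eq

theorem apply_comm (hy : y ∈ T) (i j : Fin 4) : G y i j = G y j i := by
  conv_lhs => rw [← hG.transpose_eq hy]
  rfl

theorem det_ne_zero (hy : y ∈ T) : (G y).det ≠ 0 := (hG.posDef y hy).det_pos.ne'

theorem isUnit_det (hy : y ∈ T) : IsUnit (G y).det := (hG.det_ne_zero hy).isUnit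

theorem smooth_inv : SmoothOn (fun z => (G z)⁻¹) T := hG.smooth.inv fun _ hz => hG.det_ne_zero hz

theorem inv_transpose (hy : y ∈ T) : ((G y)⁻¹)ᵀ = (G y)⁻¹ := by
  rw [Matrix.transpose_nonsing_inv, hG.transpose_eq hy]

theorem mderiv_apply_comm (hy : y ∈ T) (l i j : Fin 4) :
    mderiv l G y i j = mderiv l G y j i :=
  pderiv_congr hG.isOpen hy fun _ hz => hG.apply_comm hz i j

theorem conn_symm (hy : y ∈ T) (i j k : Fin 4) : conn G i y k j = conn G j y k i := by
  have h := hG.mderiv_apply_comm hy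
  simp only [mderiv_apply] at h
  simp only [conn, christoffel, Matrix.of_apply]
  congr 1
  refine Finset.sum_congr rfl fun l _ => ?_
  rw [h l i j]
  ring

/-- The Christoffel symbols with the upper index lowered: no inverse metric remains, so identities
about the connection become linear in the derivatives of the metric. -/
theorem mul_conn_apply (hy : y ∈ T) (i j l : Fin 4) :
    (G y * conn G i y) l j =
      (1 / 2) * (mderiv i G y j l + mderiv j G y i l - mderiv l G y i j) := by
  have : conn G i y = (G y)⁻¹ * Matrix.of fun l j =>
      (1 / 2) * (mderiv i G y j l + mderiv j G y i l - mderiv l G y i j) := by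
    ext k j
    simp only [conn, christoffel, Matrix.of_apply, Matrix.mul_apply, Finset.mul_sum, mderiv_apply]
    refine Finset.sum_congr rfl fun l _ => ?_
    ring
  rw [this, Matrix.mul_nonsing_inv_cancel_left _ _ (hG.isUnit_det hy)]
  rfl

/-- The Levi-Civita connection preserves the metric. -/
theorem mderiv_eq (hy : y ∈ T) (i : Fin 4) :
    mderiv i G y = (conn G i y)ᵀ * G y + G y * conn G i y := by
  have h := hG.mderiv_apply_comm hy
  have e : (conn G i y)ᵀ * G y = (G y * conn G i y)ᵀ := by
    rw [Matrix.transpose_mul, hG.transpose_eq hy]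
  ext a b
  rw [e, Matrix.add_apply, Matrix.transpose_apply, hG.mul_conn_apply hy, hG.mul_conn_apply hy,
    h i b a, h a i b, h b i a]
  ring

/-- The Levi-Civita connection is the only torsion-free metric connection. -/
theorem conn_unique (hy : y ∈ T) (Γ : Fin 4 → Mat4) (hsymm : ∀ i j k, Γ i k j = Γ j k i)
    (hcomp : ∀ i, mderiv i G y = (Γ i)ᵀ * G y + G y * Γ i) (i : Fin 4) : Γ i = conn G i y := by
  have hL : ∀ i j l, (G y * Γ i) l j = (G y * Γ j) l i := by
    intro i j l
    simp only [Matrix.mul_apply]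
    exact Finset.sum_congr rfl fun k _ => by rw [hsymm i j k]
  have hd : ∀ i j l, mderiv i G y j l = (G y * Γ i) l j + (G y * Γ i) j l := by
    intro i j l
    have e : (Γ i)ᵀ * G y = (G y * Γ i)ᵀ := by
      rw [Matrix.transpose_mul, hG.transpose_eq hy]
    rw [hcomp, e]
    rfl
  have : G y * Γ i = G y * conn G i y := by
    ext l j
    rw [hG.mul_conn_apply hy, hd, hd, hd, hL i j l, hL l i j, hL j l i]
    ring
  have h2 := congrArg ((G y)⁻¹ * ·) this
  simpa [Matrix.nonsing_inv_mul_cancel_left _ _ (hG.isUnit_det hy)] using h2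

theorem smooth_conn (i : Fin 4) : SmoothOn (conn G i) T := by
  intro k j
  simp only [conn, christoffel, Matrix.of_apply]
  refine contDiffOn_const.mul (ContDiffOn.sum fun l _ => (hG.smooth_inv k l).mul ?_)
  exact ((contDiffOn_pderiv hG.isOpen (hG.smooth _ _) _).add
    (contDiffOn_pderiv hG.isOpen (hG.smooth _ _) _)).sub
    (contDiffOn_pderiv hG.isOpen (hG.smooth _ _) _)

theorem smooth_covDeriv (hX : SmoothOn X T) (i : Fin 4) : SmoothOn (covDeriv G i X) T :=
  (hX.mderiv hG.isOpen i).add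
    (((hG.smooth_conn i).mul hX).sub (hX.mul (hG.smooth_conn i)))

theorem smooth_curvMat (i j : Fin 4) : SmoothOn (curvMat G i j) T :=
  (((hG.smooth_conn j).mderiv hG.isOpen i).sub ((hG.smooth_conn i).mderiv hG.isOpen j)).add
    (((hG.smooth_conn i).mul (hG.smooth_conn j)).sub ((hG.smooth_conn j).mul (hG.smooth_conn i)))

theorem covDeriv_mul (hX : SmoothOn X T) (hY : SmoothOn Y T) (hy : y ∈ T) (i : Fin 4) :
    covDeriv G i (fun z => X z * Y z) y = covDeriv G i X y * Y y + X y * covDeriv G i Y y := by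
  simp only [covDeriv]
  rw [mderiv_mul hG.isOpen hX hY hy]
  noncomm_ring

theorem pderiv_trace_eq (hX : SmoothOn X T) (hy : y ∈ T) (i : Fin 4) :
    pderiv i (fun z => (X z).trace) y = (covDeriv G i X y).trace := by
  rw [pderiv_trace hG.isOpen hX hy, covDeriv, Matrix.trace_add, Matrix.trace_sub,
    Matrix.trace_mul_comm (conn G i y)]
  simp

omit hG in
theorem covDeriv_congr {X Y : R4 → Mat4} {i : Fin 4} (hT : IsOpen T) (hy : y ∈ T)
    (hXY : ∀ z ∈ T, X z = Y z) : covDeriv G i X y = covDeriv G i Y y := by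
  simp only [covDeriv]
  rw [mderiv_congr hT hy hXY, hXY y hy]

theorem mderiv_covDeriv (hX : SmoothOn X T) (hy : y ∈ T) (i j : Fin 4) :
    mderiv i (covDeriv G j X) y = mderiv i (mderiv j X) y +
      (mderiv i (conn G j) y * X y + conn G j y * mderiv i X y
        - (mderiv i X y * conn G j y + X y * mderiv i (conn G j) y)) := by
  have hΓ := hG.smooth_conn j
  have e : covDeriv G j X = fun z => mderiv j X z + (conn G j z * X z - X z * conn G j z) := rfl
  rw [e, mderiv_add hG.isOpen (hX.mderiv hG.isOpen j) ((hΓ.mul hX).sub (hX.mul hΓ)) hy,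
    mderiv_sub hG.isOpen (hΓ.mul hX) (hX.mul hΓ) hy, mderiv_mul hG.isOpen hΓ hX hy,
    mderiv_mul hG.isOpen hX hΓ hy]

/-- The Ricci identity for endomorphism fields. -/
theorem covDeriv_comm (hX : SmoothOn X T) (hy : y ∈ T) (i j : Fin 4) :
    covDeriv G i (covDeriv G j X) y - covDeriv G j (covDeriv G i X) y =
      curvMat G i j y * X y - X y * curvMat G i j y := by
  have e : ∀ i j, covDeriv G i (covDeriv G j X) y = mderiv i (covDeriv G j X) y +
      (conn G i y * covDeriv G j X y - covDeriv G j X y * conn G i y) := fun _ _ => rfl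
  rw [e i j, e j i, hG.mderiv_covDeriv hX hy, hG.mderiv_covDeriv hX hy,
    mderiv_comm hG.isOpen hX hy i j, covDeriv, covDeriv, curvMat]
  noncomm_ring

omit hG in
theorem curvMat_swap (i j : Fin 4) (y : R4) : curvMat G j i y = -curvMat G i j y := by
  simp only [curvMat]
  noncomm_ring

/-- The differential Bianchi identity. -/
theorem covDeriv_curvMat (hy : y ∈ T) (i j k : Fin 4) :
    covDeriv G i (curvMat G j k) y + covDeriv G j (curvMat G k i) y
      + covDeriv G k (curvMat G i j) y = 0 := by
  have hΓ := hG.smooth_conn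
  have hd : ∀ i j k, mderiv i (curvMat G j k) y = mderiv i (mderiv j (conn G k)) y
      - mderiv i (mderiv k (conn G j)) y
      + ((mderiv i (conn G j) y * conn G k y + conn G j y * mderiv i (conn G k) y)
        - (mderiv i (conn G k) y * conn G j y + conn G k y * mderiv i (conn G j) y)) := by
    intro i j k
    have e : curvMat G j k = fun z => (mderiv j (conn G k) z - mderiv k (conn G j) z)
      + (conn G j z * conn G k z - conn G k z * conn G j z) := rfl
    have ho := hG.isOpen
    rw [e, mderiv_add ho (((hΓ k).mderiv ho j).sub ((hΓ j).mderiv ho k))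
      (((hΓ j).mul (hΓ k)).sub ((hΓ k).mul (hΓ j))) hy,
      mderiv_sub ho ((hΓ k).mderiv ho j) ((hΓ j).mderiv ho k) hy,
      mderiv_sub ho ((hΓ j).mul (hΓ k)) ((hΓ k).mul (hΓ j)) hy,
      mderiv_mul ho (hΓ j) (hΓ k) hy, mderiv_mul ho (hΓ k) (hΓ j) hy]
  have hc := fun i j k => mderiv_comm hG.isOpen (hΓ k) hy i j
  simp only [covDeriv, hd]
  rw [hc i j k, hc k i j, hc k j i]
  simp only [curvMat]
  noncomm_ring

/-- The algebraic Bianchi identity. -/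
theorem curvMat_cyclic (hy : y ∈ T) (i j k l : Fin 4) :
    curvMat G i j y l k + curvMat G j k y l i + curvMat G k i y l j = 0 := by
  have hs : ∀ m i j k, mderiv m (conn G i) y k j = mderiv m (conn G j) y k i :=
    fun m i j k => pderiv_congr hG.isOpen hy fun z hz => hG.conn_symm hz i j k
  have hm : ∀ i j k, (conn G i y * conn G j y) l k = (conn G i y * conn G k y) l j := by
    intro i j k
    simp only [Matrix.mul_apply]
    exact Finset.sum_congr rfl fun m _ => by rw [hG.conn_symm hy j k m]
  simp only [curvMat, Matrix.add_apply, Matrix.sub_apply]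
  rw [hs i j k, hs j k i, hs k i j, hm i j k, hm j k i, hm k i j]
  ring

/-- A covariant derivative of a field of skew endomorphisms is skew. -/
theorem covDeriv_skew (hX : SmoothOn X T) (hskew : ∀ z ∈ T, G z * X z + (X z)ᵀ * G z = 0)
    (hy : y ∈ T) (i : Fin 4) :
    G y * covDeriv G i X y + (covDeriv G i X y)ᵀ * G y = 0 := by
  have ho := hG.isOpen
  have h1 : mderiv i (fun z => G z * X z + (X z)ᵀ * G z) y = 0 := by
    rw [mderiv_congr ho hy hskew, mderiv_const]
  rw [mderiv_add ho (hG.smooth.mul hX) (hX.transpose.mul hG.smooth) hy,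
    mderiv_mul ho hG.smooth hX hy, mderiv_mul ho hX.transpose hG.smooth hy, mderiv_transpose,
    hG.mderiv_eq hy] at h1
  have h2 := hskew y hy
  have h3 : G y * covDeriv G i X y + (covDeriv G i X y)ᵀ * G y =
      (((conn G i y)ᵀ * G y + G y * conn G i y) * X y + G y * mderiv i X y +
      ((mderiv i X y)ᵀ * G y + (X y)ᵀ * ((conn G i y)ᵀ * G y + G y * conn G i y)))
      - ((conn G i y)ᵀ * (G y * X y + (X y)ᵀ * G y)
        + (G y * X y + (X y)ᵀ * G y) * conn G i y) := by
    simp only [covDeriv, Matrix.transpose_add, Matrix.transpose_sub, Matrix.transpose_mul]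
    noncomm_ring
  rw [h3, h1, h2]
  simp

theorem mderiv_mderiv (hy : y ∈ T) (i j : Fin 4) :
    mderiv i (mderiv j G) y = (mderiv i (conn G j) y)ᵀ * G y + (conn G j y)ᵀ * mderiv i G y
      + (mderiv i G y * conn G j y + G y * mderiv i (conn G j) y) := by
  have ho := hG.isOpen
  have hΓ := hG.smooth_conn j
  rw [mderiv_congr ho hy fun z hz => hG.mderiv_eq hz j,
    mderiv_add ho (hΓ.transpose.mul hG.smooth) (hG.smooth.mul hΓ) hy,
    mderiv_mul ho hΓ.transpose hG.smooth hy, mderiv_mul ho hG.smooth hΓ hy, mderiv_transpose]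

theorem curvMat_skew (hy : y ∈ T) (i j : Fin 4) :
    G y * curvMat G i j y + (curvMat G i j y)ᵀ * G y = 0 := by
  have h := mderiv_comm hG.isOpen hG.smooth hy i j
  rw [hG.mderiv_mderiv hy, hG.mderiv_mderiv hy, hG.mderiv_eq hy, hG.mderiv_eq hy] at h
  rw [← sub_eq_zero] at h
  rw [← h]
  simp only [curvMat, Matrix.transpose_add, Matrix.transpose_sub, Matrix.transpose_mul]
  noncomm_ring

/-- The pair symmetry of the curvature tensor. -/
theorem curvMat_pair (hy : y ∈ T) (i j k l : Fin 4) :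
    (G y * curvMat G i j y) l k = (G y * curvMat G k l y) j i := by
  have h1 : ∀ i j k l, (G y * curvMat G i j y) l k = -(G y * curvMat G j i y) l k := by
    intro i j k l
    rw [curvMat_swap i j, Matrix.mul_neg, Matrix.neg_apply, neg_neg]
  have h2 : ∀ i j k l, (G y * curvMat G i j y) l k = -(G y * curvMat G i j y) k l := by
    intro i j k l
    have := congrFun (congrFun (hG.curvMat_skew hy i j) l) k
    have e : (curvMat G i j y)ᵀ * G y = (G y * curvMat G i j y)ᵀ := by
      rw [Matrix.transpose_mul, hG.transpose_eq hy]
    rw [e, Matrix.add_apply, Matrix.transpose_apply, Matrix.zero_apply] at this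
    linarith
  have h3 : ∀ i j k l, (G y * curvMat G i j y) l k + (G y * curvMat G j k y) l i
      + (G y * curvMat G k i y) l j = 0 := by
    intro i j k l
    simp only [Matrix.mul_apply, ← Finset.sum_add_distrib, ← mul_add, hG.curvMat_cyclic hy,
      mul_zero, Finset.sum_const_zero]
  -- The classical octahedron argument: the four algebraic Bianchi identities are combined, and the
  -- unwanted terms cancel by skewness in each pair of indices.
  linarith [h3 i j k l, h3 j k l i, h3 k l i j, h3 l i j k, h1 i j k l, h2 i j k l, h1 j k i l,
    h2 j k i l, h1 k i j l, h2 k i j l, h1 k l j i, h2 k l j i, h1 l j k i, h2 l j k i, h1 l i k j,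
    h2 l i k j, h1 i k l j, h2 i k l j, h1 i j l k, h2 i j l k, h1 j l i k, h2 j l i k,
    h2 j k l i, h2 k l i j, h2 l i j k, h2 i k j l, h2 j l k i, h1 i k j l, h1 j l k i]

end IsMetricOn

end Coord

/-! ### Linear algebra of orthogonal complex structures on `ℝ⁴` -/

namespace Coord

open Matrix

/-- The standard complex structure on `ℝ⁴`. -/
def stdJ : Mat4 := !![0, -1, 0, 0; 1, 0, 0, 0; 0, 0, 0, -1; 0, 0, 1, 0]

/-- The columns of `P` form an orthonormal basis `u, Ju, v, Jv`. Here `u` is any unit vector and `v`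
a unit vector orthogonal to `u` and `Ju`; orthogonality of `J` does the rest. -/
theorem exists_adapted_frame {g J : Mat4} (hg : g.PosDef) (hJ : J * J = -1) (hJg : Jᵀ * g * J = g) :
    ∃ P : Mat4, Pᵀ * g * P = 1 ∧ J * P = P * stdJ := by
  let b : (Fin 4 → ℝ) → (Fin 4 → ℝ) → ℝ := fun u v => u ⬝ᵥ g *ᵥ v
  have hsymm : gᵀ = g := by simpa using hg.isHermitian.eq
  have b_comm : ∀ u v, b u v = b v u := by
    intro u v
    simp only [b]
    rw [dotProduct_comm, ← vecMul_transpose, hsymm, ← dotProduct_mulVec]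
  have b_J : ∀ u v, b (J *ᵥ u) (J *ᵥ v) = b u v := by
    intro u v
    simp only [b]
    conv_rhs => rw [← hJg]
    rw [← mulVec_mulVec, ← mulVec_mulVec, dotProduct_mulVec u, vecMul_transpose]
  have JJ : ∀ u, J *ᵥ (J *ᵥ u) = -u := by
    intro u
    rw [mulVec_mulVec, hJ, neg_mulVec, one_mulVec]
  have b_neg : ∀ u v, b u (-v) = -b u v := by
    intro u v
    simp only [b, mulVec_neg, dotProduct_neg]
  have b_smul : ∀ (c : ℝ) u v, b u (c • v) = c * b u v := by
    intro c u v
    simp only [b, mulVec_smul, dotProduct_smul, smul_eq_mul]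
  have b_J_right : ∀ u v, b u (J *ᵥ v) = -b (J *ᵥ u) v := by
    intro u v
    rw [← b_J u (J *ᵥ v), JJ, b_neg]
  have b_self : ∀ u, b u (J *ᵥ u) = 0 := by
    intro u
    have := b_J_right u u
    rw [b_comm (J *ᵥ u)] at this
    linarith
  have normalize : ∀ u, u ≠ 0 → ∃ c : ℝ, b (c • u) (c • u) = 1 := by
    intro u hu
    have hpos : 0 < b u u := by simpa [b] using hg.dotProduct_mulVec_pos hu
    refine ⟨(Real.sqrt (b u u))⁻¹, ?_⟩
    rw [b_smul, b_comm (_ • u) u, b_smul, ← mul_assoc, ← mul_inv, Real.mul_self_sqrt hpos.le,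
      inv_mul_cancel₀ hpos.ne']
  obtain ⟨c, hc⟩ := normalize (Pi.single 0 1) (by simp)
  set u : Fin 4 → ℝ := c • Pi.single 0 1
  let L : (Fin 4 → ℝ) →ₗ[ℝ] (Fin 2 → ℝ) := Matrix.mulVecLin (Matrix.of ![u ᵥ* g, (J *ᵥ u) ᵥ* g])
  -- Two linear conditions on `ℝ⁴` leave a nonzero vector orthogonal to `u` and `Ju`.
  have hL : LinearMap.ker L ≠ ⊥ := LinearMap.ker_ne_bot_of_finrank_lt (by simp)
  obtain ⟨v₀, hv₀, hne⟩ := (Submodule.ne_bot_iff _).1 hL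
  have hL0 : ∀ i, L v₀ i = 0 := fun i => congrFun (LinearMap.mem_ker.1 hv₀) i
  have hu0 : b u v₀ = 0 := by
    have := hL0 0
    simpa [L, mulVec, ← dotProduct_mulVec, b] using this
  have hJu0 : b (J *ᵥ u) v₀ = 0 := by
    have := hL0 1
    simpa [L, mulVec, ← dotProduct_mulVec, b] using this
  obtain ⟨d, hd⟩ := normalize v₀ hne
  set v : Fin 4 → ℝ := d • v₀
  have huv : b u v = 0 := by simp only [v, b_smul, hu0, mul_zero]
  have hJuv : b (J *ᵥ u) v = 0 := by simp only [v, b_smul, hJu0, mul_zero]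
  have huJv : b u (J *ᵥ v) = 0 := by rw [b_J_right, hJuv, neg_zero]
  have hJuJv : b (J *ᵥ u) (J *ᵥ v) = 0 := by rw [b_J, huv]
  have hJu : b (J *ᵥ u) (J *ᵥ u) = 1 := by rw [b_J, hc]
  have hJv : b (J *ᵥ v) (J *ᵥ v) = 1 := by rw [b_J, hd]
  let w : Fin 4 → Fin 4 → ℝ := ![u, J *ᵥ u, v, J *ᵥ v]
  refine ⟨(Matrix.of w)ᵀ, ?_, ?_⟩
  · have e : ∀ i j, (((Matrix.of w)ᵀ)ᵀ * g * (Matrix.of w)ᵀ) i j = b (w i) (w j) := by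
      intro i j
      rw [Matrix.mul_assoc]
      rfl
    ext i j
    rw [e]
    fin_cases i <;> fin_cases j <;> simp [w, hc, hd, huv, hJuv, huJv, hJuJv, hJu, hJv, b_self,
      b_comm (J *ᵥ u) u, b_comm v u, b_comm v (J *ᵥ u), b_comm (J *ᵥ v)]
  · have e : ∀ i j, (J * (Matrix.of w)ᵀ) i j = (J *ᵥ w j) i := fun i j => rfl
    ext i j
    rw [e]
    simp only [Matrix.mul_apply, Fin.sum_univ_four, stdJ, Matrix.transpose_apply]
    fin_cases j <;> simp [w, JJ]

/-- The skew antilinear endomorphisms form a plane: two entries determine the matrix. This is where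
dimension 4 enters. -/
theorem stdJ_anticomm_form {B : Mat4} (hB : B + Bᵀ = 0) (hBJ : B * stdJ = -(stdJ * B)) :
    B = !![0, 0, B 0 2, B 0 3; 0, 0, B 0 3, -B 0 2; -B 0 2, -B 0 3, 0, 0;
      -B 0 3, B 0 2, 0, 0] := by
  have h1 : ∀ i j, B i j + B j i = 0 := fun i j => congrFun (congrFun hB i) j
  have h2 : ∀ i j, (B * stdJ) i j = -(stdJ * B) i j := fun i j => congrFun (congrFun hBJ i) j
  have a := h2 0 0
  have b := h2 2 2
  have c := h2 0 2
  have d := h2 0 3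
  simp [Matrix.mul_apply, Fin.sum_univ_four, stdJ] at a b c d
  ext i j
  fin_cases i <;> fin_cases j <;> simp <;>
    linarith [h1 0 0, h1 1 1, h1 2 2, h1 3 3, h1 0 1, h1 0 2, h1 0 3, h1 1 2, h1 1 3, h1 2 3]

theorem stdJ_comm_form {S : Mat4} (hS : S + Sᵀ = 0) (hSJ : S * stdJ = stdJ * S) :
    S = !![0, S 0 1, S 0 2, S 0 3; -S 0 1, 0, -S 0 3, S 0 2; -S 0 2, S 0 3, 0, S 2 3;
      -S 0 3, -S 0 2, -S 2 3, 0] := by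
  have h1 : ∀ i j, S i j + S j i = 0 := fun i j => congrFun (congrFun hS i) j
  have h2 : ∀ i j, (S * stdJ) i j = (stdJ * S) i j := fun i j => congrFun (congrFun hSJ i) j
  have c := h2 0 2
  have d := h2 0 3
  simp [Matrix.mul_apply, Fin.sum_univ_four, stdJ] at c d
  ext i j
  fin_cases i <;> fin_cases j <;> simp <;>
    linarith [h1 0 0, h1 1 1, h1 2 2, h1 3 3, h1 0 1, h1 0 2, h1 0 3, h1 1 2, h1 1 3, h1 2 3]

/-- In `so(4) = u(2) ⊕ m` the subalgebra `su(2)` commutes with `m`, so `S` acts on `m` only through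
its component along `J`. The constant is checked on `S = J`: there `tr(JS) = -4` and `[J, B] = 2JB`.
-/
theorem stdJ_commutator_comm_anticomm {S B : Mat4} (hS : S + Sᵀ = 0) (hSJ : S * stdJ = stdJ * S)
    (hB : B + Bᵀ = 0) (hBJ : B * stdJ = -(stdJ * B)) :
    S * B - B * S = (-(1 / 2) * (stdJ * S).trace) • (stdJ * B) := by
  rw [stdJ_anticomm_form hB hBJ, stdJ_comm_form hS hSJ]
  generalize S 0 1 = a; generalize S 0 2 = b; generalize S 0 3 = c; generalize S 2 3 = d
  generalize B 0 2 = p; generalize B 0 3 = q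
  ext i j
  fin_cases i <;> fin_cases j <;>
    simp [Fin.sum_univ_four, stdJ, Matrix.trace] <;> ring

theorem stdJ_commutator_anticomm {B C : Mat4} (hB : B + Bᵀ = 0) (hBJ : B * stdJ = -(stdJ * B))
    (hC : C + Cᵀ = 0) (hCJ : C * stdJ = -(stdJ * C)) :
    B * C - C * B = (-(1 / 2) * (stdJ * (B * C)).trace) • stdJ := by
  rw [stdJ_anticomm_form hB hBJ, stdJ_anticomm_form hC hCJ]
  generalize B 0 2 = a; generalize B 0 3 = b; generalize C 0 2 = p; generalize C 0 3 = q
  ext i j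
  fin_cases i <;> fin_cases j <;>
    simp [Fin.sum_univ_four, stdJ, Matrix.trace] <;> ring

/-- Conjugation by an adapted frame reduces identities between endomorphisms to the standard
complex structure. -/
theorem exists_conj_stdJ {g J : Mat4} (hg : g.PosDef) (hJ : J * J = -1) (hJg : Jᵀ * g * J = g) :
    ∃ P Q : Mat4, P * Q = 1 ∧ Q * P = 1 ∧ Q * J * P = stdJ ∧
      ∀ X : Mat4, g * X + Xᵀ * g = 0 → Q * X * P + (Q * X * P)ᵀ = 0 := by
  obtain ⟨P, hP, hJP⟩ := exists_adapted_frame hg hJ hJg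
  have hsymm : gᵀ = g := by simpa using hg.isHermitian.eq
  have hPQ : P * (Pᵀ * g) = 1 := mul_eq_one_comm.1 hP
  refine ⟨P, Pᵀ * g, hPQ, hP, ?_, fun X hX => ?_⟩
  · rw [Matrix.mul_assoc, hJP, ← Matrix.mul_assoc, hP, Matrix.one_mul]
  · have : Pᵀ * g * X * P + (Pᵀ * g * X * P)ᵀ = Pᵀ * (g * X + Xᵀ * g) * P := by
      simp only [Matrix.transpose_mul, Matrix.transpose_transpose, hsymm]
      noncomm_ring
    rw [this, hX]
    simp

section conj

variable {P Q X Y : Mat4}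

theorem conj_mul (hPQ : P * Q = 1) : Q * (X * Y) * P = (Q * X * P) * (Q * Y * P) := by
  calc Q * (X * Y) * P = Q * X * 1 * Y * P := by noncomm_ring
    _ = _ := by rw [← hPQ]; noncomm_ring

theorem trace_conj (hPQ : P * Q = 1) : (Q * X * P).trace = X.trace := by
  rw [Matrix.trace_mul_comm, ← Matrix.mul_assoc, hPQ, Matrix.one_mul]

theorem conj_injective (hPQ : P * Q = 1) (h : Q * X * P = Q * Y * P) : X = Y := by
  have : ∀ Z : Mat4, Z = P * (Q * Z * P) * Q := fun Z => by
    calc Z = 1 * Z * 1 := by simp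
      _ = _ := by rw [← hPQ]; noncomm_ring
  rw [this X, this Y, h]

end conj

variable {g J S B C : Mat4}

/-- On `ℝ⁴`, the commutator of a skew-hermitian endomorphism with a skew antilinear one only
depends on the complex trace of the former. -/
theorem commutator_comm_anticomm (hg : g.PosDef) (hJ : J * J = -1) (hJg : Jᵀ * g * J = g)
    (hS : g * S + Sᵀ * g = 0) (hSJ : S * J = J * S)
    (hB : g * B + Bᵀ * g = 0) (hBJ : B * J = -(J * B)) :
    S * B - B * S = (-(1 / 2) * (J * S).trace) • (J * B) := by
  obtain ⟨P, Q, hPQ, -, hJ0, hskew⟩ := exists_conj_stdJ hg hJ hJg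
  have h := stdJ_commutator_comm_anticomm (hskew S hS)
    (by rw [← hJ0, ← conj_mul hPQ, ← conj_mul hPQ, hSJ]) (hskew B hB)
    (by rw [← hJ0, ← conj_mul hPQ, ← conj_mul hPQ, hBJ, Matrix.mul_neg, Matrix.neg_mul])
  rw [← hJ0, ← conj_mul hPQ, ← conj_mul hPQ, ← conj_mul hPQ, ← conj_mul hPQ, trace_conj hPQ] at h
  refine conj_injective hPQ ?_
  rw [Matrix.mul_smul, Matrix.smul_mul, ← h]
  noncomm_ring

/-- On `ℝ⁴`, the commutator of two skew antilinear endomorphisms is a multiple of `J`. -/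
theorem commutator_anticomm (hg : g.PosDef) (hJ : J * J = -1) (hJg : Jᵀ * g * J = g)
    (hB : g * B + Bᵀ * g = 0) (hBJ : B * J = -(J * B))
    (hC : g * C + Cᵀ * g = 0) (hCJ : C * J = -(J * C)) :
    B * C - C * B = (-(1 / 2) * (J * (B * C)).trace) • J := by
  obtain ⟨P, Q, hPQ, -, hJ0, hskew⟩ := exists_conj_stdJ hg hJ hJg
  have h := stdJ_commutator_anticomm (hskew B hB)
    (by rw [← hJ0, ← conj_mul hPQ, ← conj_mul hPQ, hBJ, Matrix.mul_neg, Matrix.neg_mul])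
    (hskew C hC)
    (by rw [← hJ0, ← conj_mul hPQ, ← conj_mul hPQ, hCJ, Matrix.mul_neg, Matrix.neg_mul])
  rw [← hJ0, ← conj_mul hPQ, ← conj_mul hPQ, ← conj_mul hPQ, trace_conj hPQ] at h
  refine conj_injective hPQ ?_
  rw [Matrix.mul_smul, Matrix.smul_mul, ← h]
  noncomm_ring

end Coord

/-! ### Almost Hermitian structures in local coordinates -/

namespace Coord

open Matrix

/-- `G` and `A` are the components on `T` of a metric and of an orthogonal almost complex
structure. -/
structure IsHermitianOn (G A : R4 → Mat4) (T : Set R4) : Prop extends IsMetricOn G T where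
  smooth_J : SmoothOn A T
  sq : ∀ y ∈ T, A y * A y = -1
  orthogonal : ∀ y ∈ T, (A y)ᵀ * G y * A y = G y

/-- The covariant derivative `∇_i J` of the almost complex structure. -/
def nablaJ (G A : R4 → Mat4) (i : Fin 4) (y : R4) : Mat4 := covDeriv G i A y

/-- The endomorphism `J ∇_i J`. -/
def jNablaJ (G A : R4 → Mat4) (i : Fin 4) (y : R4) : Mat4 := A y * nablaJ G A i y

/-- The closed 2-form `tr (J ∇_i J ∇_j J)`. -/
def betaForm (G A : R4 → Mat4) (i j : Fin 4) (y : R4) : ℝ :=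
  (A y * (nablaJ G A i y * nablaJ G A j y)).trace

/-- The 2-form `tr (J Ω_{ij})`. -/
def rhoForm (G A : R4 → Mat4) (i j : Fin 4) (y : R4) : ℝ :=
  (A y * curvMat G i j y).trace

/-- The bivector `J g⁻¹` dual to the fundamental form. -/
def bivec (G A : R4 → Mat4) (y : R4) : Mat4 := A y * (G y)⁻¹

/-- The contraction of a covariant 2-tensor with the bivector `J g⁻¹`. -/
def contr (G A : R4 → Mat4) (β : Fin 4 → Fin 4 → R4 → ℝ) (y : R4) : ℝ :=
  ∑ i, ∑ j, β i j y * bivec G A y i j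

/-- The vector field dual to the Lee form. -/
def leeVec (G A : R4 → Mat4) (k : Fin 4) (y : R4) : ℝ :=
  ∑ l, (G y)⁻¹ k l * leeForm G A l y

variable {G A : R4 → Mat4} {T : Set R4} {y : R4}

namespace IsHermitianOn

variable (hH : IsHermitianOn G A T)
include hH

theorem J_skew (hy : y ∈ T) : G y * A y + (A y)ᵀ * G y = 0 := by
  have h1 := congrArg (· * A y) (hH.orthogonal y hy)
  simp only [Matrix.mul_assoc, hH.sq y hy] at h1
  rw [← h1]
  simp

theorem smooth_nablaJ (i : Fin 4) : SmoothOn (nablaJ G A i) T :=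
  hH.toIsMetricOn.smooth_covDeriv hH.smooth_J i

theorem smooth_jNablaJ (i : Fin 4) : SmoothOn (jNablaJ G A i) T :=
  hH.smooth_J.mul (hH.smooth_nablaJ i)

theorem nablaJ_anticomm (hy : y ∈ T) (i : Fin 4) :
    nablaJ G A i y * A y = -(A y * nablaJ G A i y) := by
  have h := hH.toIsMetricOn.covDeriv_mul hH.smooth_J hH.smooth_J hy i
  rw [IsMetricOn.covDeriv_congr hH.isOpen hy hH.sq, covDeriv, mderiv_const] at h
  simp only [Matrix.mul_neg, Matrix.neg_mul, Matrix.mul_one, Matrix.one_mul, sub_self,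
    add_zero] at h
  exact eq_neg_of_add_eq_zero_left h.symm

theorem nablaJ_skew (hy : y ∈ T) (i : Fin 4) :
    G y * nablaJ G A i y + (nablaJ G A i y)ᵀ * G y = 0 :=
  hH.toIsMetricOn.covDeriv_skew hH.smooth_J (fun _ hz => hH.J_skew hz) hy i

theorem jNablaJ_skew (hy : y ∈ T) (i : Fin 4) :
    G y * jNablaJ G A i y + (jNablaJ G A i y)ᵀ * G y = 0 := by
  have h1 := hH.J_skew hy
  have h2 := hH.nablaJ_skew hy i
  have h3 := hH.nablaJ_anticomm hy i
  have : G y * jNablaJ G A i y + (jNablaJ G A i y)ᵀ * G y =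
      G y * (A y * nablaJ G A i y + nablaJ G A i y * A y)
      - (G y * nablaJ G A i y + (nablaJ G A i y)ᵀ * G y) * A y
      + (nablaJ G A i y)ᵀ * (G y * A y + (A y)ᵀ * G y) := by
    simp only [jNablaJ, Matrix.transpose_mul]
    noncomm_ring
  rw [this, h1, h2, h3]
  simp

omit hH in
theorem skew_raise (hG : IsMetricOn G T) (hy : y ∈ T) {X : Mat4}
    (hX : G y * X + Xᵀ * G y = 0) : (X * (G y)⁻¹)ᵀ = -(X * (G y)⁻¹) := by
  have hu := hG.isUnit_det hy
  rw [Matrix.transpose_mul, hG.inv_transpose hy]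
  have h1 : (G y)⁻¹ * (G y * X + Xᵀ * G y) * (G y)⁻¹ = X * (G y)⁻¹ + (G y)⁻¹ * Xᵀ := by
    rw [Matrix.mul_add, Matrix.nonsing_inv_mul_cancel_left _ _ hu, Matrix.add_mul,
      ← Matrix.mul_assoc, Matrix.mul_nonsing_inv_cancel_right _ _ hu]
  rw [hX] at h1
  simp only [Matrix.mul_zero, Matrix.zero_mul] at h1
  exact eq_neg_of_add_eq_zero_right h1.symm

omit hH in
theorem skew_raise_apply (hG : IsMetricOn G T) (hy : y ∈ T) {X : Mat4}
    (hX : G y * X + Xᵀ * G y = 0) (i j : Fin 4) :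
    (X * (G y)⁻¹) j i = -(X * (G y)⁻¹) i j :=
  congrFun (congrFun (skew_raise hG hy hX) i) j

theorem bivec_swap (hy : y ∈ T) (i j : Fin 4) : bivec G A y j i = -bivec G A y i j :=
  skew_raise_apply hH.toIsMetricOn hy (hH.J_skew hy) i j

theorem betaForm_swap (hy : y ∈ T) (i j : Fin 4) : betaForm G A j i y = -betaForm G A i j y := by
  have h := hH.nablaJ_anticomm hy j
  simp only [betaForm]
  rw [Matrix.trace_mul_comm (A y) (nablaJ G A i y * _), Matrix.mul_assoc, h, Matrix.mul_neg,
    Matrix.trace_neg, neg_neg, Matrix.trace_mul_comm (nablaJ G A i y), Matrix.mul_assoc]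

omit hH in
theorem rhoForm_swap (i j : Fin 4) (y : R4) : rhoForm G A j i y = -rhoForm G A i j y := by
  simp only [rhoForm]
  rw [IsMetricOn.curvMat_swap i j, Matrix.mul_neg, Matrix.trace_neg]

/-- The matrix of the fundamental form is `Jᵀ g`; since `∇g = 0`, the derivative falls on `J` alone.
-/
theorem nablaTwo_fundamentalForm (hy : y ∈ T) (i j k : Fin 4) :
    nablaTwo G (fundamentalForm G A) i j k y = ((nablaJ G A i y)ᵀ * G y) j k := by
  have e : ∀ z, (fun j k => fundamentalForm G A j k z) = (A z)ᵀ * G z := by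
    intro z; ext j k
    simp only [fundamentalForm, Matrix.mul_apply, Matrix.transpose_apply]
  have e' : ∀ j k z, fundamentalForm G A j k z = ((A z)ᵀ * G z) j k :=
    fun j k z => congrFun (congrFun (e z) j) k
  have h1 : nablaTwo G (fundamentalForm G A) i j k y =
      (mderiv i (fun z => (A z)ᵀ * G z) y - (conn G i y)ᵀ * ((A y)ᵀ * G y)
        - ((A y)ᵀ * G y) * conn G i y) j k := by
    have h2 : fundamentalForm G A j k = fun z => ((A z)ᵀ * G z) j k := funext fun z => e' j k z
    simp only [nablaTwo, Matrix.sub_apply, mderiv_apply]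
    rw [Matrix.mul_apply (M := (conn G i y)ᵀ), Matrix.mul_apply (N := conn G i y), h2]
    simp only [e', mul_comm (christoffel G _ i k y)]
    rfl
  rw [h1, mderiv_mul hH.isOpen hH.smooth_J.transpose hH.smooth hy, mderiv_transpose,
    hH.toIsMetricOn.mderiv_eq hy]
  refine congrFun (congrFun ?_ j) k
  simp only [nablaJ, covDeriv, Matrix.transpose_add, Matrix.transpose_sub, Matrix.transpose_mul]
  noncomm_ring

theorem codiffTwo_fundamentalForm (hy : y ∈ T) (k : Fin 4) :
    codiffTwo G (fundamentalForm G A) k y = ∑ i, nablaJ G A i y i k := by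
  simp only [codiffTwo, hH.nablaTwo_fundamentalForm hy]
  rw [← Finset.sum_neg_distrib]
  refine Finset.sum_congr rfl fun i _ => ?_
  have h := hH.nablaJ_skew hy i
  have h2 : nablaJ G A i y = -((G y)⁻¹ * ((nablaJ G A i y)ᵀ * G y)) := by
    rw [eq_neg_of_add_eq_zero_right h, Matrix.mul_neg, neg_neg,
      Matrix.nonsing_inv_mul_cancel_left _ _ (hH.toIsMetricOn.isUnit_det hy)]
  conv_rhs => rw [h2]
  rw [Matrix.neg_apply, Matrix.mul_apply]

/-- `θ` is the trace of `J∇J` over the form index and the upper index. The sign in `(Jα)(X) =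
-α(JX)` is absorbed by `(∇J)J = -J∇J`. -/
theorem leeForm_eq (hy : y ∈ T) (l : Fin 4) :
    leeForm G A l y = ∑ i, jNablaJ G A i y i l := by
  have e : ∀ i, jNablaJ G A i y = -(nablaJ G A i y * A y) := fun i => by
    rw [hH.nablaJ_anticomm hy, neg_neg]; rfl
  simp only [leeForm, hH.codiffTwo_fundamentalForm hy, e, Matrix.neg_apply, Matrix.mul_apply,
    Finset.mul_sum, Finset.sum_neg_distrib]
  rw [Finset.sum_comm]
  refine congrArg _ (Finset.sum_congr rfl fun i _ => Finset.sum_congr rfl fun k _ => mul_comm _ _)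

theorem smooth_leeForm (l : Fin 4) : ContDiffOn ℝ ∞ (leeForm G A l) T :=
  (ContDiffOn.sum fun i _ => hH.smooth_jNablaJ i i l).congr fun _ hz => hH.leeForm_eq hz l

theorem smooth_leeVec (k : Fin 4) : ContDiffOn ℝ ∞ (leeVec G A k) T :=
  ContDiffOn.sum fun l _ => (hH.toIsMetricOn.smooth_inv k l).mul (hH.smooth_leeForm l)

theorem smooth_betaForm (i j : Fin 4) : ContDiffOn ℝ ∞ (betaForm G A i j) T :=
  (hH.smooth_J.mul ((hH.smooth_nablaJ i).mul (hH.smooth_nablaJ j))).trace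

theorem smooth_rhoForm (i j : Fin 4) : ContDiffOn ℝ ∞ (rhoForm G A i j) T :=
  (hH.smooth_J.mul (hH.toIsMetricOn.smooth_curvMat i j)).trace

theorem smooth_contr {β : Fin 4 → Fin 4 → R4 → ℝ} (hβ : ∀ i j, ContDiffOn ℝ ∞ (β i j) T) :
    ContDiffOn ℝ ∞ (contr G A β) T :=
  ContDiffOn.sum fun i _ => ContDiffOn.sum fun j _ =>
    (hβ i j).mul (hH.smooth_J.mul hH.toIsMetricOn.smooth_inv i j)

theorem leeVec_eq (hy : y ∈ T) (k : Fin 4) :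
    leeVec G A k y = ∑ i, (jNablaJ G A i y * (G y)⁻¹) i k := by
  simp only [leeVec, hH.leeForm_eq hy, Matrix.mul_apply, Finset.mul_sum]
  rw [Finset.sum_comm]
  refine Finset.sum_congr rfl fun i _ => Finset.sum_congr rfl fun l _ => ?_
  have : (G y)⁻¹ k l = (G y)⁻¹ l k := by
    conv_lhs => rw [← hH.toIsMetricOn.inv_transpose hy]
    rfl
  rw [this, mul_comm]

/-- With its index raised, `J∇_i J` is a bivector, so contracting its other slot only changes the
sign. Both contractions occur in `rho_leeVec`. -/
theorem leeVec_eq' (hy : y ∈ T) (k : Fin 4) :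
    leeVec G A k y = -∑ i, (jNablaJ G A i y * (G y)⁻¹) k i := by
  rw [hH.leeVec_eq hy, ← Finset.sum_neg_distrib]
  exact Finset.sum_congr rfl fun i _ =>
    skew_raise_apply hH.toIsMetricOn hy (hH.jNablaJ_skew hy i) k i

end IsHermitianOn

end Coord

/-! ### The first Gray condition in local coordinates -/

namespace Coord

open Matrix

/-- An almost Hermitian structure on `T` all of whose curvature endomorphisms commute with the
almost complex structure. -/
structure IsGrayOn (G A : R4 → Mat4) (T : Set R4) : Prop extends IsHermitianOn G A T where
  comm : ∀ y ∈ T, ∀ i j, curvMat G i j y * A y = A y * curvMat G i j y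

variable {G A : R4 → Mat4} {T : Set R4} {y : R4}

/-- In matrix form the Gray condition reads `Ωᵀg = Jᵀ(Ωᵀg)J`. Skewness of `Ω` and `J` turns it into
`Ω = -JΩJ`, which is commutation because `J² = -1`. -/
theorem IsHermitianOn.isGrayOn (hH : IsHermitianOn G A T)
    (hR : ∀ y ∈ T, ∀ i j k l : Fin 4, riemann G i j k l y =
      ∑ m, ∑ n, A y m k * A y n l * riemann G i j m n y) : IsGrayOn G A T := by
  refine ⟨hH, fun y hy i j => ?_⟩
  have hu := hH.toIsMetricOn.isUnit_det hy
  have h1 : (curvMat G i j y)ᵀ * G y = (A y)ᵀ * ((curvMat G i j y)ᵀ * G y) * A y := by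
    ext k l
    rw [← riemann_eq, hR y hy, Matrix.mul_apply]
    simp only [Matrix.mul_apply (M := (A y)ᵀ), Finset.sum_mul, ← riemann_eq]
    rw [Finset.sum_comm]
    refine Finset.sum_congr rfl fun n _ => Finset.sum_congr rfl fun m _ => ?_
    rw [Matrix.transpose_apply]
    ring
  rw [eq_neg_of_add_eq_zero_right (hH.toIsMetricOn.curvMat_skew hy i j)] at h1
  have h2 : G y * curvMat G i j y = -(G y * (A y * curvMat G i j y * A y)) := by
    have h3 := eq_neg_of_add_eq_zero_right (hH.J_skew hy)
    calc G y * curvMat G i j y = (A y)ᵀ * G y * curvMat G i j y * A y := by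
          rw [← neg_inj, h1]; noncomm_ring
      _ = _ := by rw [h3]; noncomm_ring
  have h4 : curvMat G i j y = -(A y * curvMat G i j y * A y) := by
    rw [← Matrix.mul_neg] at h2
    have := congrArg ((G y)⁻¹ * ·) h2
    simpa only [Matrix.nonsing_inv_mul_cancel_left _ _ hu] using this
  calc curvMat G i j y * A y = -((A y * A y) * curvMat G i j y * A y) := by
        rw [hH.sq y hy]; simp
    _ = A y * (-(A y * curvMat G i j y * A y)) := by noncomm_ring
    _ = A y * curvMat G i j y := by rw [← h4]

namespace IsGrayOn

variable (hA : IsGrayOn G A T)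
include hA

/-- This is `d^∇(∇J) = [Ω, J] = 0`. Since `covDeriv` leaves the form index `j` alone,
antisymmetrising in `i, j` gives the exterior covariant derivative without Christoffel corrections.
-/
theorem covDeriv_nablaJ_symm (hy : y ∈ T) (i j : Fin 4) :
    covDeriv G i (nablaJ G A j) y = covDeriv G j (nablaJ G A i) y := by
  have h := hA.toIsMetricOn.covDeriv_comm hA.smooth_J hy i j
  rw [hA.comm y hy, sub_self] at h
  exact sub_eq_zero.1 h

theorem commutator_nablaJ (hy : y ∈ T) (i j : Fin 4) :
    nablaJ G A i y * nablaJ G A j y - nablaJ G A j y * nablaJ G A i y =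
      (-(1 / 2) * betaForm G A i j y) • A y :=
  have hH := hA.toIsHermitianOn
  commutator_anticomm (hH.posDef y hy) (hH.sq y hy) (hH.orthogonal y hy) (hH.nablaJ_skew hy i)
    (hH.nablaJ_anticomm hy i) (hH.nablaJ_skew hy j) (hH.nablaJ_anticomm hy j)

theorem commutator_curvMat_nablaJ (hy : y ∈ T) (i j k : Fin 4) :
    curvMat G i j y * nablaJ G A k y - nablaJ G A k y * curvMat G i j y =
      (-(1 / 2) * rhoForm G A i j y) • jNablaJ G A k y :=
  have hH := hA.toIsHermitianOn
  commutator_comm_anticomm (hH.posDef y hy) (hH.sq y hy) (hH.orthogonal y hy)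
    (hH.toIsMetricOn.curvMat_skew hy i j) (hA.comm y hy i j) (hH.nablaJ_skew hy k)
    (hH.nablaJ_anticomm hy k)

/-- A second exterior derivative of `d^∇(∇J) = 0`: the Ricci identity turns each commutator into a
difference of second derivatives, and these cancel in pairs by the symmetry of
`covDeriv_nablaJ_symm`. -/
theorem cyclic_commutator (hy : y ∈ T) (i j k : Fin 4) :
    (curvMat G i j y * nablaJ G A k y - nablaJ G A k y * curvMat G i j y) +
    (curvMat G j k y * nablaJ G A i y - nablaJ G A i y * curvMat G j k y) +
    (curvMat G k i y * nablaJ G A j y - nablaJ G A j y * curvMat G k i y) = 0 := by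
  have hG := hA.toIsMetricOn
  have hB := hA.toIsHermitianOn.smooth_nablaJ
  have hs : ∀ i j k, covDeriv G i (covDeriv G j (nablaJ G A k)) y =
      covDeriv G i (covDeriv G k (nablaJ G A j)) y := fun i j k =>
    IsMetricOn.covDeriv_congr hG.isOpen hy fun z hz => hA.covDeriv_nablaJ_symm hz j k
  rw [← hG.covDeriv_comm (hB k) hy i j, ← hG.covDeriv_comm (hB i) hy j k,
    ← hG.covDeriv_comm (hB j) hy k i, hs i j k, hs j k i, hs k i j]
  abel

/-- `ρ ∧ J∇J = 0`. -/
theorem rho_wedge (hy : y ∈ T) (i j k : Fin 4) :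
    rhoForm G A i j y • jNablaJ G A k y + rhoForm G A j k y • jNablaJ G A i y +
      rhoForm G A k i y • jNablaJ G A j y = 0 := by
  have h := hA.cyclic_commutator hy i j k
  rw [hA.commutator_curvMat_nablaJ hy, hA.commutator_curvMat_nablaJ hy,
    hA.commutator_curvMat_nablaJ hy, mul_smul, mul_smul, mul_smul, ← smul_add, ← smul_add] at h
  exact (smul_eq_zero.1 h).resolve_left (by norm_num)

/-- Multiply `ρ ∧ J∇J = 0` by `∇_l J` and take the trace. -/
theorem rho_wedge_beta (hy : y ∈ T) (i j k l : Fin 4) :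
    rhoForm G A i j y * betaForm G A k l y + rhoForm G A j k y * betaForm G A i l y +
      rhoForm G A k i y * betaForm G A j l y = 0 := by
  have h := congrArg (fun X => (X * nablaJ G A l y).trace) (hA.rho_wedge hy i j k)
  simp only [Matrix.add_mul, Matrix.smul_mul, Matrix.trace_add, Matrix.trace_smul, smul_eq_mul,
    Matrix.zero_mul, Matrix.trace_zero, jNablaJ, Matrix.mul_assoc] at h
  exact h

/-- By the Leibniz rule `d^∇(J∇J) = ∇J ∧ ∇J + J d^∇(∇J)`; the second term vanishes and the first is
a multiple of `J` in dimension 4. -/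
theorem covDeriv_jNablaJ (hy : y ∈ T) (i j : Fin 4) :
    covDeriv G i (jNablaJ G A j) y - covDeriv G j (jNablaJ G A i) y =
      (-(1 / 2) * betaForm G A i j y) • A y := by
  have hG := hA.toIsMetricOn
  have hB := hA.toIsHermitianOn.smooth_nablaJ
  have h : ∀ i j, covDeriv G i (jNablaJ G A j) y =
      nablaJ G A i y * nablaJ G A j y + A y * covDeriv G i (nablaJ G A j) y :=
    fun i j => hG.covDeriv_mul hA.smooth_J (hB j) hy i
  rw [← hA.commutator_nablaJ hy, h i j, h j i, hA.covDeriv_nablaJ_symm hy i j]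
  abel

/-- A product of three antilinear endomorphisms is antilinear, so conjugation by `J` changes its
sign and its trace vanishes. -/
theorem trace_nablaJ_cube (hy : y ∈ T) (i j k : Fin 4) :
    (nablaJ G A i y * (nablaJ G A j y * nablaJ G A k y)).trace = 0 := by
  have h := hA.nablaJ_anticomm hy
  set X := nablaJ G A i y * (nablaJ G A j y * nablaJ G A k y) with hX
  have h1 : X * A y = -(A y * X) := by
    have e : nablaJ G A i y * (nablaJ G A j y * nablaJ G A k y) * A y
        = nablaJ G A i y * (nablaJ G A j y * (nablaJ G A k y * A y)) := by noncomm_ring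
    have e2 : nablaJ G A i y * (nablaJ G A j y * (A y * nablaJ G A k y))
        = nablaJ G A i y * ((nablaJ G A j y * A y) * nablaJ G A k y) := by noncomm_ring
    have e3 : nablaJ G A i y * (A y * nablaJ G A j y * nablaJ G A k y)
        = (nablaJ G A i y * A y) * (nablaJ G A j y * nablaJ G A k y) := by noncomm_ring
    rw [hX, e, h k, Matrix.mul_neg, Matrix.mul_neg, e2, h j, Matrix.neg_mul, Matrix.mul_neg, e3,
      h i]
    noncomm_ring
  have h2 : (A y * (X * A y)).trace = (A y * A y * X).trace := by
    rw [← Matrix.mul_assoc, Matrix.trace_mul_comm, Matrix.mul_assoc]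
  rw [h1, Matrix.mul_neg, ← Matrix.mul_assoc, hA.sq y hy, Matrix.neg_mul, Matrix.one_mul,
    Matrix.trace_neg, Matrix.trace_neg] at h2
  linarith

/-- An antilinear endomorphism times a linear one is antilinear, hence traceless. -/
theorem trace_curvMat_nablaJ (hy : y ∈ T) (i j k : Fin 4) :
    (nablaJ G A k y * curvMat G i j y).trace = 0 := by
  have h := hA.nablaJ_anticomm hy k
  have hc := hA.comm y hy i j
  set X := nablaJ G A k y * curvMat G i j y with hX
  have h1 : X * A y = -(A y * X) := by
    rw [hX, Matrix.mul_assoc, hc, ← Matrix.mul_assoc, h]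
    noncomm_ring
  have h2 : (A y * (X * A y)).trace = (A y * A y * X).trace := by
    rw [← Matrix.mul_assoc, Matrix.trace_mul_comm, Matrix.mul_assoc]
  rw [h1, Matrix.mul_neg, ← Matrix.mul_assoc, hA.sq y hy, Matrix.neg_mul, Matrix.one_mul,
    Matrix.trace_neg, Matrix.trace_neg] at h2
  linarith

/-- The 2-form `tr (J Ω)` is closed. -/
theorem rho_closed (hy : y ∈ T) (i j k : Fin 4) :
    pderiv i (rhoForm G A j k) y + pderiv j (rhoForm G A k i) y + pderiv k (rhoForm G A i j) y
      = 0 := by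
  have hG := hA.toIsMetricOn
  have h : ∀ i j k, pderiv i (rhoForm G A j k) y = (A y * covDeriv G i (curvMat G j k) y).trace := by
    intro i j k
    have hs := hA.smooth_J.mul (hG.smooth_curvMat j k)
    have e : pderiv i (rhoForm G A j k) y = _ := hG.pderiv_trace_eq hs hy i
    rw [e, hG.covDeriv_mul hA.smooth_J (hG.smooth_curvMat j k) hy, Matrix.trace_add]
    -- The derivative of the factor `J` contributes nothing, so only the differential Bianchi
    -- identity is left.
    have : (covDeriv G i A y * curvMat G j k y).trace = 0 := hA.trace_curvMat_nablaJ hy j k i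
    rw [this, zero_add]
  rw [h, h, h, ← Matrix.trace_add, ← Matrix.trace_add, ← Matrix.mul_add, ← Matrix.mul_add,
    hG.covDeriv_curvMat hy]
  simp

theorem trace_anticomm (hy : y ∈ T) (X : Mat4) (j : Fin 4) :
    (A y * (nablaJ G A j y * X)).trace = -(A y * (X * nablaJ G A j y)).trace := by
  have h := hA.nablaJ_anticomm hy j
  have e : A y * (nablaJ G A j y * X) = -(nablaJ G A j y * (A y * X)) := by
    rw [← Matrix.mul_assoc, ← Matrix.mul_assoc, h, Matrix.neg_mul, neg_neg]
  rw [e, Matrix.trace_neg, Matrix.trace_mul_comm, Matrix.mul_assoc]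

/-- The 2-form `tr (J ∇J ∇J)` is closed. -/
theorem beta_closed (hy : y ∈ T) (i j k : Fin 4) :
    pderiv i (betaForm G A j k) y + pderiv j (betaForm G A k i) y + pderiv k (betaForm G A i j) y
      = 0 := by
  have hG := hA.toIsMetricOn
  have hB := hA.toIsHermitianOn.smooth_nablaJ
  have h : ∀ i j k, pderiv i (betaForm G A j k) y =
      (A y * (covDeriv G i (nablaJ G A j) y * nablaJ G A k y)).trace
        - (A y * (covDeriv G i (nablaJ G A k) y * nablaJ G A j y)).trace := by
    intro i j k
    have hs := hA.smooth_J.mul ((hB j).mul (hB k))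
    have e : pderiv i (betaForm G A j k) y = _ := hG.pderiv_trace_eq hs hy i
    rw [e, hG.covDeriv_mul hA.smooth_J ((hB j).mul (hB k)) hy, hG.covDeriv_mul (hB j) (hB k) hy,
      Matrix.trace_add, Matrix.mul_add, Matrix.trace_add, hA.trace_anticomm hy _ j]
    have : (covDeriv G i A y * (nablaJ G A j y * nablaJ G A k y)).trace = 0 :=
      hA.trace_nablaJ_cube hy i j k
    rw [this]
    ring
  -- In the cyclic sum each `∇_i B_j` meets `∇_j B_i` with the opposite sign.
  rw [h, h, h, hA.covDeriv_nablaJ_symm hy i j, hA.covDeriv_nablaJ_symm hy j k,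
    hA.covDeriv_nablaJ_symm hy k i]
  ring

/-- The codifferential of the Lee form. -/
theorem codiffOne_leeForm (hy : y ∈ T) :
    codiffOne G (leeForm G A) y = -(1 / 4) * contr G A (betaForm G A) y := by
  have hH := hA.toIsHermitianOn
  have hG := hA.toIsMetricOn
  -- The full tensorial derivative `∇_m(J∇J)_i`, with the correction for the form index. The
  -- correction is symmetric in `m, i`, so the antisymmetric part of `N` is still `d^∇(J∇J)`.
  let N : Fin 4 → Fin 4 → Mat4 := fun m i =>
    covDeriv G m (jNablaJ G A i) y - ∑ p, conn G m y p i • jNablaJ G A p y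
  have hNskew : ∀ m i, G y * N m i + (N m i)ᵀ * G y = 0 := by
    intro m i
    have h1 := hG.covDeriv_skew (hH.smooth_jNablaJ i) (fun z hz => hH.jNablaJ_skew hz i) hy m
    have h2 : ∀ p, G y * (conn G m y p i • jNablaJ G A p y)
        + (conn G m y p i • jNablaJ G A p y)ᵀ * G y = 0 := by
      intro p
      rw [Matrix.transpose_smul, Matrix.mul_smul, Matrix.smul_mul, ← smul_add,
        hH.jNablaJ_skew hy, smul_zero]
    have h3 : G y * (∑ p, conn G m y p i • jNablaJ G A p y)
        + (∑ p, conn G m y p i • jNablaJ G A p y)ᵀ * G y = 0 := by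
      rw [Matrix.transpose_sum, Finset.mul_sum, Finset.sum_mul, ← Finset.sum_add_distrib]
      exact Finset.sum_eq_zero fun p _ => h2 p
    simp only [N, Matrix.transpose_sub, Matrix.mul_sub, Matrix.sub_mul]
    rw [sub_add_sub_comm, h1, h3, sub_zero]
  have hNsymm : ∀ i m, N i m - N m i = (-(1 / 2) * betaForm G A i m y) • A y := by
    intro i m
    rw [← hA.covDeriv_jNablaJ hy]
    simp only [N, hG.conn_symm hy m i]
    abel
  have hnabla : ∀ m l, nablaOne G (leeForm G A) m l y = ∑ i, N m i i l := by
    intro m l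
    have h1 : pderiv m (leeForm G A l) y = ∑ i, mderiv m (jNablaJ G A i) y i l := by
      rw [pderiv_congr hH.isOpen hy fun z hz => hH.leeForm_eq hz l, pderiv_sum]
      · rfl
      · exact fun i _ => differentiableAt_of_contDiffOn hH.isOpen (hH.smooth_jNablaJ i i l) hy
    have h2 : ∑ i, (conn G m y * jNablaJ G A i y) i l =
        ∑ i, ∑ p, conn G m y p i * jNablaJ G A p y i l := by
      simp only [Matrix.mul_apply]
      exact Finset.sum_comm
    have h3 : ∑ k, christoffel G k m l y * leeForm G A k y =
        ∑ i, (jNablaJ G A i y * conn G m y) i l := by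
      simp only [Matrix.mul_apply, hH.leeForm_eq hy, Finset.mul_sum]
      rw [Finset.sum_comm]
      exact Finset.sum_congr rfl fun i _ => Finset.sum_congr rfl fun k _ => mul_comm _ _
    simp only [N, covDeriv, Matrix.sub_apply, Matrix.add_apply, Matrix.sum_apply,
      Matrix.smul_apply, smul_eq_mul, Finset.sum_sub_distrib, Finset.sum_add_distrib]
    rw [nablaOne, h1, h2, h3]
    ring
  have h1 : codiffOne G (leeForm G A) y = -∑ i, ∑ m, (N m i * (G y)⁻¹) i m := by
    simp only [codiffOne, hnabla, Matrix.mul_apply, Finset.mul_sum]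
    congr 1
    have : ∀ m, ∑ l, ∑ i, (G y)⁻¹ m l * N m i i l = ∑ i, ∑ l, N m i i l * (G y)⁻¹ l m := by
      intro m
      rw [Finset.sum_comm]
      refine Finset.sum_congr rfl fun i _ => Finset.sum_congr rfl fun l _ => ?_
      have : (G y)⁻¹ m l = (G y)⁻¹ l m := by
        conv_lhs => rw [← hG.inv_transpose hy]
        rfl
      rw [this, mul_comm]
    simp only [this]
    exact Finset.sum_comm
  -- Skewness of the raised matrix exchanges the roles of the two indices. Averaging with `h1`
  -- leaves only the antisymmetric part of `N`; this second factor `½` turns `-½β` into `-¼⟨β, ω⟩`.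
  have h2 : codiffOne G (leeForm G A) y = ∑ i, ∑ m, (N i m * (G y)⁻¹) i m := by
    rw [h1, Finset.sum_comm, ← Finset.sum_neg_distrib]
    refine Finset.sum_congr rfl fun m _ => ?_
    rw [← Finset.sum_neg_distrib]
    refine Finset.sum_congr rfl fun i _ => ?_
    rw [IsHermitianOn.skew_raise_apply hG hy (hNskew m i) m i, neg_neg]
  have h3 : 2 * codiffOne G (leeForm G A) y = ∑ i, ∑ m, ((N i m - N m i) * (G y)⁻¹) i m := by
    simp only [Matrix.sub_mul, Matrix.sub_apply, Finset.sum_sub_distrib]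
    linarith
  have h4 : ∑ i, ∑ m, ((N i m - N m i) * (G y)⁻¹) i m
      = -(1 / 2) * contr G A (betaForm G A) y := by
    simp only [hNsymm, contr, Finset.mul_sum, Matrix.smul_mul, Matrix.smul_apply, smul_eq_mul,
      bivec, mul_assoc]
  linarith

/-- The algebraic Bianchi identity rewrites `ρ` as two sums with equal contractions `E`. There `J`
stands on both sides of the curvature; commuting the two together gives `J² = -1` and leaves the
scalar curvature. Under the Gray condition the `*`-scalar curvature therefore equals `s`. -/
theorem contr_rhoForm (hy : y ∈ T) : contr G A (rhoForm G A) y = -2 * scalar G y := by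
  have hG := hA.toIsMetricOn
  have hs : scalar G y = ∑ i, ∑ j, (curvMat G i j y * (G y)⁻¹) i j := by
    simp only [scalar, ricci, ← curvMat_apply, Matrix.mul_apply, Finset.mul_sum]
    have : ∀ j, ∑ k, ∑ i, (G y)⁻¹ j k * curvMat G i j y i k
        = ∑ i, ∑ k, curvMat G i j y i k * (G y)⁻¹ k j := by
      intro j
      rw [Finset.sum_comm]
      refine Finset.sum_congr rfl fun i _ => Finset.sum_congr rfl fun k _ => ?_
      have : (G y)⁻¹ j k = (G y)⁻¹ k j := by
        conv_lhs => rw [← hG.inv_transpose hy]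
        rfl
      rw [this, mul_comm]
    simp only [this]
    exact Finset.sum_comm
  have hρ : ∀ i j, rhoForm G A i j y = -∑ k, ∑ l, A y k l * (curvMat G j k y l i)
      - ∑ k, ∑ l, A y k l * (curvMat G k i y l j) := by
    intro i j
    simp only [rhoForm, Matrix.trace, Matrix.diag, Matrix.mul_apply]
    rw [← Finset.sum_neg_distrib, ← Finset.sum_sub_distrib]
    refine Finset.sum_congr rfl fun k _ => ?_
    rw [← Finset.sum_neg_distrib, ← Finset.sum_sub_distrib]
    refine Finset.sum_congr rfl fun l _ => ?_
    have := hG.curvMat_cyclic hy i j k l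
    rw [show curvMat G i j y l k = -curvMat G j k y l i - curvMat G k i y l j by linarith]
    ring
  let E : ℝ := ∑ i, ∑ j, (∑ k, ∑ l, A y k l * curvMat G k i y l j) * bivec G A y i j
  have h1 : contr G A (rhoForm G A) y = -2 * E := by
    have e : ∑ i, ∑ j, (∑ k, ∑ l, A y k l * curvMat G j k y l i) * bivec G A y i j = E := by
      rw [Finset.sum_comm]
      refine Finset.sum_congr rfl fun j _ => Finset.sum_congr rfl fun i _ => ?_
      rw [hA.bivec_swap hy j i, mul_neg, ← neg_mul, ← Finset.sum_neg_distrib]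
      congr 1
      refine Finset.sum_congr rfl fun k _ => ?_
      rw [← Finset.sum_neg_distrib]
      refine Finset.sum_congr rfl fun l _ => ?_
      rw [IsMetricOn.curvMat_swap k j, Matrix.neg_apply]
      ring
    simp only [contr, hρ, sub_mul, Finset.sum_sub_distrib, neg_mul, Finset.sum_neg_distrib, e]
    ring
  have h2 : E = -∑ i, ∑ k, (A y * curvMat G k i y * bivec G A y) k i := by
    simp only [E]
    rw [← Finset.sum_neg_distrib]
    refine Finset.sum_congr rfl fun i _ => ?_
    simp only [Matrix.mul_apply (N := bivec G A y), Matrix.mul_apply (M := A y)]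
    rw [Finset.sum_comm (γ := Fin 4), ← Finset.sum_neg_distrib]
    refine Finset.sum_congr rfl fun j _ => ?_
    rw [hA.bivec_swap hy j i, mul_neg, Finset.sum_mul]
  have h3 : ∀ i k, A y * curvMat G k i y * bivec G A y = -(curvMat G k i y * (G y)⁻¹) := by
    intro i k
    rw [bivec, ← hA.comm y hy, Matrix.mul_assoc, ← Matrix.mul_assoc (A y), hA.sq y hy]
    simp
  rw [h1, h2, hs]
  simp only [h3, Matrix.neg_apply, Finset.sum_neg_distrib]
  rw [Finset.sum_comm]
  ring

/-- Two contractions of `rho_wedge_beta` with `J g⁻¹` are compared: over two wedge slots (`h1`), and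
over one wedge slot together with the free slot of `β` (`h2`). Both involve the same tensor `t`, and
`h1` makes `t` skew because `β` is. -/
theorem contr_mul_beta (hy : y ∈ T) (k l : Fin 4) :
    contr G A (rhoForm G A) y * betaForm G A k l y =
      contr G A (betaForm G A) y * rhoForm G A k l y := by
  have hH := hA.toIsHermitianOn
  let t : Fin 4 → Fin 4 → ℝ := fun i j =>
    ∑ p, ∑ r, rhoForm G A i p y * bivec G A y p r * betaForm G A j r y
  have h1 : ∀ k l, contr G A (rhoForm G A) y * betaForm G A k l y = 2 * t k l := by
    intro k l
    have e1 : ∑ i, ∑ j, (rhoForm G A i j y * betaForm G A k l y + rhoForm G A j k y *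
        betaForm G A i l y + rhoForm G A k i y * betaForm G A j l y) * bivec G A y i j = 0 := by
      simp only [hA.rho_wedge_beta hy, zero_mul, Finset.sum_const_zero]
    have e2 : ∑ i, ∑ j, rhoForm G A j k y * betaForm G A i l y * bivec G A y i j = -t k l := by
      simp only [t, ← Finset.sum_neg_distrib]
      rw [Finset.sum_comm]
      refine Finset.sum_congr rfl fun j _ => Finset.sum_congr rfl fun i _ => ?_
      rw [IsHermitianOn.rhoForm_swap k j, hH.bivec_swap hy j i, hH.betaForm_swap hy l i]
      ring
    have e3 : ∑ i, ∑ j, rhoForm G A k i y * betaForm G A j l y * bivec G A y i j = -t k l := by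
      simp only [t, ← Finset.sum_neg_distrib]
      refine Finset.sum_congr rfl fun i _ => Finset.sum_congr rfl fun j _ => ?_
      rw [hH.betaForm_swap hy l j]
      ring
    have e4 : ∑ i, ∑ j, rhoForm G A i j y * betaForm G A k l y * bivec G A y i j =
        contr G A (rhoForm G A) y * betaForm G A k l y := by
      simp only [contr, Finset.sum_mul]
      exact Finset.sum_congr rfl fun i _ => Finset.sum_congr rfl fun j _ => by ring
    simp only [add_mul, Finset.sum_add_distrib, e2, e3, e4] at e1
    linarith
  have h2 : contr G A (betaForm G A) y * rhoForm G A k l y = t k l - t l k := by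
    have e1 : ∑ i, ∑ j, (rhoForm G A k l y * betaForm G A i j y + rhoForm G A l i y *
        betaForm G A k j y + rhoForm G A i k y * betaForm G A l j y) * bivec G A y i j = 0 := by
      simp only [hA.rho_wedge_beta hy, zero_mul, Finset.sum_const_zero]
    have e2 : ∑ i, ∑ j, rhoForm G A l i y * betaForm G A k j y * bivec G A y i j = t l k :=
      Finset.sum_congr rfl fun i _ => Finset.sum_congr rfl fun j _ => by ring
    have e3 : ∑ i, ∑ j, rhoForm G A i k y * betaForm G A l j y * bivec G A y i j = -t k l := by
      simp only [t, ← Finset.sum_neg_distrib]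
      refine Finset.sum_congr rfl fun i _ => Finset.sum_congr rfl fun j _ => ?_
      rw [IsHermitianOn.rhoForm_swap k i]
      ring
    have e4 : ∑ i, ∑ j, rhoForm G A k l y * betaForm G A i j y * bivec G A y i j =
        contr G A (betaForm G A) y * rhoForm G A k l y := by
      simp only [contr, Finset.sum_mul]
      exact Finset.sum_congr rfl fun i _ => Finset.sum_congr rfl fun j _ => by ring
    simp only [add_mul, Finset.sum_add_distrib, e2, e3, e4] at e1
    linarith
  have h3 := h1 k l
  have h4 := h1 l k
  rw [hH.betaForm_swap hy k l] at h4
  linarith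

/-- By pair symmetry `ρ` is also a contraction over the form slots of the curvature, so its own
slots become endomorphism slots, where the Gray condition is `J`-invariance. -/
theorem rho_J_invariant (hy : y ∈ T) :
    (A y)ᵀ * (Matrix.of fun i j => rhoForm G A i j y) * A y =
      Matrix.of fun i j => rhoForm G A i j y := by
  have hG := hA.toIsMetricOn
  have hu := hG.isUnit_det hy
  have h1 : (Matrix.of fun i j => rhoForm G A i j y) =
      ∑ k, ∑ l, bivec G A y k l • (G y * curvMat G k l y)ᵀ := by
    ext i j
    have e : A y * curvMat G i j y = bivec G A y * (G y * curvMat G i j y) := by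
      rw [bivec, ← Matrix.mul_assoc, Matrix.nonsing_inv_mul_cancel_right _ _ hu]
    simp only [Matrix.of_apply, rhoForm, e, Matrix.trace, Matrix.diag,
      Matrix.mul_apply (M := bivec G A y), Matrix.sum_apply, Matrix.smul_apply, smul_eq_mul,
      Matrix.transpose_apply]
    exact Finset.sum_congr rfl fun k _ => Finset.sum_congr rfl fun l _ => by
      rw [hG.curvMat_pair hy i j k l]
  have h2 : ∀ k l, (A y)ᵀ * (G y * curvMat G k l y)ᵀ * A y = (G y * curvMat G k l y)ᵀ := by
    intro k l
    have h3 := eq_neg_of_add_eq_zero_right (hA.J_skew hy)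
    have h4 : (A y)ᵀ * (G y * curvMat G k l y) * A y = G y * curvMat G k l y := by
      rw [← Matrix.mul_assoc, h3, Matrix.mul_assoc, hA.comm y hy, Matrix.neg_mul,
        Matrix.mul_assoc (G y), ← Matrix.mul_assoc (A y), hA.sq y hy]
      simp
    conv_rhs => rw [← h4]
    simp only [Matrix.transpose_mul, Matrix.transpose_transpose, Matrix.mul_assoc]
  rw [h1]
  simp only [Finset.mul_sum, Finset.sum_mul, Matrix.mul_smul, Matrix.smul_mul, h2]

/-- The Lee vector field lies in the kernel of `ρ`. -/
theorem rho_leeVec (hy : y ∈ T) (j : Fin 4) :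
    ∑ k, rhoForm G A j k y * leeVec G A k y = 0 := by
  have hH := hA.toIsHermitianOn
  have hG := hA.toIsMetricOn
  let X : Fin 4 → Mat4 := fun k => jNablaJ G A k y * (G y)⁻¹
  have h0 : ∀ i k, rhoForm G A i j y * X k i k + rhoForm G A j k y * X i i k
      + rhoForm G A k i y * X j i k = 0 := by
    intro i k
    have h := congrArg (fun Y => (Y * (G y)⁻¹) i k) (hA.rho_wedge hy i j k)
    simpa only [Matrix.add_mul, Matrix.smul_mul, Matrix.add_apply, Matrix.smul_apply, smul_eq_mul,
      Matrix.zero_mul, Matrix.zero_apply] using h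
  have h1 : ∑ i, ∑ k, rhoForm G A i j y * X k i k = ∑ k, rhoForm G A j k y * leeVec G A k y := by
    refine Finset.sum_congr rfl fun i _ => ?_
    rw [hH.leeVec_eq' hy, ← Finset.mul_sum, IsHermitianOn.rhoForm_swap j i]
    ring
  have h2 : ∑ i, ∑ k, rhoForm G A j k y * X i i k = ∑ k, rhoForm G A j k y * leeVec G A k y := by
    rw [Finset.sum_comm]
    refine Finset.sum_congr rfl fun k _ => ?_
    rw [hH.leeVec_eq hy, ← Finset.mul_sum]
  -- A `J`-invariant form is paired with a bivector that changes sign under `J`.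
  have h3 : ∑ i, ∑ k, rhoForm G A k i y * X j i k = 0 := by
    set R : Mat4 := Matrix.of fun i j => rhoForm G A i j y with hR
    have e : ∑ i, ∑ k, rhoForm G A k i y * X j i k = (R * X j).trace := by
      simp only [Matrix.trace, Matrix.diag, Matrix.mul_apply]
      exact Finset.sum_comm
    have hX : A y * X j * (A y)ᵀ = -X j := by
      have hu := hG.isUnit_det hy
      have hb := IsHermitianOn.skew_raise hG hy (hH.J_skew hy)
      rw [Matrix.transpose_mul, hG.inv_transpose hy] at hb
      have hc : A y * jNablaJ G A j y * A y = jNablaJ G A j y := by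
        rw [jNablaJ, Matrix.mul_assoc, Matrix.mul_assoc, hH.nablaJ_anticomm hy, Matrix.mul_neg,
          Matrix.mul_neg, ← Matrix.mul_assoc (A y) (A y) (A y * _), hH.sq y hy]
        simp
      calc A y * X j * (A y)ᵀ = A y * jNablaJ G A j y * ((G y)⁻¹ * (A y)ᵀ) := by
            simp only [X]; noncomm_ring
        _ = -((A y * jNablaJ G A j y * A y) * (G y)⁻¹) := by rw [hb]; noncomm_ring
        _ = _ := by rw [hc]
    have h4 : (R * X j).trace = -(R * X j).trace := by
      conv_lhs => rw [hR, ← hA.rho_J_invariant hy, ← hR]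
      rw [Matrix.mul_assoc, Matrix.mul_assoc, Matrix.trace_mul_comm, Matrix.mul_assoc, hX,
        Matrix.mul_neg, Matrix.trace_neg]
    rw [e]
    linarith
  have h4 : ∑ i, ∑ k, (rhoForm G A i j y * X k i k + rhoForm G A j k y * X i i k
      + rhoForm G A k i y * X j i k) = 0 := by
    simp only [h0, Finset.sum_const_zero]
  simp only [Finset.sum_add_distrib, h1, h2, h3] at h4
  linarith

/-- The derivative of `⟨β, ω⟩` along the Lee field is a multiple of `⟨β, ω⟩`. -/
theorem leeVec_contr_beta (hs : ∀ z ∈ T, scalar G z ≠ 0) (hy : y ∈ T) :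
    ∑ k, leeVec G A k y * pderiv k (contr G A (betaForm G A)) y =
      (∑ k, leeVec G A k y * pderiv k (contr G A (rhoForm G A)) y) / contr G A (rhoForm G A) y
        * contr G A (betaForm G A) y := by
  have hH := hA.toIsHermitianOn
  have ho := hH.isOpen
  set q := contr G A (betaForm G A) with hq
  set r := contr G A (rhoForm G A) with hr
  have hr0 : ∀ z ∈ T, r z ≠ 0 := fun z hz => by
    rw [hr, hA.contr_rhoForm hz]
    exact mul_ne_zero (by norm_num) (hs z hz)
  have sq : ContDiffOn ℝ ∞ q T := hH.smooth_contr hH.smooth_betaForm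
  have sr : ContDiffOn ℝ ∞ r T := hH.smooth_contr hH.smooth_rhoForm
  let f : R4 → ℝ := fun z => q z / r z
  have sf : ContDiffOn ℝ ∞ f T := sq.div sr hr0
  have df := differentiableAt_of_contDiffOn ho sf hy
  -- On all of `T`, `contr_mul_beta` says `β = fρ`, so the product rule applies.
  have hβ : ∀ i j k, pderiv k (betaForm G A i j) y =
      pderiv k f y * rhoForm G A i j y + f y * pderiv k (rhoForm G A i j) y := by
    intro i j k
    rw [← pderiv_mul k df (differentiableAt_of_contDiffOn ho (hH.smooth_rhoForm i j) hy)]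
    refine pderiv_congr ho hy fun z hz => ?_
    have := hA.contr_mul_beta hz i j
    have h0 := hr0 z hz
    simp only [f]
    field_simp
    linarith
  -- `df ∧ ρ = 0`, from `dβ = 0` and `dρ = 0`.
  have hdf : ∀ i j k, pderiv i f y * rhoForm G A j k y + pderiv j f y * rhoForm G A k i y
      + pderiv k f y * rhoForm G A i j y = 0 := by
    intro i j k
    have h1 := hA.beta_closed hy i j k
    rw [hβ, hβ, hβ] at h1
    linear_combination h1 - f y * hA.rho_closed hy i j k
  -- Inserting the Lee field, which `ρ` annihilates, leaves `θ^♯(f) ρ = 0`; contraction with `J g⁻¹`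
  -- then replaces `ρ` by a nonzero number.
  have hXf : ∑ k, leeVec G A k y * pderiv k f y = 0 := by
    have h1 : ∀ i j, (∑ k, leeVec G A k y * pderiv k f y) * rhoForm G A i j y = 0 := by
      intro i j
      have e : ∑ k, leeVec G A k y * (pderiv i f y * rhoForm G A j k y
          + pderiv j f y * rhoForm G A k i y + pderiv k f y * rhoForm G A i j y) =
          pderiv i f y * (∑ k, rhoForm G A j k y * leeVec G A k y)
          - pderiv j f y * (∑ k, rhoForm G A i k y * leeVec G A k y)
          + (∑ k, leeVec G A k y * pderiv k f y) * rhoForm G A i j y := by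
        rw [Finset.mul_sum, Finset.mul_sum, Finset.sum_mul, ← Finset.sum_sub_distrib,
          ← Finset.sum_add_distrib]
        refine Finset.sum_congr rfl fun k _ => ?_
        rw [IsHermitianOn.rhoForm_swap i k]
        ring
      simp only [hdf, mul_zero, Finset.sum_const_zero, hA.rho_leeVec hy] at e
      linarith
    have h2 : (∑ k, leeVec G A k y * pderiv k f y) * r y = 0 := by
      simp only [hr, contr, Finset.mul_sum (a := ∑ k, leeVec G A k y * pderiv k f y), ← mul_assoc,
        h1, zero_mul, Finset.sum_const_zero]
    exact (mul_eq_zero.1 h2).resolve_right (hr0 y hy)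
  have hqf : ∀ k, pderiv k q y = pderiv k f y * r y + f y * pderiv k r y := by
    intro k
    rw [← pderiv_mul k df (differentiableAt_of_contDiffOn ho sr hy)]
    refine pderiv_congr ho hy fun z hz => ?_
    simp only [f]
    rw [div_mul_cancel₀ _ (hr0 z hz)]
  have h3 : ∑ k, leeVec G A k y * pderiv k q y =
      (∑ k, leeVec G A k y * pderiv k f y) * r y + f y * ∑ k, leeVec G A k y * pderiv k r y := by
    rw [Finset.sum_mul, Finset.mul_sum, ← Finset.sum_add_distrib]
    exact Finset.sum_congr rfl fun k _ => by rw [hqf]; ring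
  rw [h3, hXf]
  simp only [f]
  ring

end IsGrayOn

end Coord

/-! ### The divergence in local coordinates, and changes of coordinates -/

namespace Coord

open Matrix

variable {G A G' A' : R4 → Mat4} {T T' : Set R4} {y : R4} {τ : R4 → R4}

/-- The Riemannian volume density. -/
def density (G : R4 → Mat4) (y : R4) : ℝ := Real.sqrt (G y).det

namespace IsMetricOn

variable (hG : IsMetricOn G T)
include hG

theorem density_pos (hy : y ∈ T) : 0 < density G y :=
  Real.sqrt_pos.2 (hG.posDef y hy).det_pos

theorem smooth_density : ContDiffOn ℝ ∞ (density G) T :=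
  hG.smooth.det.sqrt fun _ hz => hG.det_ne_zero hz

theorem pderiv_density (hy : y ∈ T) (k : Fin 4) :
    pderiv k (density G) y = density G y * (conn G k y).trace := by
  have h1 : pderiv k (fun z => (G z).det) y = 2 * (G y).det * (conn G k y).trace := by
    rw [pderiv_det hG.isOpen hG.smooth hy, hG.mderiv_eq hy, Matrix.mul_add, Matrix.trace_add,
      ← Matrix.mul_assoc, ← Matrix.mul_assoc, Matrix.adjugate_mul, Matrix.trace_mul_comm,
      ← Matrix.mul_assoc, Matrix.mul_adjugate, Matrix.smul_mul, Matrix.smul_mul, Matrix.one_mul,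
      Matrix.one_mul, Matrix.trace_smul, Matrix.trace_smul, Matrix.trace_transpose, smul_eq_mul]
    ring
  have hpos := hG.density_pos hy
  have hs : density G y * density G y = (G y).det :=
    Real.mul_self_sqrt (hG.posDef y hy).det_pos.le
  -- Differentiating `density² = det g` avoids differentiating the square root.
  have h2 := pderiv_mul k (differentiableAt_of_contDiffOn hG.isOpen hG.smooth_density hy)
    (differentiableAt_of_contDiffOn hG.isOpen hG.smooth_density hy)
  rw [pderiv_congr (f := fun z => density G z * density G z) (h := fun z => (G z).det) hG.isOpen hy
    fun z hz => Real.mul_self_sqrt (hG.posDef z hz).det_pos.le, h1, ← hs] at h2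
  have h3 : density G y * (pderiv k (density G) y - density G y * (conn G k y).trace) = 0 := by
    linarith
  exact sub_eq_zero.1 ((mul_eq_zero.1 h3).resolve_left hpos.ne')

theorem mderiv_inv (hy : y ∈ T) (k : Fin 4) :
    mderiv k (fun z => (G z)⁻¹) y =
      -((G y)⁻¹ * (conn G k y)ᵀ) - conn G k y * (G y)⁻¹ := by
  have hu := hG.isUnit_det hy
  have h := mderiv_mul hG.isOpen hG.smooth hG.smooth_inv hy k
  rw [mderiv_congr (H := fun _ => 1) hG.isOpen hy
    fun z hz => Matrix.mul_nonsing_inv _ (hG.isUnit_det hz), mderiv_const, hG.mderiv_eq hy] at h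
  have h2 := congrArg ((G y)⁻¹ * ·) h
  simp only [Matrix.mul_zero, Matrix.mul_add, Matrix.add_mul,
    Matrix.nonsing_inv_mul_cancel_left _ _ hu, Matrix.mul_assoc] at h2
  rw [Matrix.mul_nonsing_inv _ hu, Matrix.mul_one] at h2
  have h3 : mderiv k (fun z => (G z)⁻¹) y = 0 - ((G y)⁻¹ * (conn G k y)ᵀ + conn G k y * (G y)⁻¹) := by
    rw [h2]; abel
  rw [h3]; abel

/-- The divergence formula for the codifferential of a 1-form. -/
theorem sum_pderiv_density {α : Fin 4 → R4 → ℝ} (hα : ∀ l, ContDiffOn ℝ ∞ (α l) T) (hy : y ∈ T) :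
    ∑ k, pderiv k (fun z => density G z * ∑ l, (G z)⁻¹ k l * α l z) y =
      -(density G y * codiffOne G α y) := by
  have ho := hG.isOpen
  have dα := fun l => differentiableAt_of_contDiffOn ho (hα l) hy
  have dI := fun k l => differentiableAt_of_contDiffOn ho (hG.smooth_inv k l) hy
  have dρ := differentiableAt_of_contDiffOn ho hG.smooth_density hy
  have h1 : ∀ k, pderiv k (fun z => density G z * ∑ l, (G z)⁻¹ k l * α l z) y =
      density G y * ∑ l, ((conn G k y).trace * (G y)⁻¹ k l * α l y + (G y)⁻¹ k l * pderiv k (α l) y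
        - ((G y)⁻¹ * (conn G k y)ᵀ) k l * α l y - (conn G k y * (G y)⁻¹) k l * α l y) := by
    intro k
    have ds : DifferentiableAt ℝ (fun z => ∑ l, (G z)⁻¹ k l * α l z) y :=
      DifferentiableAt.fun_sum fun l _ => (dI k l).fun_mul (dα l)
    rw [pderiv_mul k dρ ds, pderiv_sum _ _ fun l _ => (dI k l).fun_mul (dα l),
      hG.pderiv_density hy, mul_assoc, ← mul_add, Finset.mul_sum, ← Finset.sum_add_distrib]
    congr 1
    refine Finset.sum_congr rfl fun l _ => ?_
    rw [pderiv_mul k (dI k l) (dα l)]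
    have := congrFun (congrFun (hG.mderiv_inv hy k) k) l
    rw [mderiv_apply, Matrix.sub_apply, Matrix.neg_apply] at this
    rw [this]
    ring
  simp only [h1]
  rw [← Finset.mul_sum, ← mul_neg]
  congr 1
  simp only [Finset.sum_sub_distrib, Finset.sum_add_distrib, codiffOne, neg_neg, nablaOne, mul_sub]
  -- By symmetry of the Christoffel symbols this part of the derivative of `g⁻¹` cancels the
  -- logarithmic derivative of the density.
  have h2 : ∑ k, ∑ l, (conn G k y * (G y)⁻¹) k l * α l y =
      ∑ k, ∑ l, (conn G k y).trace * (G y)⁻¹ k l * α l y := by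
    simp only [Matrix.mul_apply, Matrix.trace, Matrix.diag, Finset.sum_mul]
    have : ∀ k, ∑ l, ∑ j, conn G k y k j * (G y)⁻¹ j l * α l y =
        ∑ j, ∑ l, conn G j y k k * (G y)⁻¹ j l * α l y := by
      intro k
      rw [Finset.sum_comm]
      exact Finset.sum_congr rfl fun j _ => Finset.sum_congr rfl fun l _ => by
        rw [hG.conn_symm hy k j k]
    simp only [this]
    rw [Finset.sum_comm]
    refine Finset.sum_congr rfl fun j _ => Finset.sum_comm
  have h3 : ∑ k, ∑ l, ((G y)⁻¹ * (conn G k y)ᵀ) k l * α l y =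
      ∑ k, ∑ l, (G y)⁻¹ k l * ∑ m, christoffel G m k l y * α m y := by
    refine Finset.sum_congr rfl fun k _ => ?_
    simp only [Matrix.mul_apply, Finset.sum_mul, Finset.mul_sum, Matrix.transpose_apply]
    rw [Finset.sum_comm]
    exact Finset.sum_congr rfl fun l _ => Finset.sum_congr rfl fun m _ => by
      rw [mul_assoc]; rfl
  rw [h2, h3]
  ring

end IsMetricOn

/-! ### Transformation laws for the connection, `∇J`, the Lee field and `⟨β, ω⟩`. -/

/-- The Jacobian matrix of a map between coordinate domains. -/
def jacobian (τ : R4 → R4) (y : R4) : Mat4 :=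
  Matrix.of fun a i => pderiv i (fun z => τ z a) y

theorem fderiv_single (hτ : DifferentiableAt ℝ τ y) (i a : Fin 4) :
    fderiv ℝ τ y (EuclideanSpace.single i 1) a = jacobian τ y a i := by
  simp only [jacobian, pderiv, Matrix.of_apply]
  have : HasFDerivAt (fun z => τ z a) ((EuclideanSpace.proj a).comp (fderiv ℝ τ y)) y :=
    (EuclideanSpace.proj (𝕜 := ℝ) a).hasFDerivAt.comp y hτ.hasFDerivAt
  rw [this.fderiv]
  rfl

theorem fderiv_single_eq_sum (hτ : DifferentiableAt ℝ τ y) (i : Fin 4) :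
    fderiv ℝ τ y (EuclideanSpace.single i 1) =
      ∑ a, jacobian τ y a i • (EuclideanSpace.single a (1 : ℝ) : R4) := by
  ext b
  rw [fderiv_single hτ]
  simp [Finset.sum_apply, Pi.single_apply]

theorem pderiv_comp {f : R4 → ℝ} (hτ : DifferentiableAt ℝ τ y)
    (hf : DifferentiableAt ℝ f (τ y)) (i : Fin 4) :
    pderiv i (fun z => f (τ z)) y = ∑ a, jacobian τ y a i * pderiv a f (τ y) := by
  have h1 : pderiv i (fun z => f (τ z)) y =
      fderiv ℝ f (τ y) (fderiv ℝ τ y (EuclideanSpace.single i 1)) := by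
    have := (hf.hasFDerivAt.comp y hτ.hasFDerivAt).fderiv
    simp only [pderiv]
    change fderiv ℝ (f ∘ τ) y _ = _
    rw [this]
    rfl
  rw [h1, fderiv_single_eq_sum hτ, map_sum]
  simp [pderiv]

/-- `τ` is a change of coordinates relating `(G, A)` on `T` with `(G', A')` on `T'`. -/
structure IsCoordChange (τ : R4 → R4) (T T' : Set R4) (G A G' A' : R4 → Mat4) : Prop where
  isOpen : IsOpen T
  left : IsHermitianOn G A T
  right : IsHermitianOn G' A' T'
  mapsTo : ∀ z ∈ T, τ z ∈ T'
  smooth : ContDiffOn ℝ ∞ τ T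
  metric : ∀ z ∈ T, G z = (jacobian τ z)ᵀ * G' (τ z) * jacobian τ z
  complex : ∀ z ∈ T, jacobian τ z * A z = A' (τ z) * jacobian τ z

namespace IsCoordChange

variable (hτ : IsCoordChange τ T T' G A G' A')
include hτ

theorem differentiableAt (hy : y ∈ T) : DifferentiableAt ℝ τ y :=
  (hτ.smooth.contDiffAt (hτ.isOpen.mem_nhds hy)).differentiableAt (by simp)

theorem smooth_coord (a : Fin 4) : ContDiffOn ℝ ∞ (fun z => τ z a) T :=
  (EuclideanSpace.proj (𝕜 := ℝ) a).contDiff.comp_contDiffOn hτ.smooth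

theorem smooth_jacobian : SmoothOn (jacobian τ) T :=
  fun a i => contDiffOn_pderiv hτ.isOpen (hτ.smooth_coord a) i

theorem smooth_comp {F : R4 → Mat4} (hF : SmoothOn F T') : SmoothOn (fun z => F (τ z)) T :=
  fun a b => (hF a b).comp hτ.smooth fun z hz => hτ.mapsTo z hz

theorem mderiv_comp {F : R4 → Mat4} (hF : SmoothOn F T') (hy : y ∈ T) (i : Fin 4) :
    mderiv i (fun z => F (τ z)) y = ∑ a, jacobian τ y a i • mderiv a F (τ y) := by
  ext b c
  rw [mderiv_apply, pderiv_comp (f := fun z => F z b c) (hτ.differentiableAt hy)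
    (differentiableAt_of_contDiffOn hτ.right.isOpen (hF b c) (hτ.mapsTo y hy)), Matrix.sum_apply]
  rfl

theorem isUnit_det_jacobian (hy : y ∈ T) : IsUnit (jacobian τ y).det := by
  have h := hτ.left.toIsMetricOn.det_ne_zero hy
  rw [hτ.metric y hy, Matrix.det_mul] at h
  exact (right_ne_zero_of_mul h).isUnit

theorem mderiv_jacobian_symm (hy : y ∈ T) (i j a : Fin 4) :
    mderiv i (jacobian τ) y a j = mderiv j (jacobian τ) y a i :=
  pderiv_comm hτ.isOpen (hτ.smooth_coord a) hy i j

/-- The transformation law of the Christoffel symbols. -/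
theorem conn_eq (hy : y ∈ T) (i : Fin 4) :
    jacobian τ y * conn G i y =
      (∑ a, jacobian τ y a i • conn G' a (τ y)) * jacobian τ y + mderiv i (jacobian τ) y := by
  have hu := hτ.isUnit_det_jacobian hy
  have hy' := hτ.mapsTo y hy
  have hG' := hτ.right.toIsMetricOn
  set P := jacobian τ y with hP
  let M : Fin 4 → Mat4 := fun i => ∑ a, P a i • conn G' a (τ y)
  -- The connection pulled back along `τ`. It is torsion-free and preserves the pulled-back metric,
  -- so `conn_unique` identifies it with the Levi-Civita connection.
  let Γ : Fin 4 → Mat4 := fun i => P⁻¹ * (M i * P + mderiv i (jacobian τ) y)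
  have hPΓ : ∀ i, P * Γ i = M i * P + mderiv i (jacobian τ) y :=
    fun i => Matrix.mul_nonsing_inv_cancel_left _ _ hu
  have hΓ : ∀ i, Γ i = conn G i y := by
    refine hτ.left.toIsMetricOn.conn_unique hy Γ (fun i j k => ?_) fun i => ?_
    · have : ∀ l, (M i * P + mderiv i (jacobian τ) y) l j =
          (M j * P + mderiv j (jacobian τ) y) l i := by
        intro l
        simp only [Matrix.add_apply, M, Matrix.mul_apply, Matrix.sum_apply, Matrix.smul_apply,
          smul_eq_mul, Finset.sum_mul]
        rw [hτ.mderiv_jacobian_symm hy i j l, Finset.sum_comm]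
        congr 1
        refine Finset.sum_congr rfl fun a _ => Finset.sum_congr rfl fun m _ => ?_
        rw [hG'.conn_symm hy' a m l]
        ring
      simp only [Γ, Matrix.mul_apply (M := P⁻¹), this]
    · have ho := hτ.isOpen
      have hJ := hτ.smooth_jacobian
      have hGτ := hτ.smooth_comp hτ.right.smooth
      have hM : mderiv i (fun z => G' (τ z)) y = (M i)ᵀ * G' (τ y) + G' (τ y) * M i := by
        rw [hτ.mderiv_comp hτ.right.smooth hy]
        simp only [M, Matrix.transpose_sum, Matrix.transpose_smul, Finset.sum_mul, Finset.mul_sum,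
          Matrix.smul_mul, Matrix.mul_smul, ← Finset.sum_add_distrib, ← smul_add,
          hG'.mderiv_eq hy', hP]
      rw [mderiv_congr ho hy hτ.metric, mderiv_mul ho (hJ.transpose.mul hGτ) hJ hy,
        mderiv_mul ho hJ.transpose hGτ hy, mderiv_transpose, hM, hτ.metric y hy, ← hP]
      have e1 : Pᵀ * G' (τ y) * P * Γ i = Pᵀ * G' (τ y) * (P * Γ i) := by noncomm_ring
      have e2 : (Γ i)ᵀ * (Pᵀ * G' (τ y) * P) = (P * Γ i)ᵀ * G' (τ y) * P := by
        rw [Matrix.transpose_mul P]; simp only [Matrix.mul_assoc]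
      rw [e1, e2, hPΓ, Matrix.transpose_add, Matrix.transpose_mul]
      noncomm_ring
  rw [← hΓ, hPΓ]

/-- Differentiating `P A = (A' ∘ τ) P` produces second derivatives of `τ`, which cancel against
those in the law for the connection. -/
theorem nablaJ_eq (hy : y ∈ T) (i : Fin 4) :
    jacobian τ y * nablaJ G A i y =
      (∑ a, jacobian τ y a i • nablaJ G' A' a (τ y)) * jacobian τ y := by
  have ho := hτ.isOpen
  have hJ := hτ.smooth_jacobian
  have h1 := mderiv_mul ho hJ hτ.left.smooth_J hy i
  rw [mderiv_congr ho hy hτ.complex, mderiv_mul ho (hτ.smooth_comp hτ.right.smooth_J) hJ hy,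
    hτ.mderiv_comp hτ.right.smooth_J hy] at h1
  have hc := hτ.conn_eq hy i
  have hA := hτ.complex y hy
  set P := jacobian τ y with hP
  set M := ∑ a, P a i • conn G' a (τ y) with hM
  set D := ∑ a, P a i • mderiv a A' (τ y) with hD
  have h2 : ∑ a, P a i • nablaJ G' A' a (τ y) = D + (M * A' (τ y) - A' (τ y) * M) := by
    simp only [nablaJ, covDeriv, hD, hM, smul_add, smul_sub, Finset.sum_add_distrib,
      Finset.sum_sub_distrib, Finset.sum_mul, Finset.mul_sum, Matrix.smul_mul, Matrix.mul_smul]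
  rw [h2, nablaJ, covDeriv]
  have h3 : P * mderiv i A y = D * P + A' (τ y) * mderiv i (jacobian τ) y
      - mderiv i (jacobian τ) y * A y := by
    rw [h1]; abel
  calc P * (mderiv i A y + (conn G i y * A y - A y * conn G i y))
      = P * mderiv i A y + (P * conn G i y) * A y - (P * A y) * conn G i y := by noncomm_ring
    _ = P * mderiv i A y + (P * conn G i y) * A y - A' (τ y) * (P * conn G i y) := by
        rw [hA]; noncomm_ring
    _ = D * P + M * (P * A y) - A' (τ y) * M * P := by rw [h3, hc]; noncomm_ring
    _ = _ := by rw [hA]; noncomm_ring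

theorem jNablaJ_eq (hy : y ∈ T) (i : Fin 4) :
    jacobian τ y * jNablaJ G A i y =
      (∑ a, jacobian τ y a i • jNablaJ G' A' a (τ y)) * jacobian τ y := by
  rw [jNablaJ, ← Matrix.mul_assoc, hτ.complex y hy, Matrix.mul_assoc, hτ.nablaJ_eq hy,
    ← Matrix.mul_assoc, Finset.mul_sum]
  simp only [Matrix.mul_smul, jNablaJ]

/-- The Lee form transforms as a covector. -/
theorem leeForm_eq (hy : y ∈ T) (l : Fin 4) :
    leeForm G A l y = ∑ a, leeForm G' A' a (τ y) * jacobian τ y a l := by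
  have hy' := hτ.mapsTo y hy
  have h1 : ∀ i, jNablaJ G A i y =
      ∑ a, jacobian τ y a i • ((jacobian τ y)⁻¹ * jNablaJ G' A' a (τ y) * jacobian τ y) := by
    intro i
    rw [← Matrix.nonsing_inv_mul_cancel_left _ (jNablaJ G A i y) (hτ.isUnit_det_jacobian hy),
      hτ.jNablaJ_eq hy, ← Matrix.mul_assoc, Finset.mul_sum, Finset.sum_mul]
    simp only [Matrix.mul_smul, Matrix.smul_mul]
  have h2 : ∀ a, ∑ i, jacobian τ y a i *
      ((jacobian τ y)⁻¹ * jNablaJ G' A' a (τ y) * jacobian τ y) i l =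
      (jNablaJ G' A' a (τ y) * jacobian τ y) a l := by
    intro a
    rw [← Matrix.mul_apply, ← Matrix.mul_assoc,
      Matrix.mul_nonsing_inv_cancel_left _ _ (hτ.isUnit_det_jacobian hy)]
  rw [hτ.left.leeForm_eq hy]
  simp only [h1, Matrix.sum_apply, Matrix.smul_apply, smul_eq_mul]
  rw [Finset.sum_comm, Finset.sum_congr rfl fun a _ => h2 a]
  simp only [hτ.right.leeForm_eq hy', Matrix.mul_apply, Finset.sum_mul]
  exact Finset.sum_comm

theorem inv_metric (hy : y ∈ T) :
    (G' (τ y))⁻¹ = jacobian τ y * (G y)⁻¹ * (jacobian τ y)ᵀ := by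
  have hu := hτ.isUnit_det_jacobian hy
  have hut : IsUnit ((jacobian τ y)ᵀ).det := by rwa [Matrix.det_transpose]
  rw [hτ.metric y hy, Matrix.mul_inv_rev, Matrix.mul_inv_rev, ← Matrix.mul_assoc,
    Matrix.mul_nonsing_inv _ hu, Matrix.one_mul, Matrix.nonsing_inv_mul_cancel_right _ _ hut]

/-- The Lee vector field transforms as a vector. -/
theorem leeVec_eq (hy : y ∈ T) (a : Fin 4) :
    leeVec G' A' a (τ y) = ∑ k, jacobian τ y a k * leeVec G A k y := by
  have h1 : (fun a => leeVec G' A' a (τ y)) = (G' (τ y))⁻¹ *ᵥ fun a => leeForm G' A' a (τ y) := rfl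
  have h2 : (fun a => leeVec G A a y) = (G y)⁻¹ *ᵥ fun a => leeForm G A a y := rfl
  have h3 : (fun l => leeForm G A l y) = (jacobian τ y)ᵀ *ᵥ fun a => leeForm G' A' a (τ y) := by
    funext l
    rw [hτ.leeForm_eq hy]
    exact Finset.sum_congr rfl fun a _ => mul_comm _ _
  have h4 : (fun a => leeVec G' A' a (τ y)) = jacobian τ y *ᵥ fun a => leeVec G A a y := by
    rw [h1, h2, h3, hτ.inv_metric hy, Matrix.mulVec_mulVec, Matrix.mulVec_mulVec, Matrix.mul_assoc]
  exact congrFun h4 a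

theorem betaForm_eq (hy : y ∈ T) (i j : Fin 4) :
    betaForm G A i j y =
      ∑ a, ∑ b, jacobian τ y a i * jacobian τ y b j * betaForm G' A' a b (τ y) := by
  have hu := hτ.isUnit_det_jacobian hy
  have hA := hτ.complex y hy
  have hB := hτ.nablaJ_eq hy
  set P := jacobian τ y with hP
  have h1 : P * (A y * (nablaJ G A i y * nablaJ G A j y)) =
      (A' (τ y) * ((∑ a, P a i • nablaJ G' A' a (τ y)) * (∑ a, P a j • nablaJ G' A' a (τ y)))) * P := by
    rw [← Matrix.mul_assoc, hA, Matrix.mul_assoc, ← Matrix.mul_assoc P, hB, Matrix.mul_assoc _ P,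
      hB]
    noncomm_ring
  have h2 : betaForm G A i j y = (A' (τ y) * ((∑ a, P a i • nablaJ G' A' a (τ y)) *
      (∑ a, P a j • nablaJ G' A' a (τ y)))).trace := by
    rw [betaForm, ← Matrix.nonsing_inv_mul_cancel_left P (A y * _) hu, h1, ← Matrix.mul_assoc,
      Matrix.trace_mul_comm, ← Matrix.mul_assoc, Matrix.mul_nonsing_inv _ hu, Matrix.one_mul]
  rw [h2, Finset.sum_mul_sum]
  simp only [Finset.mul_sum, Matrix.trace_sum, Matrix.smul_mul, Matrix.mul_smul, Matrix.trace_smul,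
    smul_eq_mul, betaForm, mul_assoc]
  exact Finset.sum_congr rfl fun a _ => Finset.sum_congr rfl fun b _ => mul_left_comm _ _ _

/-- The function `⟨β, ω⟩` is invariant. -/
theorem contr_betaForm_eq (hy : y ∈ T) :
    contr G' A' (betaForm G' A') (τ y) = contr G A (betaForm G A) y := by
  have hW : bivec G' A' (τ y) = jacobian τ y * bivec G A y * (jacobian τ y)ᵀ := by
    rw [bivec, hτ.inv_metric hy, ← Matrix.mul_assoc, ← Matrix.mul_assoc, ← hτ.complex y hy, bivec,
      ← Matrix.mul_assoc]
  have e : ∀ a b, bivec G' A' (τ y) a b =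
      ∑ i, ∑ j, jacobian τ y a i * bivec G A y i j * jacobian τ y b j := by
    intro a b
    rw [hW, Matrix.mul_assoc]
    simp only [Matrix.mul_apply, Finset.mul_sum, Matrix.transpose_apply, mul_assoc]
  simp only [contr, e, hτ.betaForm_eq hy, Finset.mul_sum, Finset.sum_mul]
  calc ∑ a, ∑ b, ∑ i, ∑ j, betaForm G' A' a b (τ y) *
        (jacobian τ y a i * bivec G A y i j * jacobian τ y b j)
      = ∑ a, ∑ i, ∑ b, ∑ j, betaForm G' A' a b (τ y) *
        (jacobian τ y a i * bivec G A y i j * jacobian τ y b j) :=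
        Finset.sum_congr rfl fun a _ => Finset.sum_comm
    _ = ∑ i, ∑ a, ∑ b, ∑ j, betaForm G' A' a b (τ y) *
        (jacobian τ y a i * bivec G A y i j * jacobian τ y b j) := Finset.sum_comm
    _ = ∑ i, ∑ a, ∑ j, ∑ b, betaForm G' A' a b (τ y) *
        (jacobian τ y a i * bivec G A y i j * jacobian τ y b j) :=
        Finset.sum_congr rfl fun i _ => Finset.sum_congr rfl fun a _ => Finset.sum_comm
    _ = ∑ i, ∑ j, ∑ a, ∑ b, betaForm G' A' a b (τ y) *
        (jacobian τ y a i * bivec G A y i j * jacobian τ y b j) :=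
        Finset.sum_congr rfl fun i _ => Finset.sum_comm
    _ = _ := Finset.sum_congr rfl fun i _ => Finset.sum_congr rfl fun j _ =>
        Finset.sum_congr rfl fun a _ => Finset.sum_congr rfl fun b _ => by ring

theorem density_eq (hy : y ∈ T) :
    density G y = |(jacobian τ y).det| * density G' (τ y) := by
  have hpos := (hτ.right.posDef _ (hτ.mapsTo y hy)).det_pos
  rw [density, density, hτ.metric y hy, Matrix.det_mul, Matrix.det_mul, Matrix.det_transpose,
    mul_right_comm, Real.sqrt_mul (mul_self_nonneg _), Real.sqrt_mul_self_eq_abs]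

/-- The derivative of a function along the Lee vector field is invariant. -/
theorem leeVec_pderiv_eq {f f' : R4 → ℝ} (hf' : DifferentiableAt ℝ f' (τ y))
    (hff' : ∀ z ∈ T, f z = f' (τ z)) (hy : y ∈ T) :
    ∑ k, leeVec G A k y * pderiv k f y = ∑ a, leeVec G' A' a (τ y) * pderiv a f' (τ y) := by
  simp only [pderiv_congr hτ.isOpen hy hff', pderiv_comp (hτ.differentiableAt hy) hf',
    hτ.leeVec_eq hy, Finset.mul_sum, Finset.sum_mul]
  rw [Finset.sum_comm]
  exact Finset.sum_congr rfl fun a _ => Finset.sum_congr rfl fun k _ => by ring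

end IsCoordChange

end Coord

/-! ### Charts of an almost Hermitian manifold -/

namespace AlmostHermitian

open Matrix Coord

variable {M : Type*} [TopologicalSpace M] [ChartedSpace R4 M] [IsManifold 𝓘(ℝ, R4) ∞ M]
variable {e e' : OpenPartialHomeomorph M R4} {y : R4}

/-- The differential of the inverse of a chart, with the tangent space identified with `ℝ⁴`. -/
def symmDeriv (e : OpenPartialHomeomorph M R4) (y : R4) : R4 →L[ℝ] R4 :=
  mfderiv 𝓘(ℝ, R4) 𝓘(ℝ, R4) e.symm y

/-- The differential of a chart, with the tangent space identified with `ℝ⁴`. -/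
def chartDeriv (e : OpenPartialHomeomorph M R4) (x : M) : R4 →L[ℝ] R4 :=
  mfderiv 𝓘(ℝ, R4) 𝓘(ℝ, R4) e x

/-- The metric, with the tangent space identified with `ℝ⁴`. -/
def innerR4 (S : AlmostHermitian M) (x : M) : R4 →L[ℝ] R4 →L[ℝ] ℝ := S.g.inner x

/-- The almost complex structure, with the tangent space identified with `ℝ⁴`. -/
def complexR4 (S : AlmostHermitian M) (x : M) : R4 →L[ℝ] R4 := S.J x

theorem metricMatrix_apply (S : AlmostHermitian M) (e : OpenPartialHomeomorph M R4) (y : R4)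
    (i j : Fin 4) : S.metricMatrix e y i j =
      S.innerR4 (e.symm y) (symmDeriv e y (EuclideanSpace.single i 1))
        (symmDeriv e y (EuclideanSpace.single j 1)) := rfl

theorem complexMatrix_apply (S : AlmostHermitian M) (e : OpenPartialHomeomorph M R4) (y : R4)
    (i j : Fin 4) : S.complexMatrix e y i j =
      chartDeriv e (e.symm y)
        (S.complexR4 (e.symm y) (symmDeriv e y (EuclideanSpace.single j 1))) i := rfl

theorem chartDeriv_symmDeriv (he : e ∈ atlas R4 M) (hy : y ∈ e.target) (v : R4) :
    chartDeriv e (e.symm y) (symmDeriv e y v) = v := by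
  have h := (mdifferentiable_of_mem_atlas (I := 𝓘(ℝ, R4)) he).comp_symm_deriv hy
  exact DFunLike.congr_fun h v

theorem symmDeriv_chartDeriv (he : e ∈ atlas R4 M) (hy : y ∈ e.target) (v : R4) :
    symmDeriv e y (chartDeriv e (e.symm y) v) = v := by
  have h := (mdifferentiable_of_mem_atlas (I := 𝓘(ℝ, R4)) he).symm_comp_deriv (e.map_target hy)
  have h2 : symmDeriv e (e (e.symm y)) (chartDeriv e (e.symm y) v) = v := DFunLike.congr_fun h v
  rwa [e.right_inv hy] at h2

theorem single_sum (v : R4) : v = ∑ i, v i • (EuclideanSpace.single i (1 : ℝ) : R4) := by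
  ext b
  simp [Finset.sum_apply, Pi.single_apply]

theorem complexR4_symmDeriv (S : AlmostHermitian M) (he : e ∈ atlas R4 M) (hy : y ∈ e.target)
    (j : Fin 4) :
    S.complexR4 (e.symm y) (symmDeriv e y (EuclideanSpace.single j 1)) =
      symmDeriv e y (∑ i, S.complexMatrix e y i j • (EuclideanSpace.single i (1 : ℝ) : R4)) := by
  simp only [complexMatrix_apply]
  rw [← single_sum, symmDeriv_chartDeriv he hy]

theorem complexR4_sq (S : AlmostHermitian M) (x : M) (v : R4) :
    S.complexR4 x (S.complexR4 x v) = -v := S.J_sq x v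

theorem innerR4_complexR4 (S : AlmostHermitian M) (x : M) (v w : R4) :
    S.innerR4 x (S.complexR4 x v) (S.complexR4 x w) = S.innerR4 x v w := S.J_orthogonal x v w

theorem mem_maximalAtlas (he : e ∈ atlas R4 M) : e ∈ IsManifold.maximalAtlas 𝓘(ℝ, R4) ∞ M :=
  StructureGroupoid.subset_maximalAtlas _ he

/-- The coordinate field is the tangent map of `e.symm` applied to a constant section. -/
theorem contMDiffOn_coordVector (he : e ∈ atlas R4 M) (j : Fin 4) :
    ContMDiffOn 𝓘(ℝ, R4) 𝓘(ℝ, R4).tangent ∞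
      (fun y => (⟨e.symm y, coordVector e y j⟩ : TangentBundle 𝓘(ℝ, R4) M)) e.target := by
  have h1 := contMDiffOn_symm_of_mem_maximalAtlas (mem_maximalAtlas he)
  have : IsManifold 𝓘(ℝ, R4) 1 M := IsManifold.of_le (n := ∞) (by simp)
  have h2 := h1.contMDiffOn_tangentMapWithin (m := ∞) (by simp) e.open_target.uniqueMDiffOn
  have h3 : ContMDiff 𝓘(ℝ, R4) 𝓘(ℝ, R4).tangent ∞
      (fun y : R4 => (⟨y, (EuclideanSpace.single j (1 : ℝ) : R4)⟩ : TangentBundle 𝓘(ℝ, R4) R4)) :=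
    fun y => contMDiffAt_vectorSpace_iff_contDiffAt.2 contDiffAt_const
  refine (h2.comp h3.contMDiffOn fun y hy => hy).congr fun y hy => ?_
  simp only [tangentMapWithin, Function.comp, mfderivWithin_of_isOpen e.open_target hy]
  rfl

theorem smooth_metricMatrix (S : AlmostHermitian M) (he : e ∈ atlas R4 M) :
    SmoothOn (S.metricMatrix e) e.target := by
  intro i j
  have hb := contMDiffOn_symm_of_mem_maximalAtlas (mem_maximalAtlas he)
  have h : ContMDiffOn 𝓘(ℝ, R4) (𝓘(ℝ, R4).prod 𝓘(ℝ)) ∞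
      (fun y => Bundle.TotalSpace.mk' ℝ (E := Bundle.Trivial M ℝ) (e.symm y)
        (S.g.inner (e.symm y) (coordVector e y i) (coordVector e y j))) e.target := by
    apply ContMDiffOn.clm_bundle_apply₂ (F₁ := R4) (F₂ := R4)
    · exact S.g.contMDiff.comp_contMDiffOn hb
    · exact contMDiffOn_coordVector he i
    · exact contMDiffOn_coordVector he j
  rw [← contMDiffOn_iff_contDiffOn]
  intro y hy
  have := h y hy
  simp only [Bundle.contMDiffWithinAt_totalSpace] at this
  exact this.2

theorem smooth_complexMatrix (S : AlmostHermitian M) (he : e ∈ atlas R4 M) :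
    SmoothOn (S.complexMatrix e) e.target := by
  intro i j
  have hb := contMDiffOn_symm_of_mem_maximalAtlas (mem_maximalAtlas he)
  have h : ContMDiffOn 𝓘(ℝ, R4) 𝓘(ℝ, R4).tangent ∞
      (fun y => (⟨e.symm y, S.J (e.symm y) (coordVector e y j)⟩ : TangentBundle 𝓘(ℝ, R4) M))
      e.target := by
    apply ContMDiffOn.clm_bundle_apply (F₁ := R4) (F₂ := R4)
    · exact S.smooth_J.comp_contMDiffOn hb
    · exact contMDiffOn_coordVector he j
  have : IsManifold 𝓘(ℝ, R4) 1 M := IsManifold.of_le (n := ∞) (by simp)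
  have h1 := contMDiffOn_of_mem_maximalAtlas (mem_maximalAtlas he)
  have h2 := h1.contMDiffOn_tangentMapWithin (m := ∞) (by simp) e.open_source.uniqueMDiffOn
  have h3 := h2.comp h fun y hy => e.map_target hy
  have h4 := (contMDiff_snd_tangentBundle_modelSpace R4 𝓘(ℝ, R4)).comp_contMDiffOn h3
  have h5 := (EuclideanSpace.proj (𝕜 := ℝ) i).contDiff.comp_contDiffOn
    (contMDiffOn_iff_contDiffOn.1 h4)
  refine h5.congr fun y hy => ?_
  simp only [tangentMapWithin, Function.comp,
    mfderivWithin_of_isOpen e.open_source (e.map_target hy)]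
  rfl

theorem posDef_metricMatrix (S : AlmostHermitian M) (he : e ∈ atlas R4 M) (hy : y ∈ e.target) :
    (S.metricMatrix e y).PosDef := by
  refine Matrix.PosDef.of_dotProduct_mulVec_pos ?_ fun v hv => ?_
  · ext i j
    exact S.g.symm _ _ _
  · let w : R4 := WithLp.toLp 2 v
    have hw : w ≠ 0 := fun h => hv (by
      have := congrArg WithLp.ofLp h
      simpa [w] using this)
    have hLw : symmDeriv e y w ≠ 0 := fun h => hw (by
      rw [← chartDeriv_symmDeriv he hy w, h, map_zero])
    have h1 : 0 < S.innerR4 (e.symm y) (symmDeriv e y w) (symmDeriv e y w) :=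
      S.g.pos (e.symm y) (symmDeriv e y w) hLw
    have h2 : star v ⬝ᵥ S.metricMatrix e y *ᵥ v =
        S.innerR4 (e.symm y) (symmDeriv e y w) (symmDeriv e y w) := by
      rw [single_sum w]
      simp only [map_sum, map_smul, _root_.sum_apply, _root_.smul_apply, dotProduct, mulVec,
        metricMatrix_apply, smul_eq_mul, Finset.mul_sum, w, star_trivial]
      rw [Finset.sum_comm]
      exact Finset.sum_congr rfl fun i _ => Finset.sum_congr rfl fun j _ => by ring
    rw [h2]
    exact h1

theorem isHermitianOn (S : AlmostHermitian M) (he : e ∈ atlas R4 M) :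
    IsHermitianOn (S.metricMatrix e) (S.complexMatrix e) e.target where
  isOpen := e.open_target
  smooth := S.smooth_metricMatrix he
  posDef _ hy := S.posDef_metricMatrix he hy
  smooth_J := S.smooth_complexMatrix he
  sq y hy := by
    have h : ∀ j, ∑ k, (S.complexMatrix e y * S.complexMatrix e y) k j •
        (EuclideanSpace.single k (1 : ℝ) : R4) = -(EuclideanSpace.single j 1) := by
      intro j
      have h1 := S.complexR4_sq (e.symm y) (symmDeriv e y (EuclideanSpace.single j 1))
      rw [S.complexR4_symmDeriv he hy] at h1
      simp only [map_sum, map_smul, S.complexR4_symmDeriv he hy] at h1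
      have h2 := congrArg (chartDeriv e (e.symm y)) h1
      simp only [map_sum, map_smul, map_neg, chartDeriv_symmDeriv he hy] at h2
      rw [← h2]
      simp only [Matrix.mul_apply, Finset.sum_smul, Finset.smul_sum, smul_smul]
      rw [Finset.sum_comm]
      exact Finset.sum_congr rfl fun i _ => Finset.sum_congr rfl fun k _ => by rw [mul_comm]
    ext k j
    have := congrArg (fun v : R4 => v k) (h j)
    simpa [Finset.sum_apply, Pi.single_apply, Matrix.one_apply] using this
  orthogonal y hy := by
    ext i j
    have h := S.innerR4_complexR4 (e.symm y) (symmDeriv e y (EuclideanSpace.single i 1))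
      (symmDeriv e y (EuclideanSpace.single j 1))
    rw [S.complexR4_symmDeriv he hy, S.complexR4_symmDeriv he hy] at h
    simp only [map_sum, map_smul, _root_.sum_apply, _root_.smul_apply, smul_eq_mul,
      ← metricMatrix_apply] at h
    rw [← h]
    simp only [Matrix.mul_apply, Matrix.transpose_apply, Finset.sum_mul, Finset.mul_sum]
    exact Finset.sum_congr rfl fun x _ => Finset.sum_congr rfl fun x' _ => by ring

/-! ### Transition maps as coordinate changes. -/

/-- The change of coordinates between two charts. -/
def transition (e e' : OpenPartialHomeomorph M R4) (y : R4) : R4 := e' (e.symm y)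

theorem contDiffOn_transition (he : e ∈ atlas R4 M) (he' : e' ∈ atlas R4 M) :
    ContDiffOn ℝ ∞ (transition e e') (e.target ∩ e.symm ⁻¹' e'.source) := by
  rw [← contMDiffOn_iff_contDiffOn]
  exact (contMDiffOn_of_mem_maximalAtlas (mem_maximalAtlas he')).comp
    ((contMDiffOn_symm_of_mem_maximalAtlas (mem_maximalAtlas he)).mono Set.inter_subset_left)
    fun y hy => hy.2

omit [ChartedSpace R4 M] [IsManifold 𝓘(ℝ, R4) ∞ M] in
theorem isOpen_overlap (e e' : OpenPartialHomeomorph M R4) :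
    IsOpen (e.target ∩ e.symm ⁻¹' e'.source) :=
  e.symm.isOpen_inter_preimage e'.open_source

theorem symmDeriv_transition (he : e ∈ atlas R4 M) (he' : e' ∈ atlas R4 M)
    (hy : y ∈ e.target ∩ e.symm ⁻¹' e'.source) (v : R4) :
    symmDeriv e y v = symmDeriv e' (transition e e' y) (fderiv ℝ (transition e e') y v) := by
  have ho := isOpen_overlap e e'
  have hd : DifferentiableAt ℝ (transition e e') y :=
    ((contDiffOn_transition he he').contDiffAt (ho.mem_nhds hy)).differentiableAt (by simp)
  have h1 : mfderiv 𝓘(ℝ, R4) 𝓘(ℝ, R4) e.symm y =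
      mfderiv 𝓘(ℝ, R4) 𝓘(ℝ, R4) (e'.symm ∘ transition e e') y := by
    refine Filter.EventuallyEq.mfderiv_eq ?_
    filter_upwards [ho.mem_nhds hy] with z hz
    exact (e'.left_inv hz.2).symm
  have h2 := mfderiv_comp y (I := 𝓘(ℝ, R4)) (I' := 𝓘(ℝ, R4)) (I'' := 𝓘(ℝ, R4)) (g := e'.symm)
    (f := transition e e')
    (mdifferentiableAt_atlas_symm he' (e'.map_source hy.2)) hd.mdifferentiableAt
  rw [mfderiv_eq_fderiv] at h2
  rw [symmDeriv, h1]
  exact DFunLike.congr_fun h2 v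

theorem _root_.Coord.IsHermitianOn.mono {G A : R4 → Mat4} {T T' : Set R4}
    (h : IsHermitianOn G A T) (hT' : IsOpen T') (hs : T' ⊆ T) : IsHermitianOn G A T' where
  isOpen := hT'
  smooth a b := (h.smooth a b).mono hs
  posDef y hy := h.posDef y (hs hy)
  smooth_J a b := (h.smooth_J a b).mono hs
  sq y hy := h.sq y (hs hy)
  orthogonal y hy := h.orthogonal y (hs hy)

theorem isCoordChange (S : AlmostHermitian M) (he : e ∈ atlas R4 M) (he' : e' ∈ atlas R4 M) :
    IsCoordChange (transition e e') (e.target ∩ e.symm ⁻¹' e'.source) e'.target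
      (S.metricMatrix e) (S.complexMatrix e) (S.metricMatrix e') (S.complexMatrix e') := by
  have ho := isOpen_overlap e e'
  have hd : ∀ z ∈ e.target ∩ e.symm ⁻¹' e'.source, DifferentiableAt ℝ (transition e e') z :=
    fun z hz => ((contDiffOn_transition he he').contDiffAt (ho.mem_nhds hz)).differentiableAt
      (by simp)
  have hL : ∀ z ∈ e.target ∩ e.symm ⁻¹' e'.source, ∀ i,
      symmDeriv e z (EuclideanSpace.single i 1) = ∑ a, jacobian (transition e e') z a i •
        symmDeriv e' (transition e e' z) (EuclideanSpace.single a 1) := by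
    intro z hz i
    rw [symmDeriv_transition he he' hz, fderiv_single_eq_sum (hd z hz)]
    simp only [map_sum, map_smul]
  have hx : ∀ z ∈ e.target ∩ e.symm ⁻¹' e'.source,
      e'.symm (transition e e' z) = e.symm z := fun z hz => e'.left_inv hz.2
  refine ⟨ho, (S.isHermitianOn he).mono ho Set.inter_subset_left, S.isHermitianOn he',
    fun z hz => e'.map_source hz.2, contDiffOn_transition he he', fun z hz => ?_, fun z hz => ?_⟩
  · ext i j
    rw [metricMatrix_apply, hL z hz, hL z hz]
    simp only [map_sum, map_smul, _root_.sum_apply, _root_.smul_apply, smul_eq_mul,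
      Matrix.mul_apply, Matrix.transpose_apply, metricMatrix_apply, hx z hz, Finset.sum_mul,
      Finset.mul_sum]
    exact Finset.sum_congr rfl fun x _ => Finset.sum_congr rfl fun x' _ => by ring
  · have hy' : transition e e' z ∈ e'.target := e'.map_source hz.2
    ext b j
    have h1 := S.complexR4_symmDeriv he hz.1 j
    rw [hL z hz] at h1
    have h2 := congrArg (chartDeriv e' (e'.symm (transition e e' z))) h1
    rw [← hx z hz] at h2
    simp only [map_sum, map_smul, hL z hz, S.complexR4_symmDeriv he' hy',
      chartDeriv_symmDeriv he' hy'] at h2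
    have h3 := congrArg (fun v : R4 => v b) h2
    simp only [PiLp.smul_apply, PiLp.single_apply, WithLp.ofLp_sum, Finset.sum_apply, smul_eq_mul] at h3
    simp only [mul_ite, mul_one, mul_zero, Finset.sum_ite_eq, Finset.mem_univ, if_true] at h3
    simp only [Matrix.mul_apply, mul_comm (jacobian _ z b _)]
    rw [← h3]
    exact Finset.sum_congr rfl fun a _ => mul_comm _ _

end AlmostHermitian

/-! ### Integration in charts -/

namespace Coord

open MeasureTheory

variable {T K : Set R4} {k : R4 → ℝ} {y : R4}

/-- The open sets `T` and `Kᶜ` cover the space; the extension by zero is `k` on the first and `0` on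
the second. -/
theorem contDiff_indicator (hT : IsOpen T) (hK : IsCompact K) (hKT : K ⊆ T)
    (hk : ContDiffOn ℝ ∞ k T) (h0 : ∀ z ∈ T, z ∉ K → k z = 0) :
    ContDiff ℝ ∞ (T.indicator k) := by
  rw [contDiff_iff_contDiffAt]
  intro y
  by_cases hy : y ∈ T
  · refine (hk.contDiffAt (hT.mem_nhds hy)).congr_of_eventuallyEq ?_
    filter_upwards [hT.mem_nhds hy] with z hz
    exact Set.indicator_of_mem hz k
  · have hyK : y ∈ Kᶜ := fun h => hy (hKT h)
    refine (contDiffAt_const (c := (0 : ℝ))).congr_of_eventuallyEq ?_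
    filter_upwards [hK.isClosed.isOpen_compl.mem_nhds hyK] with z hz
    by_cases hzT : z ∈ T
    · rw [Set.indicator_of_mem hzT, h0 z hzT hz]
    · exact Set.indicator_of_notMem hzT k

theorem continuous_indicator_of_compact (hT : IsOpen T) (hK : IsCompact K) (hKT : K ⊆ T)
    (hk : ContinuousOn k T) (h0 : ∀ z ∈ T, z ∉ K → k z = 0) :
    Continuous (T.indicator k) := by
  rw [continuous_iff_continuousAt]
  intro y
  by_cases hy : y ∈ T
  · refine (hk.continuousAt (hT.mem_nhds hy)).congr ?_
    filter_upwards [hT.mem_nhds hy] with z hz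
    exact (Set.indicator_of_mem hz k).symm
  · have hyK : y ∈ Kᶜ := fun h => hy (hKT h)
    refine (continuousAt_const (y := (0 : ℝ))).congr ?_
    filter_upwards [hK.isClosed.isOpen_compl.mem_nhds hyK] with z hz
    by_cases hzT : z ∈ T
    · rw [Set.indicator_of_mem hzT, h0 z hzT hz]
    · exact (Set.indicator_of_notMem hzT k).symm

theorem hasCompactSupport_indicator (hK : IsCompact K) (h0 : ∀ z ∈ T, z ∉ K → k z = 0) :
    HasCompactSupport (T.indicator k) := by
  refine HasCompactSupport.intro hK fun z hz => ?_
  by_cases hzT : z ∈ T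
  · rw [Set.indicator_of_mem hzT, h0 z hzT hz]
  · exact Set.indicator_of_notMem hzT k

theorem integrableOn_of_compact (hT : IsOpen T) (hK : IsCompact K) (hKT : K ⊆ T)
    (hk : ContinuousOn k T) (h0 : ∀ z ∈ T, z ∉ K → k z = 0) : IntegrableOn k T := by
  rw [← integrable_indicator_iff hT.measurableSet]
  exact (continuous_indicator_of_compact hT hK hKT hk h0).integrable_of_hasCompactSupport
    (hasCompactSupport_indicator hK h0)

theorem integral_pderiv_eq_zero {F : R4 → ℝ} (hF : ContDiff ℝ ∞ F) (hc : HasCompactSupport F)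
    (i : Fin 4) : ∫ y, pderiv i F y = 0 := by
  have hd : Continuous fun y => fderiv ℝ F y (EuclideanSpace.single i 1) :=
    (hF.continuous_fderiv (by simp)).clm_apply continuous_const
  have hcd : HasCompactSupport fun y => fderiv ℝ F y (EuclideanSpace.single i 1) :=
    (hc.fderiv ℝ).comp_left (g := fun L : R4 →L[ℝ] ℝ => L (EuclideanSpace.single i 1)) rfl
  -- Integration by parts against the constant function `1`.
  have h := integral_mul_fderiv_eq_neg_fderiv_mul_of_integrable (μ := (volume : Measure R4))
    (f := fun _ => (1 : ℝ)) (g := F) (v := EuclideanSpace.single i (1 : ℝ)) (by simp)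
    (by simpa using hd.integrable_of_hasCompactSupport hcd)
    (by simpa using hF.continuous.integrable_of_hasCompactSupport hc) (by simp)
    (fun x _ => hF.differentiable (by simp) x)
  simpa [pderiv] using h

theorem setIntegral_pderiv_eq_zero (hT : IsOpen T) (hK : IsCompact K) (hKT : K ⊆ T)
    (hk : ContDiffOn ℝ ∞ k T) (h0 : ∀ z ∈ T, z ∉ K → k z = 0) (i : Fin 4) :
    ∫ y in T, pderiv i k y = 0 := by
  rw [← integral_pderiv_eq_zero (contDiff_indicator hT hK hKT hk h0)
    (hasCompactSupport_indicator hK h0) i]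
  have h1 : ∫ y in T, pderiv i k y = ∫ y in T, pderiv i (T.indicator k) y :=
    setIntegral_congr_fun hT.measurableSet fun y hy =>
      pderiv_congr hT hy fun z hz => (Set.indicator_of_mem hz k).symm
  rw [h1]
  refine setIntegral_eq_integral_of_forall_compl_eq_zero fun y hy => ?_
  have hyK : y ∈ Kᶜ := fun h => hy (hKT h)
  rw [pderiv_congr (h := fun _ => 0) hK.isClosed.isOpen_compl hyK, pderiv_const]
  intro z hz
  by_cases hzT : z ∈ T
  · rw [Set.indicator_of_mem hzT, h0 z hzT hz]
  · exact Set.indicator_of_notMem hzT k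

theorem det_fderiv_eq {τ : R4 → R4} (hτ : DifferentiableAt ℝ τ y) :
    (fderiv ℝ τ y).det = (jacobian τ y).det := by
  have h : LinearMap.toMatrix (EuclideanSpace.basisFun (Fin 4) ℝ).toBasis
      (EuclideanSpace.basisFun (Fin 4) ℝ).toBasis (fderiv ℝ τ y : R4 →ₗ[ℝ] R4) = jacobian τ y := by
    ext a i
    rw [← fderiv_single hτ, LinearMap.toMatrix_apply]
    simp
  rw [← h, LinearMap.det_toMatrix]

end Coord

namespace AlmostHermitian

open Coord MeasureTheory

section topology

variable {M : Type*} [TopologicalSpace M] {e e' : OpenPartialHomeomorph M R4} {x : M} {h : M → ℝ}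

theorem mem_overlap (hx : x ∈ e.source) (hx' : x ∈ e'.source) :
    e x ∈ e.target ∩ e.symm ⁻¹' e'.source :=
  ⟨e.map_source hx, by rwa [Set.mem_preimage, e.left_inv hx]⟩

theorem isCompact_image_tsupport [CompactSpace M] (hh : tsupport h ⊆ e.source) : IsCompact (e '' tsupport h) :=
  (isClosed_tsupport h).isCompact.image_of_continuousOn (e.continuousOn.mono hh)

theorem image_tsupport_subset (hh : tsupport h ⊆ e.source) : e '' tsupport h ⊆ e.target := by
  rintro _ ⟨x, hx, rfl⟩
  exact e.map_source (hh hx)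

theorem eq_zero_of_notMem_image {y : R4} (hy : y ∈ e.target) (hn : y ∉ e '' tsupport h) :
    h (e.symm y) = 0 := by
  refine image_eq_zero_of_notMem_tsupport fun hx => hn ⟨e.symm y, hx, e.right_inv hy⟩

end topology

variable {M : Type*} [TopologicalSpace M] [ChartedSpace R4 M] [IsManifold 𝓘(ℝ, R4) ∞ M]
variable {e e' : OpenPartialHomeomorph M R4} {x : M} {S : AlmostHermitian M}

/-! ### Invariant functions on the manifold and integration over a chart. -/

/-- The integral over a chart domain against the Riemannian volume. -/
def chartIntegral (S : AlmostHermitian M) (e : OpenPartialHomeomorph M R4) (h : M → ℝ) : ℝ :=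
  ∫ y in e.target, h (e.symm y) * density (S.metricMatrix e) y

/-- The function `⟨β, ω⟩` on the manifold. -/
def betaTrace (S : AlmostHermitian M) (x : M) : ℝ :=
  contr (S.metricMatrix (chartAt R4 x)) (S.complexMatrix (chartAt R4 x))
    (betaForm (S.metricMatrix (chartAt R4 x)) (S.complexMatrix (chartAt R4 x))) (chartAt R4 x x)

/-- The derivative of a function along the Lee vector field, in a chart. -/
def chartLeeDeriv (S : AlmostHermitian M) (e : OpenPartialHomeomorph M R4) (v : M → ℝ)
    (y : R4) : ℝ :=
  ∑ k, leeVec (S.metricMatrix e) (S.complexMatrix e) k y * pderiv k (fun z => v (e.symm z)) y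

/-- The derivative of a function along the Lee vector field. -/
def leeDeriv (S : AlmostHermitian M) (v : M → ℝ) (x : M) : ℝ :=
  S.chartLeeDeriv (chartAt R4 x) v (chartAt R4 x x)

theorem contDiffOn_comp_symm {v : M → ℝ} (hv : ContMDiff 𝓘(ℝ, R4) 𝓘(ℝ) ∞ v) (he : e ∈ atlas R4 M) :
    ContDiffOn ℝ ∞ (fun z => v (e.symm z)) e.target := by
  rw [← contMDiffOn_iff_contDiffOn]
  exact hv.comp_contMDiffOn (contMDiffOn_symm_of_mem_maximalAtlas (mem_maximalAtlas he))

theorem betaTrace_eq (S : AlmostHermitian M) (he : e ∈ atlas R4 M) (hx : x ∈ e.source) :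
    S.betaTrace x = contr (S.metricMatrix e) (S.complexMatrix e)
      (betaForm (S.metricMatrix e) (S.complexMatrix e)) (e x) := by
  have h := (S.isCoordChange he (chart_mem_atlas R4 x)).contr_betaForm_eq
    (mem_overlap hx (mem_chart_source R4 x))
  rw [transition, e.left_inv hx] at h
  exact h

theorem leeDeriv_eq (S : AlmostHermitian M) {v : M → ℝ} (hv : ContMDiff 𝓘(ℝ, R4) 𝓘(ℝ) ∞ v)
    (he : e ∈ atlas R4 M) (hx : x ∈ e.source) : S.leeDeriv v x = S.chartLeeDeriv e v (e x) := by
  have hc := chart_mem_atlas R4 x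
  have hxc := mem_chart_source R4 x
  have h := (S.isCoordChange he hc).leeVec_pderiv_eq (f := fun z => v (e.symm z))
    (f' := fun z => v ((chartAt R4 x).symm z)) (y := e x)
    (differentiableAt_of_contDiffOn (chartAt R4 x).open_target (contDiffOn_comp_symm hv hc)
      (by rw [transition, e.left_inv hx]; exact (chartAt R4 x).map_source hxc))
    (fun z hz => by rw [transition, (chartAt R4 x).left_inv hz.2])
    (mem_overlap hx hxc)
  rw [transition, e.left_inv hx] at h
  exact h.symm

theorem continuousOn_chartLeeDeriv (S : AlmostHermitian M) {v : M → ℝ}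
    (hv : ContMDiff 𝓘(ℝ, R4) 𝓘(ℝ) ∞ v) (he : e ∈ atlas R4 M) :
    ContinuousOn (S.chartLeeDeriv e v) e.target :=
  continuousOn_finsetSum _ fun k _ => (((S.isHermitianOn he).smooth_leeVec k).continuousOn).mul
    (contDiffOn_pderiv e.open_target (contDiffOn_comp_symm hv he) k).continuousOn

theorem continuous_leeDeriv (S : AlmostHermitian M) {v : M → ℝ}
    (hv : ContMDiff 𝓘(ℝ, R4) 𝓘(ℝ) ∞ v) : Continuous (S.leeDeriv v) := by
  rw [continuous_iff_continuousAt]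
  intro x
  have hx := mem_chart_source R4 x
  have h1 : ContinuousAt (fun x' => S.chartLeeDeriv (chartAt R4 x) v (chartAt R4 x x')) x :=
    ((S.continuousOn_chartLeeDeriv hv (chart_mem_atlas R4 x)).continuousAt
      ((chartAt R4 x).open_target.mem_nhds ((chartAt R4 x).map_source hx))).comp
      ((chartAt R4 x).continuousAt hx)
  refine h1.congr ?_
  filter_upwards [(chartAt R4 x).open_source.mem_nhds hx] with z hz
  exact (S.leeDeriv_eq hv (chart_mem_atlas R4 x) hz).symm

theorem contMDiff_betaTrace (S : AlmostHermitian M) :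
    ContMDiff 𝓘(ℝ, R4) 𝓘(ℝ) ∞ S.betaTrace := by
  intro x
  have hx := mem_chart_source R4 x
  have hc := chart_mem_atlas R4 x
  have hH := S.isHermitianOn hc
  have h1 := ((hH.smooth_contr hH.smooth_betaForm).contDiffAt
    ((chartAt R4 x).open_target.mem_nhds ((chartAt R4 x).map_source hx))).contMDiffAt
  have h2 := h1.comp x (contMDiffAt_of_mem_maximalAtlas (mem_maximalAtlas hc) hx)
  refine h2.congr_of_eventuallyEq ?_
  filter_upwards [(chartAt R4 x).open_source.mem_nhds hx] with z hz
  exact S.betaTrace_eq hc hz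

variable {h : M → ℝ}

theorem integrableOn_chart [CompactSpace M] (S : AlmostHermitian M) (he : e ∈ atlas R4 M) (hc : Continuous h)
    (hh : tsupport h ⊆ e.source) :
    IntegrableOn (fun y => h (e.symm y) * density (S.metricMatrix e) y) e.target :=
  integrableOn_of_compact e.open_target (isCompact_image_tsupport hh) (image_tsupport_subset hh)
    ((hc.comp_continuousOn e.continuousOn_symm).mul
      (S.isHermitianOn he).toIsMetricOn.smooth_density.continuousOn)
    fun z hz hn => by rw [eq_zero_of_notMem_image hz hn, zero_mul]

/-- Both integrals reduce to the overlap, where the Jacobian factor of the change of variables is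
the ratio of the two densities. -/
theorem chartIntegral_eq (S : AlmostHermitian M) (he : e ∈ atlas R4 M) (he' : e' ∈ atlas R4 M)
    (hs : ∀ x, h x ≠ 0 → x ∈ e.source ∧ x ∈ e'.source) :
    S.chartIntegral e h = S.chartIntegral e' h := by
  have ho := isOpen_overlap e e'
  have ho' := isOpen_overlap e' e
  have hτ := S.isCoordChange he he'
  set T := e.target ∩ e.symm ⁻¹' e'.source with hT
  have h1 : S.chartIntegral e h = ∫ y in T, h (e.symm y) * density (S.metricMatrix e) y := by
    refine (setIntegral_eq_of_subset_of_forall_sdiff_eq_zero e.open_target.measurableSet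
      Set.inter_subset_left fun y hy => ?_)
    by_contra hne
    exact hy.2 ⟨hy.1, (hs _ (left_ne_zero_of_mul hne)).2⟩
  have h2 : S.chartIntegral e' h = ∫ y in e'.target ∩ e'.symm ⁻¹' e.source,
      h (e'.symm y) * density (S.metricMatrix e') y := by
    refine (setIntegral_eq_of_subset_of_forall_sdiff_eq_zero e'.open_target.measurableSet
      Set.inter_subset_left fun y hy => ?_)
    by_contra hne
    exact hy.2 ⟨hy.1, (hs _ (left_ne_zero_of_mul hne)).1⟩
  have himg : transition e e' '' T = e'.target ∩ e'.symm ⁻¹' e.source := by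
    ext z
    constructor
    · rintro ⟨y, hy, rfl⟩
      refine ⟨e'.map_source hy.2, ?_⟩
      rw [Set.mem_preimage, transition, e'.left_inv hy.2]
      exact e.map_target hy.1
    · rintro ⟨hz, hz'⟩
      refine ⟨e (e'.symm z), ⟨e.map_source hz', ?_⟩, ?_⟩
      · rw [Set.mem_preimage, e.left_inv hz']
        exact e'.map_target hz
      · rw [transition, e.left_inv hz', e'.right_inv hz]
  have hinj : Set.InjOn (transition e e') T := by
    intro y hy z hz hyz
    have := congrArg e'.symm hyz
    rw [transition, transition, e'.left_inv hy.2, e'.left_inv hz.2] at this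
    rw [← e.right_inv hy.1, ← e.right_inv hz.1, this]
  rw [h1, h2, ← himg, integral_image_eq_integral_abs_det_fderiv_smul volume ho.measurableSet
    (fun y hy => (hτ.differentiableAt hy).hasFDerivAt.hasFDerivWithinAt) hinj]
  refine setIntegral_congr_fun ho.measurableSet fun y hy => ?_
  rw [det_fderiv_eq (hτ.differentiableAt hy), hτ.density_eq hy, transition, e'.left_inv hy.2,
    smul_eq_mul]
  ring

/-- The coordinate form of the first Gray condition. -/
theorem IsAH1.isGrayOn (hS : S.IsAH1) (he : e ∈ atlas R4 M) :
    IsGrayOn (S.metricMatrix e) (S.complexMatrix e) e.target :=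
  (S.isHermitianOn he).isGrayOn fun y hy i j k l => hS e he y hy i j k l

/-- The divergence theorem for functions supported in a chart. -/
theorem IsAH1.chartIntegral_leeDeriv [CompactSpace M] (hS : S.IsAH1) (he : e ∈ atlas R4 M)
    {v : M → ℝ} (hv : ContMDiff 𝓘(ℝ, R4) 𝓘(ℝ) ∞ v) (hsupp : tsupport v ⊆ e.source) :
    S.chartIntegral e (fun x => S.leeDeriv v x + (1 / 4) * (v x * S.betaTrace x)) = 0 := by
  have hA := hS.isGrayOn he
  have hH := hA.toIsHermitianOn
  have hG := hA.toIsMetricOn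
  set G := S.metricMatrix e with hGdef
  set A := S.complexMatrix e with hAdef
  set u : R4 → ℝ := fun z => v (e.symm z) with hu
  have su : ContDiffOn ℝ ∞ u e.target := contDiffOn_comp_symm hv he
  have sX : ∀ k, ContDiffOn ℝ ∞ (fun z => density G z * leeVec G A k z) e.target :=
    fun k => hG.smooth_density.mul (hH.smooth_leeVec k)
  have sF : ∀ k, ContDiffOn ℝ ∞ (fun z => u z * (density G z * leeVec G A k z)) e.target :=
    fun k => su.mul (sX k)
  have hF0 : ∀ k, ∀ z ∈ e.target, z ∉ e '' tsupport v →
      u z * (density G z * leeVec G A k z) = 0 := fun k z hz hn => by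
    rw [hu]; simp only [eq_zero_of_notMem_image hz hn, zero_mul]
  -- The integrand is the coordinate divergence of `v θ^♯`, weighted by the density; its expansion
  -- uses `div θ^♯ = -δθ = ¼⟨β, ω⟩`.
  have h1 : ∑ k, ∫ y in e.target, pderiv k (fun z => u z * (density G z * leeVec G A k z)) y = 0 :=
    Finset.sum_eq_zero fun k _ => setIntegral_pderiv_eq_zero e.open_target
      (isCompact_image_tsupport hsupp) (image_tsupport_subset hsupp) (sF k) (hF0 k) k
  rw [← integral_finsetSum] at h1
  · rw [← h1, chartIntegral]
    refine setIntegral_congr_fun e.open_target.measurableSet fun y hy => ?_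
    have hd := hG.sum_pderiv_density (α := Coord.leeForm G A) hH.smooth_leeForm hy
    rw [hA.codiffOne_leeForm hy] at hd
    rw [S.leeDeriv_eq hv he (e.map_target hy), S.betaTrace_eq he (e.map_target hy),
      e.right_inv hy, chartLeeDeriv]
    have h2 : ∀ k, pderiv k (fun z => u z * (density G z * leeVec G A k z)) y =
        pderiv k u y * (density G y * leeVec G A k y)
          + u y * pderiv k (fun z => density G z * leeVec G A k z) y := fun k =>
      pderiv_mul k (differentiableAt_of_contDiffOn e.open_target su hy)
        (differentiableAt_of_contDiffOn e.open_target (sX k) hy)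
    simp only [h2, Finset.sum_add_distrib, ← Finset.mul_sum]
    have h3 : ∑ k, pderiv k (fun z => density G z * leeVec G A k z) y = _ := hd
    rw [h3, add_mul, Finset.sum_mul]
    congr 1
    · exact Finset.sum_congr rfl fun k _ => by ring
    · ring
  · intro k _
    refine integrableOn_of_compact e.open_target (isCompact_image_tsupport hsupp)
      (image_tsupport_subset hsupp) (contDiffOn_pderiv e.open_target (sF k) k).continuousOn ?_
    intro z hz hn
    have ho : IsOpen (e.target ∩ (e '' tsupport v)ᶜ) :=
      e.open_target.inter (isCompact_image_tsupport hsupp).isClosed.isOpen_compl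
    rw [pderiv_congr (h := fun _ => 0) ho ⟨hz, hn⟩, pderiv_const]
    exact fun w hw => hF0 k w hw.1 hw.2

end AlmostHermitian

/-! ### The divergence theorem and the vanishing of `δθ` -/

namespace AlmostHermitian

open Coord MeasureTheory Filter Topology

variable {M : Type*} [TopologicalSpace M] [ChartedSpace R4 M] [IsManifold 𝓘(ℝ, R4) ∞ M]
variable {e e' : OpenPartialHomeomorph M R4} {x : M} {S : AlmostHermitian M}

/-- A finite smooth partition of unity subordinate to charts. -/
structure ChartPartition (M : Type*) [TopologicalSpace M] [ChartedSpace R4 M] where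
  /-- the finite set of charts, indexed by points -/
  t : Finset M
  /-- the functions of the partition -/
  χ : t → M → ℝ
  smooth : ∀ i, ContMDiff 𝓘(ℝ, R4) 𝓘(ℝ) ∞ (χ i)
  nonneg : ∀ i x, 0 ≤ χ i x
  sum_eq_one : ∀ x, ∑ i, χ i x = 1
  tsupport_subset : ∀ i, tsupport (χ i) ⊆ (chartAt R4 (i : M)).source

theorem nonempty_chartPartition [T2Space M] [CompactSpace M] : Nonempty (ChartPartition M) := by
  obtain ⟨t, ht⟩ := isCompact_univ.elim_finite_subcover (fun x : M => (chartAt R4 x).source)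
    (fun x => (chartAt R4 x).open_source) fun x _ => Set.mem_iUnion.2 ⟨x, mem_chart_source R4 x⟩
  obtain ⟨f, hf⟩ := SmoothPartitionOfUnity.exists_isSubordinate 𝓘(ℝ, R4) (isClosed_univ (X := M))
    (fun i : t => (chartAt R4 (i : M)).source) (fun i => (chartAt R4 (i : M)).open_source)
    (fun x hx => by
      obtain ⟨i, hi, hxi⟩ := Set.mem_iUnion₂.1 (ht hx)
      exact Set.mem_iUnion.2 ⟨⟨i, hi⟩, hxi⟩)
  refine ⟨⟨t, fun i => f i, fun i => (f i).contMDiff, fun i x => f.nonneg i x, fun x => ?_, hf⟩⟩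
  rw [← finsum_eq_sum_of_fintype]
  exact f.sum_eq_one (Set.mem_univ x)

namespace ChartPartition

variable (p : ChartPartition M)

/-- The chart belonging to a member of the partition. -/
def chart (i : p.t) : OpenPartialHomeomorph M R4 := chartAt R4 (i : M)

omit [IsManifold 𝓘(ℝ, R4) ∞ M] in
theorem chart_mem (i : p.t) : p.chart i ∈ atlas R4 M := chart_mem_atlas R4 _

/-- The integral of a continuous function over the manifold. -/
def integral (S : AlmostHermitian M) (h : M → ℝ) : ℝ :=
  ∑ i, S.chartIntegral (p.chart i) fun x => p.χ i x * h x

omit [IsManifold 𝓘(ℝ, R4) ∞ M] in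
theorem tsupport_mul_subset (i : p.t) (h : M → ℝ) :
    tsupport (fun x => p.χ i x * h x) ⊆ (p.chart i).source :=
  (tsupport_mul_subset_left (f := p.χ i) (g := h)).trans (p.tsupport_subset i)

theorem integrableOn [CompactSpace M] (S : AlmostHermitian M) (i : p.t) {h : M → ℝ}
    (hh : Continuous h) :
    IntegrableOn (fun y => p.χ i ((p.chart i).symm y) * h ((p.chart i).symm y)
      * density (S.metricMatrix (p.chart i)) y) (p.chart i).target :=
  S.integrableOn_chart (h := fun x => p.χ i x * h x) (p.chart_mem i)
    ((p.smooth i).continuous.mul hh) (p.tsupport_mul_subset i h)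

theorem integral_add [CompactSpace M] (S : AlmostHermitian M) {h k : M → ℝ} (hh : Continuous h)
    (hk : Continuous k) :
    p.integral S (fun x => h x + k x) = p.integral S h + p.integral S k := by
  simp only [integral, chartIntegral]
  rw [← Finset.sum_add_distrib]
  refine Finset.sum_congr rfl fun i _ => ?_
  rw [← MeasureTheory.integral_add (p.integrableOn S i hh) (p.integrableOn S i hk)]
  simp only [mul_add, add_mul]

theorem integral_sum [CompactSpace M] (S : AlmostHermitian M) {ι : Type*} (s : Finset ι)
    {h : ι → M → ℝ} (hh : ∀ j ∈ s, Continuous (h j)) :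
    p.integral S (fun x => ∑ j ∈ s, h j x) = ∑ j ∈ s, p.integral S (h j) := by
  simp only [integral, chartIntegral]
  rw [Finset.sum_comm]
  refine Finset.sum_congr rfl fun i _ => ?_
  rw [← MeasureTheory.integral_finsetSum _ fun j hj => p.integrableOn S i (hh j hj)]
  simp only [Finset.mul_sum, Finset.sum_mul]

/-- Each `χ_i h` is supported in both charts, so its integral can be moved to chart `j`, where `∑
χ_i = 1` reassembles `h`. -/
theorem integral_eq_chartIntegral [CompactSpace M] (S : AlmostHermitian M) (j : p.t) {h : M → ℝ}
    (hc : Continuous h) (hsupp : tsupport h ⊆ (p.chart j).source) :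
    p.integral S h = S.chartIntegral (p.chart j) h := by
  have h1 : ∀ i, S.chartIntegral (p.chart i) (fun x => p.χ i x * h x) =
      S.chartIntegral (p.chart j) fun x => p.χ i x * h x := fun i =>
    S.chartIntegral_eq (p.chart_mem i) (p.chart_mem j) fun x hx =>
      ⟨p.tsupport_subset i (subset_tsupport _ (left_ne_zero_of_mul hx)),
        hsupp (subset_tsupport _ (right_ne_zero_of_mul hx))⟩
  simp only [integral, h1]
  simp only [chartIntegral]
  rw [← MeasureTheory.integral_finsetSum]
  · simp only [← Finset.sum_mul, p.sum_eq_one, one_mul]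
  · intro i _
    refine S.integrableOn_chart (h := fun x => p.χ i x * h x) (p.chart_mem j)
      ((p.smooth i).continuous.mul hc) ?_
    exact (tsupport_mul_subset_right (f := p.χ i) (g := h)).trans hsupp

end ChartPartition

theorem leeDeriv_sum (S : AlmostHermitian M) {ι : Type*} (s : Finset ι) {v : ι → M → ℝ}
    (hv : ∀ j ∈ s, ContMDiff 𝓘(ℝ, R4) 𝓘(ℝ) ∞ (v j)) (x : M) :
    S.leeDeriv (fun x => ∑ j ∈ s, v j x) x = ∑ j ∈ s, S.leeDeriv (v j) x := by
  have hx : chartAt R4 x x ∈ (chartAt R4 x).target :=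
    (chartAt R4 x).map_source (mem_chart_source R4 x)
  simp only [leeDeriv, chartLeeDeriv]
  rw [Finset.sum_comm]
  refine Finset.sum_congr rfl fun k _ => ?_
  rw [pderiv_sum _ _ fun j hj => differentiableAt_of_contDiffOn (chartAt R4 x).open_target
    (contDiffOn_comp_symm (hv j hj) (chart_mem_atlas R4 x)) hx, Finset.mul_sum]

theorem leeDeriv_eq_zero_of_notMem_tsupport (S : AlmostHermitian M) {v : M → ℝ}
    (hx : x ∉ tsupport v) : S.leeDeriv v x = 0 := by
  simp only [leeDeriv, chartLeeDeriv]
  set c := chartAt R4 x with hc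
  have hxc := mem_chart_source R4 x
  have ho : IsOpen (c.target ∩ c.symm ⁻¹' (tsupport v)ᶜ) :=
    c.symm.isOpen_inter_preimage (isClosed_tsupport v).isOpen_compl
  refine Finset.sum_eq_zero fun k _ => ?_
  rw [pderiv_congr (h := fun _ => 0) ho ⟨c.map_source hxc, ?_⟩, pderiv_const, mul_zero]
  · exact fun z hz => image_eq_zero_of_notMem_tsupport hz.2
  · rw [Set.mem_preimage, c.left_inv hxc]
    exact hx

/-- The divergence theorem for the Lee vector field. -/
theorem IsAH1.integral_leeDeriv [CompactSpace M] (hS : S.IsAH1) (p : ChartPartition M)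
    {v : M → ℝ} (hv : ContMDiff 𝓘(ℝ, R4) 𝓘(ℝ) ∞ v) :
    p.integral S (fun x => S.leeDeriv v x + (1 / 4) * (v x * S.betaTrace x)) = 0 := by
  -- The integrand is linear in `v`, so `v` may be split into pieces supported in single charts.
  let w : p.t → M → ℝ := fun i x => p.χ i x * v x
  have hw : ∀ i, ContMDiff 𝓘(ℝ, R4) 𝓘(ℝ) ∞ (w i) := fun i => (p.smooth i).mul hv
  have hvw : v = fun x => ∑ i, w i x := by
    funext x
    simp only [w, ← Finset.sum_mul, p.sum_eq_one, one_mul]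
  let D : (M → ℝ) → M → ℝ := fun u x => S.leeDeriv u x + (1 / 4) * (u x * S.betaTrace x)
  have hDc : ∀ i, Continuous (D (w i)) := fun i => (S.continuous_leeDeriv (hw i)).add
    (continuous_const.mul ((hw i).continuous.mul S.contMDiff_betaTrace.continuous))
  have hD : (fun x => S.leeDeriv v x + (1 / 4) * (v x * S.betaTrace x)) =
      fun x => ∑ i, D (w i) x := by
    funext x
    simp only [D]
    rw [Finset.sum_add_distrib, ← S.leeDeriv_sum _ fun i _ => hw i, ← hvw, ← Finset.mul_sum,
      ← Finset.sum_mul]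
    simp only [hvw]
  rw [hD, p.integral_sum S _ fun i _ => hDc i]
  refine Finset.sum_eq_zero fun i _ => ?_
  have hts : tsupport (w i) ⊆ (p.chart i).source := p.tsupport_mul_subset i v
  rw [p.integral_eq_chartIntegral S i (hDc i)]
  · exact hS.chartIntegral_leeDeriv (p.chart_mem i) (hw i) hts
  · refine (closure_minimal (fun x hx => ?_) (isClosed_tsupport (w i))).trans hts
    by_contra hn
    refine hx ?_
    simp only [D]
    rw [S.leeDeriv_eq_zero_of_notMem_tsupport hn, image_eq_zero_of_notMem_tsupport hn]
    simp

/-- The derivative of `⟨β, ω⟩` along the Lee vector field vanishes where `⟨β, ω⟩` does. -/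
theorem IsAH1.leeDeriv_betaTrace (hS : S.IsAH1) (he : e ∈ atlas R4 M)
    (hs : ∀ y ∈ e.target, S.scalarCurvature e y ≠ 0) :
    ∃ κ : R4 → ℝ, ContinuousOn κ e.target ∧
      ∀ x ∈ e.source, S.leeDeriv S.betaTrace x = κ (e x) * S.betaTrace x := by
  have hA := hS.isGrayOn he
  have hH := hA.toIsHermitianOn
  set G := S.metricMatrix e with hGdef
  set A := S.complexMatrix e with hAdef
  have sr : ContDiffOn ℝ ∞ (contr G A (rhoForm G A)) e.target := hH.smooth_contr hH.smooth_rhoForm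
  -- Since `⟨ρ, ω⟩ = -2s`, this `κ` is the derivative of `log |s|` along the Lee field; it is
  -- continuous because `s` has no zeros.
  refine ⟨fun y => (∑ k, leeVec G A k y * pderiv k (contr G A (rhoForm G A)) y)
    / contr G A (rhoForm G A) y, ?_, fun x hx => ?_⟩
  · refine ContinuousOn.div (continuousOn_finsetSum _ fun k _ => ?_) sr.continuousOn fun y hy => ?_
    · exact (hH.smooth_leeVec k).continuousOn.mul
        (contDiffOn_pderiv e.open_target sr k).continuousOn
    · rw [hA.contr_rhoForm hy]
      exact mul_ne_zero (by norm_num) (hs y hy)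
  · have hy := e.map_source hx
    rw [S.leeDeriv_eq S.contMDiff_betaTrace he hx, S.betaTrace_eq he hx,
      ← hA.leeVec_contr_beta hs hy, chartLeeDeriv]
    refine Finset.sum_congr rfl fun k _ => ?_
    congr 1
    refine pderiv_congr e.open_target hy fun z hz => ?_
    rw [S.betaTrace_eq he (e.map_target hz), e.right_inv hz]

theorem leeDeriv_comp (S : AlmostHermitian M) {v : M → ℝ} (hv : ContMDiff 𝓘(ℝ, R4) 𝓘(ℝ) ∞ v)
    {w : ℝ → ℝ} {w' : ℝ} (hw : HasDerivAt w w' (v x)) :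
    S.leeDeriv (fun x => w (v x)) x = w' * S.leeDeriv v x := by
  have hxc := mem_chart_source R4 x
  have hx : chartAt R4 x x ∈ (chartAt R4 x).target := (chartAt R4 x).map_source hxc
  simp only [leeDeriv, chartLeeDeriv]
  set c := chartAt R4 x with hc
  have hd := differentiableAt_of_contDiffOn c.open_target
    (contDiffOn_comp_symm hv (chart_mem_atlas R4 x)) hx
  have hw2 : HasDerivAt w w' (v (c.symm (c x))) := by rwa [c.left_inv hxc]
  have h1 := hw2.comp_hasFDerivAt (c x) hd.hasFDerivAt
  rw [Finset.mul_sum]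
  refine Finset.sum_congr rfl fun k _ => ?_
  have h2 : pderiv k (fun z => w (v (c.symm z))) (c x) =
      w' * pderiv k (fun z => v (c.symm z)) (c x) := by
    simp only [pderiv]
    change fderiv ℝ (w ∘ fun z => v (c.symm z)) (c x) _ = _
    rw [h1.fderiv]
    rfl
  rw [h2]
  ring

/-! ### Elementary estimates for the test functions `arctan(nq)`. -/

theorem tendsto_mul_div_one_add_sq (q : ℝ) :
    Tendsto (fun n : ℕ => (n : ℝ) * q / (1 + ((n : ℝ) * q) ^ 2)) atTop (𝓝 0) := by
  rcases eq_or_ne q 0 with rfl | hq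
  · simp
  have h1 : Tendsto (fun n : ℕ => ((n : ℝ) * |q|)⁻¹) atTop (𝓝 0) :=
    (tendsto_natCast_atTop_atTop.atTop_mul_const (abs_pos.2 hq)).inv_tendsto_atTop
  refine squeeze_zero_norm' ?_ h1
  filter_upwards [eventually_gt_atTop 0] with n hn
  have hn' : (0 : ℝ) < n := Nat.cast_pos.2 hn
  have ha : 0 < (n : ℝ) * |q| := mul_pos hn' (abs_pos.2 hq)
  rw [Real.norm_eq_abs, abs_div, abs_mul, abs_of_pos hn',
    abs_of_pos (by positivity : (0 : ℝ) < 1 + ((n : ℝ) * q) ^ 2), ← one_div,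
    div_le_div_iff₀ (by positivity) ha, mul_pow, ← sq_abs q]
  nlinarith

theorem abs_mul_div_one_add_sq_le (t : ℝ) : |t / (1 + t ^ 2)| ≤ 1 := by
  rw [abs_div, abs_of_pos (by positivity : (0 : ℝ) < 1 + t ^ 2), div_le_one (by positivity)]
  rw [← sq_abs t]
  nlinarith [sq_nonneg (|t| - 1)]

theorem mul_arctan_le {n : ℕ} (hn : 1 ≤ n) (q : ℝ) :
    q * Real.arctan q ≤ q * Real.arctan (n * q) := by
  have hn' : (1 : ℝ) ≤ n := Nat.one_le_cast.2 hn
  rcases le_total 0 q with hq | hq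
  · exact mul_le_mul_of_nonneg_left (Real.arctan_strictMono.monotone (by nlinarith)) hq
  · exact mul_le_mul_of_nonpos_left (Real.arctan_strictMono.monotone (by nlinarith)) hq

theorem mul_arctan_nonneg (q : ℝ) : 0 ≤ q * Real.arctan q := by
  rcases le_total 0 q with hq | hq
  · exact mul_nonneg hq (Real.arctan_nonneg.2 hq)
  · exact mul_nonneg_of_nonpos_of_nonpos hq (by
      simpa using Real.arctan_strictMono.monotone hq)

namespace ChartPartition

variable (p : ChartPartition M)

theorem chartIntegral_mono [CompactSpace M] (S : AlmostHermitian M) {h k : M → ℝ}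
    (hh : Continuous h) (hk : Continuous k) (hle : ∀ x, h x ≤ k x) (i : p.t) :
    S.chartIntegral (p.chart i) (fun x => p.χ i x * h x) ≤
      S.chartIntegral (p.chart i) fun x => p.χ i x * k x := by
  refine setIntegral_mono_on (p.integrableOn S i hh) (p.integrableOn S i hk)
    (p.chart i).open_target.measurableSet fun y hy => ?_
  exact mul_le_mul_of_nonneg_right (mul_le_mul_of_nonneg_left (hle _) (p.nonneg i _))
    ((S.isHermitianOn (p.chart_mem i)).toIsMetricOn.density_pos hy).le

/-- Every chart contribution is nonnegative, hence zero. As the density is positive, continuity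
forces each `χ_i h` to vanish, and `h` is their sum. -/
theorem eq_zero_of_integral_nonpos [CompactSpace M] (S : AlmostHermitian M) {h : M → ℝ}
    (hc : Continuous h) (h0 : ∀ x, 0 ≤ h x) (hint : p.integral S h ≤ 0) (x : M) : h x = 0 := by
  have h1 : ∀ i, 0 ≤ S.chartIntegral (p.chart i) fun x => p.χ i x * h x := by
    intro i
    have := p.chartIntegral_mono S continuous_const hc h0 i
    simpa [chartIntegral] using this
  have h2 : ∀ i, S.chartIntegral (p.chart i) (fun x => p.χ i x * h x) = 0 := by
    have h3 : ∑ i, S.chartIntegral (p.chart i) (fun x => p.χ i x * h x) = 0 :=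
      le_antisymm hint (Finset.sum_nonneg fun i _ => h1 i)
    exact fun i => (Finset.sum_eq_zero_iff_of_nonneg fun i _ => h1 i).1 h3 i (Finset.mem_univ i)
  have h4 : ∀ i, p.χ i x * h x = 0 := by
    intro i
    by_contra hne
    set c := p.chart i with hcdef
    have hG := (S.isHermitianOn (p.chart_mem i)).toIsMetricOn
    have hxs : x ∈ c.source :=
      p.tsupport_subset i (subset_tsupport _ (left_ne_zero_of_mul hne))
    have hts := p.tsupport_mul_subset i h
    let k : R4 → ℝ := fun y => p.χ i (c.symm y) * h (c.symm y) * density (S.metricMatrix c) y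
    have hk : ContinuousOn k c.target :=
      (((p.smooth i).continuous.mul hc).comp_continuousOn c.continuousOn_symm).mul
        hG.smooth_density.continuousOn
    have hk0 : ∀ z ∈ c.target, z ∉ c '' tsupport (fun x => p.χ i x * h x) → k z = 0 := by
      intro z hz hn
      have : p.χ i (c.symm z) * h (c.symm z) = 0 :=
        eq_zero_of_notMem_image (h := fun x => p.χ i x * h x) hz hn
      simp only [k, this, zero_mul]
    have hK := isCompact_image_tsupport hts
    have hpos := (continuous_indicator_of_compact c.open_target hK (image_tsupport_subset hts)
      hk hk0).integral_pos_of_hasCompactSupport_nonneg_nonzero (μ := volume) (x := c x)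
      (hasCompactSupport_indicator hK hk0)
      (fun y => Set.indicator_nonneg (fun z hz => mul_nonneg (mul_nonneg (p.nonneg i _) (h0 _))
        (hG.density_pos hz).le) y)
      (by
        rw [Set.indicator_of_mem (c.map_source hxs)]
        simp only [k]
        rw [c.left_inv hxs]
        exact mul_ne_zero hne (hG.density_pos (c.map_source hxs)).ne')
    rw [integral_indicator c.open_target.measurableSet] at hpos
    exact hpos.ne' (h2 i)
  have h5 : ∑ i, p.χ i x * h x = 0 := Finset.sum_eq_zero fun i _ => h4 i
  rwa [← Finset.sum_mul, p.sum_eq_one, one_mul] at h5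

end ChartPartition

theorem contMDiff_arctan_betaTrace (S : AlmostHermitian M) (n : ℕ) :
    ContMDiff 𝓘(ℝ, R4) 𝓘(ℝ) ∞ fun x => Real.arctan (n * S.betaTrace x) :=
  (Real.contDiff_arctan.comp (contDiff_const.mul contDiff_id)).contMDiff.comp S.contMDiff_betaTrace

/-- Dominated convergence in each chart: by the chain rule and `θ^♯(q) = κq`, the integrand is a
fixed function times `nq / (1 + n²q²)`, which is bounded by `1` and tends to `0` pointwise, also
where `q = 0`. -/
theorem IsAH1.tendsto_integral [CompactSpace M] (hS : S.IsAH1)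
    (hs : ∀ e ∈ atlas R4 M, ∀ y ∈ e.target, S.scalarCurvature e y ≠ 0) (p : ChartPartition M) :
    Tendsto (fun n : ℕ => p.integral S (S.leeDeriv fun x => Real.arctan (n * S.betaTrace x)))
      atTop (𝓝 0) := by
  rw [← Finset.sum_const_zero (s := (Finset.univ : Finset p.t)) (M := ℝ)]
  refine tendsto_finsetSum _ fun i _ => ?_
  have he := p.chart_mem i
  set c := p.chart i with hc
  obtain ⟨κ, hκ, hκq⟩ := hS.leeDeriv_betaTrace he (hs c he)
  have hG := (S.isHermitianOn he).toIsMetricOn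
  have hval : ∀ n : ℕ, ∀ y ∈ c.target,
      S.leeDeriv (fun x => Real.arctan (n * S.betaTrace x)) (c.symm y) =
      (n * S.betaTrace (c.symm y) / (1 + (n * S.betaTrace (c.symm y)) ^ 2)) * κ y := by
    intro n y hy
    have hw : HasDerivAt (fun t : ℝ => Real.arctan (n * t))
        (1 / (1 + (n * S.betaTrace (c.symm y)) ^ 2) * (n * 1)) (S.betaTrace (c.symm y)) :=
      ((hasDerivAt_id _).const_mul (n : ℝ)).arctan
    rw [S.leeDeriv_comp S.contMDiff_betaTrace hw, hκq _ (c.map_target hy), c.right_inv hy]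
    ring
  have hts := p.tsupport_subset i
  have hbound : IntegrableOn (fun y => |p.χ i (c.symm y) * κ y * density (S.metricMatrix c) y|)
      c.target := by
    refine Integrable.abs (integrableOn_of_compact c.open_target (isCompact_image_tsupport hts)
      (image_tsupport_subset hts) ((((p.smooth i).continuous.comp_continuousOn
        c.continuousOn_symm).mul hκ).mul hG.smooth_density.continuousOn) fun z hz hn => ?_)
    rw [eq_zero_of_notMem_image hz hn, zero_mul, zero_mul]
  have hlim : ∫ y in c.target, (0 : ℝ) = 0 := by simp
  rw [← hlim]
  refine tendsto_integral_of_dominated_convergence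
    (fun y => |p.χ i (c.symm y) * κ y * density (S.metricMatrix c) y|) (fun n => ?_) hbound
    (fun n => ?_) ?_
  · exact (p.integrableOn S i
      (S.continuous_leeDeriv (S.contMDiff_arctan_betaTrace n))).aestronglyMeasurable
  · filter_upwards [ae_restrict_mem c.open_target.measurableSet] with y hy
    rw [hval n y hy, Real.norm_eq_abs]
    have := abs_mul_div_one_add_sq_le (n * S.betaTrace (c.symm y))
    set a := (n : ℝ) * S.betaTrace (c.symm y) / (1 + (n * S.betaTrace (c.symm y)) ^ 2)
    calc |p.χ i (c.symm y) * (a * κ y) * density (S.metricMatrix c) y|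
        = |a| * |p.χ i (c.symm y) * κ y * density (S.metricMatrix c) y| := by
          rw [← abs_mul]; congr 1; ring
      _ ≤ _ := mul_le_of_le_one_left (abs_nonneg _) this
  · filter_upwards [ae_restrict_mem c.open_target.measurableSet] with y hy
    have h1 := (tendsto_mul_div_one_add_sq (S.betaTrace (c.symm y))).mul_const
      (p.χ i (c.symm y) * κ y * density (S.metricMatrix c) y)
    rw [zero_mul] at h1
    refine h1.congr fun n => ?_
    rw [hval n y hy]
    ring

/-- On a compact manifold with nowhere vanishing scalar curvature, `⟨β, ω⟩` vanishes. -/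
theorem IsAH1.betaTrace_eq_zero [T2Space M] [CompactSpace M] (hS : S.IsAH1)
    (hs : ∀ e ∈ atlas R4 M, ∀ y ∈ e.target, S.scalarCurvature e y ≠ 0) (x : M) :
    S.betaTrace x = 0 := by
  obtain ⟨p⟩ := nonempty_chartPartition (M := M)
  have hq := S.contMDiff_betaTrace.continuous
  have hcont : ∀ n : ℕ, Continuous fun x => S.betaTrace x * Real.arctan (n * S.betaTrace x) :=
    fun n => hq.mul (S.contMDiff_arctan_betaTrace n).continuous
  have hc1 : Continuous fun x => S.betaTrace x * Real.arctan (S.betaTrace x) :=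
    hq.mul (Real.continuous_arctan.comp hq)
  have h1 : ∀ n : ℕ, p.integral S (fun x => (1 / 4) * (S.betaTrace x
      * Real.arctan (n * S.betaTrace x))) =
      -p.integral S (S.leeDeriv fun x => Real.arctan (n * S.betaTrace x)) := by
    intro n
    have h := hS.integral_leeDeriv p (S.contMDiff_arctan_betaTrace n)
    simp only [mul_comm (Real.arctan _) (S.betaTrace _)] at h
    rw [p.integral_add S (S.continuous_leeDeriv (S.contMDiff_arctan_betaTrace n))
      (k := fun x => (1 / 4) * (S.betaTrace x * Real.arctan (n * S.betaTrace x)))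
      (continuous_const.mul (hcont n))] at h
    exact eq_neg_of_add_eq_zero_right h
  have h2 : p.integral S (fun x => (1 / 4) * (S.betaTrace x * Real.arctan (S.betaTrace x))) ≤ 0 := by
    have h3 := (hS.tendsto_integral hs p).neg
    rw [neg_zero] at h3
    refine ge_of_tendsto h3 ?_
    -- For `n ≥ 1` the integrand `q arctan(nq)` dominates `q arctan q`, so the limit `0` bounds the
    -- integral of the latter from above.
    filter_upwards [eventually_ge_atTop 1] with n hn
    rw [← h1 n]
    exact Finset.sum_le_sum fun i _ => p.chartIntegral_mono S (continuous_const.mul hc1)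
      (continuous_const.mul (hcont n))
      (fun x => mul_le_mul_of_nonneg_left (mul_arctan_le hn _) (by norm_num)) i
  have h4 := p.eq_zero_of_integral_nonpos S (continuous_const.mul hc1)
    (fun x => mul_nonneg (by norm_num) (mul_arctan_nonneg _)) h2 x
  have h5 := (mul_eq_zero.1 h4).resolve_left (by norm_num)
  rcases mul_eq_zero.1 h5 with h | h
  · exact h
  · exact Real.arctan_eq_zero_iff.1 h

end AlmostHermitian

end

theorem proposition5p4 {M : Type*} [TopologicalSpace M] [T2Space M] [CompactSpace M]
    [ChartedSpace R4 M] [IsManifold 𝓘(ℝ, R4) ∞ M] (S : AlmostHermitian M)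
    (hAH1 : S.IsAH1)
    (hs : ∀ e ∈ atlas R4 M, ∀ y ∈ e.target, S.scalarCurvature e y ≠ 0) :
    ∀ e ∈ atlas R4 M, ∀ y ∈ e.target, S.codiffLee e y = 0 := by
  intro e he y hy
  have h := S.betaTrace_eq he (e.map_target hy)
  rw [hAH1.betaTrace_eq_zero hs, e.right_inv hy] at h
  exact ((hAH1.isGrayOn he).codiffOne_leeForm hy).trans (by rw [← h, mul_zero])
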